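/- Fix an o-minimal expansion $\mathcal R$ of a real closed field $R$, with the order topology on $R$ and the product topology on $R^n$; "definable" means definable in $\mathcal R$ with parameters, and $I=[0,1]\subset R$. A *locally definable space* is a set $M$ with an atlas: a family of subsets $M_i$ ($i\in\Lambda$) covering $M$ and bijections $\phi_i$ from $M_i$ onto definable sets $Z_i\subset R^{n(i)}$ such that each $\phi_i(M_i\cap M_j)$ is definable and relatively open in $Z_i$ and each $\phi_j\circ\phi_i^{-1}:\phi_i(M_i\cap M_j)\to\phi_j(M_i\cap M_j)$ is continuous and definable. It carries the topology in which the $M_i$ are open and the $\phi_i$ are homeomorphisms. A set $X\subset M$ is a *definable subspace* if it lies in a finite union $\bigcup_{j\in J}M_j$ with $\phi_j(M_j\cap X)$ definable for all $j\in J$, and an *admissible subspace* if $\phi_i(M_i\cap X)$ is definable for all $i$; admissible subspaces inherit a locally definable structure, and products of locally definable spaces have the product atlas. An *LD-space* is a locally definable space that is Hausdorff, regular, and paracompact in the sense that it is covered by a family of open definable subspaces of which each $M_i$ meets only finitely many. An *ld-map* $f:M\to N$ is a continuous map such that each $f(M_i)$ is a definable subspace of $N$ and each $f|_{M_i}:M_i\to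 f(M_i)$ has definable graph. A nonempty admissible subspace $X$ is *connected* if no admissible subspace $U$ makes $X\cap U$ a nonempty proper clopen subset of $X$; connected components are maximal connected subsets. Definable subsets of $R^n$ are regarded as locally definable spaces with one chart. For an LD-space $M$, an admissible subspace $A$ and $x_0\in A$, let $\pi_n(M,x_0)^{\mathcal R}$ ($n\ge1$) be the set of ld-homotopy classes of ld-maps $(I^n,\partial I^n)\to(M,x_0)$, and $\pi_n(M,A,x_0)^{\mathcal R}$ ($n\ge 1$) the set of ld-homotopy classes of ld-maps $(I^n,I^{n-1},J^{n-1})\to(M,A,x_0)$, where $I^{n-1}=\{t\in I^n: t_n=0\}$ and $J^{n-1}=\overline{\partial I^n\setminus I^{n-1}}$. Concatenation in the first coordinate makes them groups for $n\ge1$ and for $n\ge2$, respectively. For an ld-map $p$ we write $p_*[f]=[p\circ f]$. An ld-map $p:E\to B$ of LD-spaces is a *fibration* (respectively a *Serre fibration*) if for every definable (respectively every closed and bounded definable) set $X\subset R^n$, $n\ge 0$, all ld-maps $f:X\to E$ and $H:X\times I\to B$ with $H(x,0)=p(f(x))$ admit an ld-map $G:X\times I\to E$ with $G(x,0)=f(x)$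 and $p\circ G=H$. It is a *covering map* if it is surjective and $B$ has a covering $\mathcal U$ by open definable subspaces, with each chart domain of $B$ contained in the union of finitely many members of $\mathcal U$, such that for every $U\in\mathcal U$ and every connected component $V$ of $p^{-1}(U)$ the restriction $p|_V:V\to U$ is an ld-homeomorphism (a bijective ld-map with inverse an ld-map). **Theorem.** Let $E$ and $B$ be LD-spaces and $p:E\to B$ an ld-map. 1. If $p$ is a Serre fibration, then for every $b_0\in B$ and every $e_0\in F:=p^{-1}(b_0)$ the induced map $p_*:\pi_n(E,F,e_0)^{\mathcal R}\to\pi_n(B,b_0)^{\mathcal R}$ is a bijection for $n=1$ and a group isomorphism for all $n\ge2$. 2. If $p$ is a covering map, then $p$ is a fibration. 3. If $p$ is a covering map and $p(e_0)=b_0$, then $p_*:\pi_n(E,e_0)^{\mathcal R}\to\pi_n(B,b_0)^{\mathcal R}$ is a group isomorphism for every $n>1$ and injective for $n=1$. -/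

import Mathlib

universe u v w x y

open Set Topology

section OMinimal

variable (L : FirstOrder.Language.{u, v}) {R : Type w} [L.Structure R]

/-- Definability with parameters from the whole structure. -/
abbrev IsDefinable {α : Type x} (s : Set (α → R)) : Prop :=
  (Set.univ : Set R).Definable L s

variable (R) [Field R] [LinearOrder R]

/-- The `L`-structure on the ordered field `R` is an o-minimal expansion of that ordered field:
the graphs of addition and multiplication and the order are definable, and every definable subset
of the line is a finite union of points and open intervals with end points in `R ∪ {-∞, +∞}`. -/
class IsOMinimalExpansion : Prop where
  definable_add : (Set.univ : Set R).DefinableFun L fun a : Fin 2 → R => a 0 + a 1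
  definable_mul : (Set.univ : Set R).DefinableFun L fun a : Fin 2 → R => a 0 * a 1
  definable_lt : (Set.univ : Set R).Definable₂ L {a : R × R | a.1 < a.2}
  finite_union : ∀ s : Set R, (Set.univ : Set R).Definable₁ L s →
    ∃ F : Set (Set R), F.Finite ∧ s = ⋃₀ F ∧
      ∀ t ∈ F, (∃ a, t = {a}) ∨ (∃ a b, t = Ioo a b) ∨ (∃ a, t = Iio a) ∨ (∃ a, t = Ioi a) ∨
        t = Set.univ

end OMinimal

section DefinableCalculus

variable {L : FirstOrder.Language.{u, v}} {R : Type w} [L.Structure R] {α : Type x} {β : Type y}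

theorem IsDefinable.image_map [Finite α] [Finite β] {F : (α → R) → (β → R)}
    (hF : (Set.univ : Set R).DefinableMap L F) {s : Set (α → R)} (hs : IsDefinable L s) :
    IsDefinable L (F '' s) := by
  have hG : IsDefinable L {c : α ⊕ β → R | ∀ i, F (c ∘ Sum.inl) i = c (Sum.inr i)} := by
    have := Set.definable_iInter_of_finite (L := L) (A := (Set.univ : Set R))
      (f := fun i : β => {c : α ⊕ β → R | F (c ∘ Sum.inl) i = c (Sum.inr i)}) (fun i => by
        simpa [Function.tupleGraph] using!
          (hF i).preimage_comp (fun | none => Sum.inr i | some j => Sum.inl j))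
    convert! this using 1
    ext c
    simp
  have h := (hG.inter (hs.preimage_comp Sum.inl)).image_comp (Sum.inr : β → α ⊕ β)
  convert! h using 1
  ext b
  constructor
  · rintro ⟨a, ha, rfl⟩
    exact ⟨Sum.elim a (F a), ⟨fun i => by simp [Function.comp_def], by simpa using ha⟩, by
      ext; simp⟩
  · rintro ⟨c, ⟨h1, h2⟩, rfl⟩
    exact ⟨c ∘ Sum.inl, h2, funext fun i => h1 i⟩

theorem definableFun_const' (c : R) : (Set.univ : Set R).DefinableFun L fun _ : α → R => c :=
  L.definableFun_const α (Set.mem_univ c)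

theorem definableFun_proj' (i : α) : (Set.univ : Set R).DefinableFun L fun a : α → R => a i :=
  Set.DefinableFun.proj L

variable [Field R] [LinearOrder R] [IsOMinimalExpansion L R] {f g : (α → R) → R}

theorem definableFun_add' (hf : (Set.univ : Set R).DefinableFun L f)
    (hg : (Set.univ : Set R).DefinableFun L g) :
    (Set.univ : Set R).DefinableFun L fun a => f a + g a := by
  have h : (Set.univ : Set R).DefinableMap L fun a => ![f a, g a] := by
    simp [Set.DefinableMap, *]
  simpa using Set.DefinableFun.comp h (IsOMinimalExpansion.definable_add (L := L) (R := R))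

theorem definableFun_mul' (hf : (Set.univ : Set R).DefinableFun L f)
    (hg : (Set.univ : Set R).DefinableFun L g) :
    (Set.univ : Set R).DefinableFun L fun a => f a * g a := by
  have h : (Set.univ : Set R).DefinableMap L fun a => ![f a, g a] := by
    simp [Set.DefinableMap, *]
  simpa using Set.DefinableFun.comp h (IsOMinimalExpansion.definable_mul (L := L) (R := R))

theorem definableFun_sub' (hf : (Set.univ : Set R).DefinableFun L f)
    (hg : (Set.univ : Set R).DefinableFun L g) :
    (Set.univ : Set R).DefinableFun L fun a => f a - g a := by
  have h := definableFun_add' hf (definableFun_mul' (definableFun_const' (L := L) (-1 : R)) hg)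
  simpa [sub_eq_add_neg] using h

theorem isDefinable_le (hf : (Set.univ : Set R).DefinableFun L f)
    (hg : (Set.univ : Set R).DefinableFun L g) : IsDefinable L {a | f a ≤ g a} := by
  have h : (Set.univ : Set R).DefinableMap L fun a => ![g a, f a] := by
    simp [Set.DefinableMap, *]
  have := (Set.Definable.preimage_map h (IsOMinimalExpansion.definable_lt (L := L) (R := R))).compl
  convert! this using 1
  ext a
  simp

theorem definableFun_max' (hf : (Set.univ : Set R).DefinableFun L f)
    (hg : (Set.univ : Set R).DefinableFun L g) :
    (Set.univ : Set R).DefinableFun L fun a => max (f a) (g a) := by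
  simp only [max_def]
  exact Set.DefinableFun.ite (isDefinable_le hf hg) hg hf

theorem definableFun_min' (hf : (Set.univ : Set R).DefinableFun L f)
    (hg : (Set.univ : Set R).DefinableFun L g) :
    (Set.univ : Set R).DefinableFun L fun a => min (f a) (g a) := by
  simp only [min_def]
  exact Set.DefinableFun.ite (isDefinable_le hf hg) hf hg

end DefinableCalculus

section Spaces

variable (L : FirstOrder.Language.{u, v}) (R : Type w) [L.Structure R] [TopologicalSpace R]

/-- A locally definable space: a set `M` with an atlas. The chart `φ_i` is the restriction of
`chart i` to `dom i`; the values of `chart i` elsewhere play no role. The target of the `i`-th chart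
is a definable subset of `R ^ coord i` with `coord i` a finite set of coordinates. -/
structure LocDefSpace (M : Type x) where
  /-- the index set of the atlas -/
  ι : Type y
  /-- the coordinates of the `i`-th chart -/
  coord : ι → Type
  finite_coord : ∀ i, Finite (coord i)
  /-- the domain of the `i`-th chart -/
  dom : ι → Set M
  /-- the `i`-th chart -/
  chart : ∀ i, M → coord i → R
  injOn : ∀ i, Set.InjOn (chart i) (dom i)
  covers : ∀ m, ∃ i, m ∈ dom i
  definable_image : ∀ i, IsDefinable L (chart i '' dom i)
  definable_overlap : ∀ i j, IsDefinable L (chart i '' (dom i ∩ dom j))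
  open_overlap : ∀ i j, ∃ O : Set (coord i → R), IsOpen O ∧
    chart i '' (dom i ∩ dom j) = chart i '' dom i ∩ O
  continuous_transition : ∀ i j, ∃ g : (coord i → R) → (coord j → R),
    ContinuousOn g (chart i '' (dom i ∩ dom j)) ∧
      ∀ m ∈ dom i ∩ dom j, g (chart i m) = chart j m
  definable_transition : ∀ i j, IsDefinable L
    {c : coord i ⊕ coord j → R | ∃ m ∈ dom i ∩ dom j, c = Sum.elim (chart i m) (chart j m)}

end Spaces

attribute [instance] LocDefSpace.finite_coord

namespace LocDefSpace

variable {L : FirstOrder.Language.{u, v}} {R : Type w} [L.Structure R] [TopologicalSpace R]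

section Basic

universe x' y'

variable {M : Type x} (D : LocDefSpace.{u, v, w, x, y} L R M)

/-- The topology for which the chart domains are open and the charts are homeomorphisms: `U` is
open if and only if `φ_i (U ∩ M_i)` is relatively open in `φ_i (M_i)` for every `i`. -/
abbrev topology : TopologicalSpace M where
  IsOpen U := ∀ i, ∃ O : Set (D.coord i → R), IsOpen O ∧
    ∀ m ∈ D.dom i, (m ∈ U ↔ D.chart i m ∈ O)
  isOpen_univ i := ⟨Set.univ, isOpen_univ, by simp⟩
  isOpen_inter U V hU hV i := by
    obtain ⟨O, hO, h⟩ := hU i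
    obtain ⟨O', hO', h'⟩ := hV i
    exact ⟨O ∩ O', hO.inter hO', fun m hm => by simp [h m hm, h' m hm]⟩
  isOpen_sUnion S hS i := by
    choose! O hO h using fun U hU => hS U hU i
    refine ⟨⋃ U ∈ S, O U, isOpen_biUnion hO, fun m hm => ?_⟩
    simp only [Set.mem_sUnion, Set.mem_iUnion, exists_prop]
    exact exists_congr fun U => and_congr_right fun hU => h U hU m hm

/-- Definable subspaces. -/
def IsDefinableSubspace (X : Set M) : Prop :=
  ∃ J : Finset D.ι, X ⊆ ⋃ j ∈ J, D.dom j ∧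
    ∀ j ∈ J, IsDefinable L (D.chart j '' (D.dom j ∩ X))

/-- Admissible subspaces. -/
def IsAdmissible (Y : Set M) : Prop :=
  ∀ i, IsDefinable L (D.chart i '' (D.dom i ∩ Y))

theorem definable_transition_image {i j : D.ι} {X : Set M}
    (h : IsDefinable L (D.chart j '' (D.dom j ∩ X))) :
    IsDefinable L (D.chart i '' (D.dom i ∩ D.dom j ∩ X)) := by
  have := ((D.definable_transition i j).inter (h.preimage_comp Sum.inr)).image_comp
    (Sum.inl : D.coord i → D.coord i ⊕ D.coord j)
  convert! this using 1
  ext a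
  constructor
  · rintro ⟨m, ⟨hm, hX⟩, rfl⟩
    exact ⟨_, ⟨⟨m, hm, rfl⟩, ⟨m, ⟨hm.2, hX⟩, by ext; simp⟩⟩, by ext; simp⟩
  · rintro ⟨_, ⟨⟨m, hm, rfl⟩, ⟨m', hm', h'⟩⟩, rfl⟩
    have : m' = m := D.injOn j hm'.1 hm.2 (by simpa using h')
    exact ⟨m, ⟨hm, this ▸ hm'.2⟩, by ext; simp⟩

theorem IsDefinableSubspace.isAdmissible {D : LocDefSpace.{u, v, w, x, y} L R M} {X : Set M}
    (h : D.IsDefinableSubspace X) : D.IsAdmissible X := by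
  obtain ⟨J, hJ, h⟩ := h
  intro i
  have := Set.definable_biUnion_finset (L := L) (A := (Set.univ : Set R))
    (f := fun j : J => D.chart i '' (D.dom i ∩ D.dom j ∩ X))
    (fun j => D.definable_transition_image (h j j.2)) Finset.univ
  convert! this using 1
  ext a
  simp only [Set.mem_iUnion, Finset.mem_univ, exists_prop, true_and]
  constructor
  · rintro ⟨m, ⟨hm, hX⟩, rfl⟩
    obtain ⟨j, hj, hmj⟩ := by simpa using hJ hX
    exact ⟨⟨j, hj⟩, m, ⟨⟨hm, hmj⟩, hX⟩, rfl⟩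
  · rintro ⟨j, m, ⟨⟨hm, -⟩, hX⟩, rfl⟩
    exact ⟨m, ⟨hm, hX⟩, rfl⟩

/-- The locally definable space structure inherited by an admissible subspace. -/
def restrict (Y : Set M) (hY : D.IsAdmissible Y) : LocDefSpace.{u, v, w, x, y} L R Y where
  ι := D.ι
  coord := D.coord
  finite_coord := D.finite_coord
  dom i := Subtype.val ⁻¹' D.dom i
  chart i m := D.chart i m
  injOn i a ha b hb h := Subtype.ext (D.injOn i ha hb h)
  covers m := D.covers m
  definable_image i := by
    convert! hY i using 1
    ext a
    constructor
    · rintro ⟨m, hm, rfl⟩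
      exact ⟨m, ⟨hm, m.2⟩, rfl⟩
    · rintro ⟨m, ⟨hm, hX⟩, rfl⟩
      exact ⟨⟨m, hX⟩, hm, rfl⟩
  definable_overlap i j := by
    convert! D.definable_transition_image (i := i) (j := j) (hY j) using 1
    ext a
    constructor
    · rintro ⟨m, hm, rfl⟩
      exact ⟨m, ⟨hm, m.2⟩, rfl⟩
    · rintro ⟨m, ⟨hm, hX⟩, rfl⟩
      exact ⟨⟨m, hX⟩, hm, rfl⟩
  open_overlap i j := by
    obtain ⟨O, hO, h⟩ := D.open_overlap i j
    refine ⟨O, hO, ?_⟩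
    ext a
    constructor
    · rintro ⟨m, hm, rfl⟩
      exact ⟨⟨m, hm.1, rfl⟩, (h.subset ⟨m, hm, rfl⟩).2⟩
    · rintro ⟨⟨m, hm, rfl⟩, ha⟩
      obtain ⟨m', hm', h'⟩ := h.superset ⟨⟨m, hm, rfl⟩, ha⟩
      obtain rfl : m' = m := D.injOn i hm'.1 hm h'
      exact ⟨m, hm', rfl⟩
  continuous_transition i j := by
    obtain ⟨g, hg, h⟩ := D.continuous_transition i j
    refine ⟨g, hg.mono ?_, fun m hm => h m hm⟩
    rintro _ ⟨m, hm, rfl⟩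
    exact ⟨m, hm, rfl⟩
  definable_transition i j := by
    convert! (D.definable_transition i j).inter ((hY i).preimage_comp Sum.inl) using 1
    ext c
    constructor
    · rintro ⟨m, hm, rfl⟩
      exact ⟨⟨m, hm, rfl⟩, ⟨m, ⟨hm.1, m.2⟩, by ext; simp⟩⟩
    · rintro ⟨⟨m, hm, rfl⟩, ⟨m', hm', h'⟩⟩
      have : m' = m := D.injOn i hm'.1 hm.1 (by simpa using h')
      exact ⟨⟨m, this ▸ hm'.2⟩, hm, rfl⟩

/-- The locally definable space with a single chart, defined on the whole set. -/
def ofChart {κ : Type} [Finite κ] {X : Type x} (φ : X → κ → R) (hφ : Function.Injective φ)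
    (hX : IsDefinable L (Set.range φ)) : LocDefSpace.{u, v, w, x, 0} L R X where
  ι := Unit
  coord _ := κ
  finite_coord _ := inferInstance
  dom _ := Set.univ
  chart _ := φ
  injOn _ _ _ _ _ h := hφ h
  covers _ := ⟨(), trivial⟩
  definable_image _ := by simpa using hX
  definable_overlap _ _ := by simpa using hX
  open_overlap _ _ := ⟨Set.univ, isOpen_univ, by simp⟩
  continuous_transition _ _ := ⟨id, continuousOn_id, fun _ _ => rfl⟩
  definable_transition _ _ := by
    have := IsDefinable.image_map (L := L) (F := fun a : κ → R => Sum.elim a a)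
      (by rintro (i | i) <;> exact definableFun_proj' i) hX
    convert! this using 1
    ext c
    constructor
    · rintro ⟨m, -, rfl⟩
      exact ⟨φ m, ⟨m, rfl⟩, rfl⟩
    · rintro ⟨_, ⟨m, rfl⟩, rfl⟩
      exact ⟨m, by simp, rfl⟩

/-- A definable subset of `R ^ κ` as a locally definable space; the chart is the inclusion. -/
def ofDefinable {κ : Type} [Finite κ] (X : Set (κ → R)) (hX : IsDefinable L X) :
    LocDefSpace.{u, v, w, w, 0} L R X :=
  ofChart Subtype.val Subtype.val_injective (by simpa using hX)

variable {N : Type x'} (D' : LocDefSpace.{u, v, w, x', y'} L R N)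

/-- The product of two locally definable spaces, with the atlas `(M_i × N_j, (φ_i, ψ_j))`. -/
def prod : LocDefSpace.{u, v, w, max x x', max y y'} L R (M × N) where
  ι := D.ι × D'.ι
  coord i := D.coord i.1 ⊕ D'.coord i.2
  finite_coord _ := inferInstance
  dom i := D.dom i.1 ×ˢ D'.dom i.2
  chart i m := Sum.elim (D.chart i.1 m.1) (D'.chart i.2 m.2)
  injOn i a ha b hb h := by
    have h1 := congrArg (· ∘ Sum.inl) h
    have h2 := congrArg (· ∘ Sum.inr) h
    simp only [Sum.elim_comp_inl, Sum.elim_comp_inr] at h1 h2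
    exact Prod.ext (D.injOn _ ha.1 hb.1 h1) (D'.injOn _ ha.2 hb.2 h2)
  covers m := by
    obtain ⟨i, hi⟩ := D.covers m.1
    obtain ⟨j, hj⟩ := D'.covers m.2
    exact ⟨(i, j), hi, hj⟩
  definable_image i := by
    convert! ((D.definable_image i.1).preimage_comp Sum.inl).inter
      ((D'.definable_image i.2).preimage_comp Sum.inr) using 1
    ext c
    constructor
    · rintro ⟨m, hm, rfl⟩
      exact ⟨⟨m.1, hm.1, by ext; simp⟩, ⟨m.2, hm.2, by ext; simp⟩⟩
    · rintro ⟨⟨m, hm, h⟩, ⟨n, hn, h'⟩⟩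
      exact ⟨(m, n), ⟨hm, hn⟩, by simp [h, h']⟩
  definable_overlap i j := by
    convert! ((D.definable_overlap i.1 j.1).preimage_comp Sum.inl).inter
      ((D'.definable_overlap i.2 j.2).preimage_comp Sum.inr) using 1
    ext c
    constructor
    · rintro ⟨m, hm, rfl⟩
      exact ⟨⟨m.1, ⟨hm.1.1, hm.2.1⟩, by ext; simp⟩, ⟨m.2, ⟨hm.1.2, hm.2.2⟩, by ext; simp⟩⟩
    · rintro ⟨⟨m, hm, h⟩, ⟨n, hn, h'⟩⟩
      exact ⟨(m, n), ⟨⟨hm.1, hn.1⟩, ⟨hm.2, hn.2⟩⟩, by simp [h, h']⟩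
  open_overlap i j := by
    obtain ⟨O, hO, h⟩ := D.open_overlap i.1 j.1
    obtain ⟨O', hO', h'⟩ := D'.open_overlap i.2 j.2
    refine ⟨(fun c => c ∘ Sum.inl) ⁻¹' O ∩ (fun c => c ∘ Sum.inr) ⁻¹' O',
      (hO.preimage (by fun_prop)).inter (hO'.preimage (by fun_prop)), ?_⟩
    ext c
    constructor
    · rintro ⟨m, hm, rfl⟩
      refine ⟨⟨m, hm.1, rfl⟩, ?_, ?_⟩
      · simpa using (h.subset ⟨m.1, ⟨hm.1.1, hm.2.1⟩, rfl⟩).2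
      · simpa using (h'.subset ⟨m.2, ⟨hm.1.2, hm.2.2⟩, rfl⟩).2
    · rintro ⟨⟨m, hm, rfl⟩, h1, h2⟩
      obtain ⟨a, ha, ha'⟩ := h.superset ⟨⟨m.1, hm.1, rfl⟩, by simpa using h1⟩
      obtain ⟨b, hb, hb'⟩ := h'.superset ⟨⟨m.2, hm.2, rfl⟩, by simpa using h2⟩
      have e1 : a = m.1 := D.injOn _ ha.1 hm.1 ha'
      have e2 : b = m.2 := D'.injOn _ hb.1 hm.2 hb'
      exact ⟨m, ⟨hm, e1 ▸ ha.2, e2 ▸ hb.2⟩, rfl⟩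
  continuous_transition i j := by
    obtain ⟨g, hg, h⟩ := D.continuous_transition i.1 j.1
    obtain ⟨g', hg', h'⟩ := D'.continuous_transition i.2 j.2
    refine ⟨fun c => Sum.elim (g (c ∘ Sum.inl)) (g' (c ∘ Sum.inr)), ?_, fun m hm => ?_⟩
    · have c1 : ContinuousOn (fun c : D.coord i.1 ⊕ D'.coord i.2 → R => g (c ∘ Sum.inl))
          ((fun m : M × N => Sum.elim (D.chart i.1 m.1) (D'.chart i.2 m.2)) ''
            (D.dom i.1 ×ˢ D'.dom i.2 ∩ D.dom j.1 ×ˢ D'.dom j.2)) := by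
        refine hg.comp (by fun_prop) ?_
        rintro _ ⟨m, hm, rfl⟩
        exact ⟨m.1, ⟨hm.1.1, hm.2.1⟩, by ext; simp⟩
      have c2 : ContinuousOn (fun c : D.coord i.1 ⊕ D'.coord i.2 → R => g' (c ∘ Sum.inr))
          ((fun m : M × N => Sum.elim (D.chart i.1 m.1) (D'.chart i.2 m.2)) ''
            (D.dom i.1 ×ˢ D'.dom i.2 ∩ D.dom j.1 ×ˢ D'.dom j.2)) := by
        refine hg'.comp (by fun_prop) ?_
        rintro _ ⟨m, hm, rfl⟩
        exact ⟨m.2, ⟨hm.1.2, hm.2.2⟩, by ext; simp⟩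
      refine continuousOn_pi.2 ?_
      rintro (k | k)
      · exact continuousOn_pi.1 c1 k
      · exact continuousOn_pi.1 c2 k
    · simp only [Sum.elim_comp_inl, Sum.elim_comp_inr]
      rw [h m.1 ⟨hm.1.1, hm.2.1⟩, h' m.2 ⟨hm.1.2, hm.2.2⟩]
  definable_transition i j := by
    convert! ((D.definable_transition i.1 j.1).preimage_comp
        (Sum.map Sum.inl Sum.inl :
          _ → (D.coord i.1 ⊕ D'.coord i.2) ⊕ (D.coord j.1 ⊕ D'.coord j.2))).inter
      ((D'.definable_transition i.2 j.2).preimage_comp (Sum.map Sum.inr Sum.inr)) using 1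
    ext c
    constructor
    · rintro ⟨m, hm, rfl⟩
      exact ⟨⟨m.1, ⟨hm.1.1, hm.2.1⟩, by ext (k | k) <;> simp⟩,
        ⟨m.2, ⟨hm.1.2, hm.2.2⟩, by ext (k | k) <;> simp⟩⟩
    · rintro ⟨⟨m, hm, h⟩, ⟨n, hn, h'⟩⟩
      refine ⟨(m, n), ⟨⟨hm.1, hn.1⟩, ⟨hm.2, hn.2⟩⟩, ?_⟩
      ext ((k | k) | (k | k))
      · simpa using congrFun h (Sum.inl k)
      · simpa using congrFun h' (Sum.inl k)
      · simpa using congrFun h (Sum.inr k)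
      · simpa using congrFun h' (Sum.inr k)

/-- Connected admissible subspaces. The empty subspace is not counted as connected. -/
def IsConn (X : Set M) : Prop :=
  D.IsAdmissible X ∧ X.Nonempty ∧
    ∀ U, D.IsAdmissible U →
      (∃ O, IsOpen[D.topology] O ∧ X ∩ U = X ∩ O) →
      (∃ C, IsClosed[D.topology] C ∧ X ∩ U = X ∩ C) → X ∩ U = ∅ ∨ X ∩ U = X

/-- `V` is a connected component of the subspace `W`: a maximal connected subset of `W`. -/
def IsConnComponent (W V : Set M) : Prop :=
  D.IsConn V ∧ V ⊆ W ∧ ∀ V', D.IsConn V' → V' ⊆ W → V ⊆ V' → V' = V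

/-- Paracompactness: there is a locally finite covering by open definable subspaces. -/
def IsParacompact : Prop :=
  ∃ S : Set (Set M), ⋃₀ S = Set.univ ∧
    (∀ U ∈ S, IsOpen[D.topology] U ∧ D.IsDefinableSubspace U) ∧
    ∀ i, {U ∈ S | (D.dom i ∩ U).Nonempty}.Finite

/-- LD-spaces: Hausdorff, regular and paracompact locally definable spaces. -/
structure IsLDSpace : Prop where
  t2 : @T2Space M D.topology
  regular : @RegularSpace M D.topology
  paracompact : D.IsParacompact

/-- An admissible covering of the whole space by open definable subspaces. -/
def IsOpenAdmissibleCovering (S : Set (Set M)) : Prop :=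
  ⋃₀ S = Set.univ ∧ (∀ U ∈ S, IsOpen[D.topology] U ∧ D.IsDefinableSubspace U) ∧
    ∀ i, ∃ T : Set (Set M), T ⊆ S ∧ T.Finite ∧ D.dom i ⊆ ⋃₀ T

end Basic

end LocDefSpace

section Maps

universe x' y' x'' y''

variable {L : FirstOrder.Language.{u, v}} {R : Type w} [L.Structure R] [TopologicalSpace R]
variable {M : Type x} {N : Type x'} {P : Type x''}

/-- Ld-maps: continuous maps `f` such that each `f (M_i)` is a definable subspace of `N` and the
graph of `f : M_i → f (M_i)` is definable, that is, definable in the charts. -/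
structure IsLDMap (D : LocDefSpace.{u, v, w, x, y} L R M)
    (D' : LocDefSpace.{u, v, w, x', y'} L R N) (f : M → N) : Prop where
  continuous : @Continuous M N D.topology D'.topology f
  image : ∀ i, D'.IsDefinableSubspace (f '' D.dom i)
  graph : ∀ i j, IsDefinable L {c : D.coord i ⊕ D'.coord j → R |
    ∃ m ∈ D.dom i, f m ∈ D'.dom j ∧ c = Sum.elim (D.chart i m) (D'.chart j (f m))}

/-- Bundled ld-maps. -/
structure LDMap (D : LocDefSpace.{u, v, w, x, y} L R M)
    (D' : LocDefSpace.{u, v, w, x', y'} L R N) where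
  toFun : M → N
  isLDMap : IsLDMap D D' toFun

instance (D : LocDefSpace.{u, v, w, x, y} L R M) (D' : LocDefSpace.{u, v, w, x', y'} L R N) :
    FunLike (LDMap D D') M N where
  coe := LDMap.toFun
  coe_injective f g h := by
    cases f
    cases g
    congr

variable {D : LocDefSpace.{u, v, w, x, y} L R M} {D' : LocDefSpace.{u, v, w, x', y'} L R N}
  {D'' : LocDefSpace.{u, v, w, x'', y''} L R P}

theorem IsLDMap.comp {g : N → P} {f : M → N} (hg : IsLDMap D' D'' g) (hf : IsLDMap D D' f) :
    IsLDMap D D'' (g ∘ f) := by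
  have hgr : ∀ i k, IsDefinable L {c : D.coord i ⊕ D''.coord k → R |
      ∃ m ∈ D.dom i, g (f m) ∈ D''.dom k ∧
        c = Sum.elim (D.chart i m) (D''.chart k (g (f m)))} := by
    intro i k
    obtain ⟨J, hJ, -⟩ := hf.image i
    have key : ∀ j, IsDefinable L {c : D.coord i ⊕ D''.coord k → R |
        ∃ m ∈ D.dom i, f m ∈ D'.dom j ∧ g (f m) ∈ D''.dom k ∧
          c = Sum.elim (D.chart i m) (D''.chart k (g (f m)))} := by
      intro j
      have := (((hf.graph i j).preimage_comp (Sum.elim (Sum.inl ∘ Sum.inl) Sum.inr :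
          _ → (D.coord i ⊕ D''.coord k) ⊕ D'.coord j)).inter
        ((hg.graph j k).preimage_comp (Sum.elim Sum.inr (Sum.inl ∘ Sum.inr)))).image_comp
          (Sum.inl : _ → (D.coord i ⊕ D''.coord k) ⊕ D'.coord j)
      convert! this using 1
      ext c
      constructor
      · rintro ⟨m, hm, h1, h2, rfl⟩
        refine ⟨Sum.elim (Sum.elim (D.chart i m) (D''.chart k (g (f m)))) (D'.chart j (f m)),
          ⟨⟨m, hm, h1, ?_⟩, ⟨f m, h1, h2, ?_⟩⟩, ?_⟩
        · ext (q | q) <;> simp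
        · ext (q | q) <;> simp
        · ext (q | q) <;> simp
      · rintro ⟨c, ⟨⟨m, hm, h1, h2⟩, ⟨n, hn, h3, h4⟩⟩, rfl⟩
        have e : n = f m := by
          refine D'.injOn j hn h1 (funext fun q => ?_)
          have e1 := congrFun h2 (Sum.inr q)
          have e2 := congrFun h4 (Sum.inl q)
          simp at e1 e2
          rw [← e1, ← e2]
        subst e
        refine ⟨m, hm, h1, h3, ?_⟩
        ext (q | q)
        · simpa using congrFun h2 (Sum.inl q)
        · simpa using congrFun h4 (Sum.inr q)
    have := Set.definable_biUnion_finset (L := L) (A := (Set.univ : Set R)) key J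
    convert! this using 1
    ext c
    simp only [Set.mem_iUnion, exists_prop]
    constructor
    · rintro ⟨m, hm, h, rfl⟩
      obtain ⟨j, hj, hmj⟩ := by simpa using hJ ⟨m, hm, rfl⟩
      exact ⟨j, hj, m, hm, hmj, h, rfl⟩
    · rintro ⟨j, -, m, hm, -, h, rfl⟩
      exact ⟨m, hm, h, rfl⟩
  refine ⟨?_, fun i => ?_, hgr⟩
  · let _ := D.topology
    let _ := D'.topology
    let _ := D''.topology
    exact hg.continuous.comp hf.continuous
  · classical
    obtain ⟨J, hJ, -⟩ := hf.image i
    choose K hK _ using fun j => hg.image j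
    refine ⟨J.biUnion K, ?_, fun k _ => ?_⟩
    · rintro _ ⟨m, hm, rfl⟩
      obtain ⟨j, hj, hmj⟩ := by simpa using hJ ⟨m, hm, rfl⟩
      obtain ⟨k, hk, hmk⟩ := by simpa using hK j ⟨f m, hmj, rfl⟩
      simp only [Set.mem_iUnion, Finset.mem_biUnion]
      exact ⟨k, ⟨j, hj, hk⟩, hmk⟩
    · convert! (hgr i k).image_comp (Sum.inr : _ → D.coord i ⊕ D''.coord k) using 1
      ext c
      constructor
      · rintro ⟨_, ⟨h, ⟨m, hm, rfl⟩⟩, rfl⟩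
        exact ⟨_, ⟨m, hm, h, rfl⟩, by ext; simp⟩
      · rintro ⟨_, ⟨m, hm, h, rfl⟩, rfl⟩
        exact ⟨g (f m), ⟨h, ⟨m, hm, rfl⟩⟩, by ext; simp⟩

/-- Composition of ld-maps. -/
def LDMap.comp (g : LDMap D' D'') (f : LDMap D D') : LDMap D D'' :=
  ⟨g ∘ f, g.isLDMap.comp f.isLDMap⟩

/-- A map that is given in charts by continuous definable maps of the ambient affine spaces, each
chart going to a single chart, is an ld-map. -/
theorem IsLDMap.of_charts {f : M → N} (h : ∀ i, ∃ j, ∃ F : (D.coord i → R) → (D'.coord j → R),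
    Continuous F ∧ (Set.univ : Set R).DefinableMap L F ∧
      ∀ m ∈ D.dom i, f m ∈ D'.dom j ∧ D'.chart j (f m) = F (D.chart i m)) :
    IsLDMap D D' f where
  continuous := by
    let _ := D.topology
    let _ := D'.topology
    refine continuous_def.2 fun U hU i => ?_
    obtain ⟨j, F, hF, -, hf⟩ := h i
    obtain ⟨O, hO, hOU⟩ := hU j
    refine ⟨F ⁻¹' O, hO.preimage hF, fun m hm => ?_⟩
    rw [Set.mem_preimage, hOU _ (hf m hm).1, (hf m hm).2, Set.mem_preimage]
  image i := by
    obtain ⟨j, F, -, hF, hf⟩ := h i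
    refine ⟨{j}, ?_, ?_⟩
    · rintro _ ⟨m, hm, rfl⟩
      simpa using (hf m hm).1
    · simp only [Finset.mem_singleton, forall_eq]
      convert! IsDefinable.image_map hF (D.definable_image i) using 1
      ext c
      constructor
      · rintro ⟨_, ⟨-, m, hm, rfl⟩, rfl⟩
        exact ⟨_, ⟨m, hm, rfl⟩, (hf m hm).2.symm⟩
      · rintro ⟨_, ⟨m, hm, rfl⟩, rfl⟩
        exact ⟨f m, ⟨(hf m hm).1, m, hm, rfl⟩, (hf m hm).2⟩
  graph i k := by
    obtain ⟨j, F, -, hF, hf⟩ := h i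
    have hG : (Set.univ : Set R).DefinableMap L
        (fun c : D.coord i ⊕ D'.coord k → R => Sum.elim (F (c ∘ Sum.inl)) (c ∘ Sum.inr)) := by
      rintro (q | q)
      · refine Set.DefinableFun.comp (g := fun c : D.coord i ⊕ D'.coord k → R => c ∘ Sum.inl)
          (fun r => definableFun_proj' (Sum.inl r)) (hF q)
      · exact definableFun_proj' (Sum.inr q)
    convert! ((D.definable_image i).preimage_comp Sum.inl).inter
      (Set.Definable.preimage_map hG (D'.definable_transition j k)) using 1
    ext c
    constructor
    · rintro ⟨m, hm, h1, rfl⟩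
      refine ⟨⟨m, hm, by ext; simp⟩, ⟨f m, ⟨(hf m hm).1, h1⟩, ?_⟩⟩
      simp [(hf m hm).2]
    · rintro ⟨⟨m, hm, h1⟩, ⟨n, hn, h2⟩⟩
      have e1 : F (c ∘ Sum.inl) = D'.chart j n := by
        simpa using congrArg (· ∘ Sum.inl) h2
      have e2 : c ∘ Sum.inr = D'.chart k n := by
        simpa using congrArg (· ∘ Sum.inr) h2
      have e : n = f m := D'.injOn j hn.1 (hf m hm).1 (by rw [(hf m hm).2, ← e1, h1])
      subst e
      refine ⟨m, hm, hn.2, ?_⟩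
      rw [← e2, h1]
      ext (q | q) <;> simp

open Classical in
/-- Gluing of two ld-maps along two closed admissible subspaces. -/
theorem IsLDMap.glue {f g : M → N} (hf : IsLDMap D D' f) (hg : IsLDMap D D' g) {S T : Set M}
    (hS : IsClosed[D.topology] S) (hT : IsClosed[D.topology] T) (hST : S ∪ T = Set.univ)
    (hSa : D.IsAdmissible S) (hfg : ∀ m ∈ S, m ∈ T → f m = g m) :
    IsLDMap D D' (fun m => if m ∈ S then f m else g m) := by
  have hgr : ∀ i j, IsDefinable L {c : D.coord i ⊕ D'.coord j → R |
      ∃ m ∈ D.dom i, (if m ∈ S then f m else g m) ∈ D'.dom j ∧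
        c = Sum.elim (D.chart i m) (D'.chart j (if m ∈ S then f m else g m))} := by
    intro i j
    convert! ((hf.graph i j).inter ((hSa i).preimage_comp Sum.inl)).union
      ((hg.graph i j).inter ((hSa i).preimage_comp Sum.inl).compl) using 1
    ext c
    constructor
    · rintro ⟨m, hm, h, rfl⟩
      by_cases hmS : m ∈ S
      · simp only [hmS, if_true] at h ⊢
        exact Or.inl ⟨⟨m, hm, h, rfl⟩, ⟨m, ⟨hm, hmS⟩, by ext; simp⟩⟩
      · simp only [hmS, if_false] at h ⊢
        refine Or.inr ⟨⟨m, hm, h, rfl⟩, ?_⟩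
        rintro ⟨m', hm', h'⟩
        exact hmS (D.injOn i hm'.1 hm (by simpa using h') ▸ hm'.2)
    · rintro (⟨⟨m, hm, h, rfl⟩, ⟨m', hm', h'⟩⟩ | ⟨⟨m, hm, h, rfl⟩, h'⟩)
      · have hmS : m ∈ S := D.injOn i hm'.1 hm (by simpa using h') ▸ hm'.2
        exact ⟨m, hm, by simpa [hmS] using h, by simp [hmS]⟩
      · have hmS : m ∉ S := fun hmS => h' ⟨m, ⟨hm, hmS⟩, by ext; simp⟩
        exact ⟨m, hm, by simpa [hmS] using h, by simp [hmS]⟩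
  refine ⟨?_, fun i => ?_, hgr⟩
  · let _ := D.topology
    let _ := D'.topology
    refine continuous_if ?_ hf.continuous.continuousOn hg.continuous.continuousOn
    intro m hm
    refine hfg m (hS.frontier_subset hm) ?_
    have h1 : m ∈ closure Sᶜ := frontier_subset_closure (frontier_compl S ▸ hm)
    refine closure_minimal (fun a ha => ?_) hT h1
    exact (hST.superset (Set.mem_univ a)).resolve_left ha
  · obtain ⟨J, hJ, -⟩ := hf.image i
    obtain ⟨K, hK, -⟩ := hg.image i
    refine ⟨J ∪ K, ?_, fun k _ => ?_⟩
    · rintro _ ⟨m, hm, rfl⟩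
      dsimp only
      split_ifs with hmS
      · obtain ⟨j, hj, hmj⟩ := by simpa using hJ ⟨m, hm, rfl⟩
        exact Set.mem_biUnion (Finset.mem_union_left K hj) hmj
      · obtain ⟨j, hj, hmj⟩ := by simpa using hK ⟨m, hm, rfl⟩
        exact Set.mem_biUnion (Finset.mem_union_right J hj) hmj
    · convert! (hgr i k).image_comp (Sum.inr : _ → D.coord i ⊕ D'.coord k) using 1
      ext c
      constructor
      · rintro ⟨_, ⟨h, ⟨m, hm, rfl⟩⟩, rfl⟩
        exact ⟨_, ⟨m, hm, h, rfl⟩, by ext; simp⟩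
      · rintro ⟨_, ⟨m, hm, h, rfl⟩, rfl⟩
        exact ⟨_, ⟨h, ⟨m, hm, rfl⟩⟩, by ext; simp⟩

end Maps

set_option linter.unusedSectionVars false

section Homotopy

universe x' y' x'' y'' z z'

variable (L : FirstOrder.Language.{u, v}) {R : Type w} [L.Structure R] [TopologicalSpace R]
  [Field R] [LinearOrder R] [IsStrictOrderedRing R] [OrderTopology R] [IsOMinimalExpansion L R]

variable (R) in
/-- The unit interval `I = [0, 1]` of `R` as a locally definable space. -/
def unitSpace : LocDefSpace.{u, v, w, w, 0} L R (Set.Icc (0 : R) 1) :=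
  LocDefSpace.ofChart (κ := Unit) (fun t _ => (t : R))
    (fun _ _ h => Subtype.ext (congrFun h ())) (by
      have h := (isDefinable_le (L := L) (definableFun_const' (0 : R))
        (definableFun_proj' ())).inter
        (isDefinable_le (L := L) (definableFun_proj' ()) (definableFun_const' (1 : R)))
      convert! h using 1
      ext c
      constructor
      · rintro ⟨t, rfl⟩
        exact t.2
      · intro hc
        exact ⟨⟨c (), hc⟩, rfl⟩)

variable (R) in
/-- The cube `I ^ n` in `R ^ n`. -/
abbrev Cube (n : ℕ) : Set (Fin n → R) := Set.Icc 0 1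

variable (R) in
theorem isDefinable_cube (n : ℕ) : IsDefinable L (Cube R n) := by
  have h := Set.definable_iInter_of_finite (L := L) (A := (Set.univ : Set R))
    (f := fun i : Fin n => {c : Fin n → R | 0 ≤ c i} ∩ {c : Fin n → R | c i ≤ 1}) (fun i =>
      (isDefinable_le (L := L) (definableFun_const' (0 : R)) (definableFun_proj' i)).inter
        (isDefinable_le (L := L) (definableFun_proj' i) (definableFun_const' (1 : R))))
  convert! h using 1
  ext c
  simp [Set.mem_Icc, Pi.le_def, forall_and]

variable (R) in
/-- The cube `I ^ n` as a locally definable space. -/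
def cubeSpace (n : ℕ) : LocDefSpace.{u, v, w, w, 0} L R (Cube R n) :=
  LocDefSpace.ofDefinable (Cube R n) (isDefinable_cube L R n)

variable {L} {M : Type x} {N : Type x'} {D : LocDefSpace.{u, v, w, x, y} L R M}
  {D' : LocDefSpace.{u, v, w, x', y'} L R N}

theorem IsLDMap.glue_of_charts {f g : M → N} (hf : IsLDMap D D' f) (hg : IsLDMap D D' g)
    (r : M → R) (c : R) (hr : ∀ i, ∃ k : D.coord i, ∀ m ∈ D.dom i, r m = D.chart i m k)
    (hfg : ∀ m, r m = c → f m = g m) :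
    IsLDMap D D' (fun m => if r m ≤ c then f m else g m) := by
  classical
  have h := IsLDMap.glue (S := {m | r m ≤ c}) (T := {m | c ≤ r m}) hf hg ?_ ?_ ?_ ?_ ?_
  · convert! h using 1
    funext m
    by_cases hm : r m ≤ c <;> simp [hm]
  · let _ := D.topology
    refine ⟨fun i => ?_⟩
    obtain ⟨k, hk⟩ := hr i
    refine ⟨{a | c < a k}, isOpen_lt continuous_const (continuous_apply k), fun m hm => ?_⟩
    simp [hk m hm]
  · let _ := D.topology
    refine ⟨fun i => ?_⟩
    obtain ⟨k, hk⟩ := hr i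
    refine ⟨{a | a k < c}, isOpen_lt (continuous_apply k) continuous_const, fun m hm => ?_⟩
    simp [hk m hm]
  · ext m
    simpa using le_total (r m) c
  · intro i
    obtain ⟨k, hk⟩ := hr i
    convert! (D.definable_image i).inter
      (isDefinable_le (L := L) (definableFun_proj' k) (definableFun_const' c)) using 1
    ext a
    constructor
    · rintro ⟨m, ⟨hm, h⟩, rfl⟩
      exact ⟨⟨m, hm, rfl⟩, by simpa [hk m hm] using h⟩
    · rintro ⟨⟨m, hm, rfl⟩, h⟩
      exact ⟨m, ⟨hm, by simpa [hk m hm] using h⟩, rfl⟩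
  · intro m h1 h2
    exact hfg m (le_antisymm h1 h2)

/-- A self-map of the unit interval that is the restriction of a continuous definable map. -/
structure IsDefinableReparam (L : FirstOrder.Language.{u, v}) [L.Structure R]
    (σ : Set.Icc (0 : R) 1 → Set.Icc (0 : R) 1) (s : R → R) : Prop where
  continuous : Continuous s
  definable : (Set.univ : Set R).DefinableFun L fun a : Fin 1 → R => s (a 0)
  eq : ∀ t, (σ t : R) = s t

theorem IsDefinableReparam.isLDMap_prod {σ : Set.Icc (0 : R) 1 → Set.Icc (0 : R) 1} {s : R → R}
    (h : IsDefinableReparam L σ s) :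
    IsLDMap (D.prod (unitSpace L R)) (D.prod (unitSpace L R)) (fun z => (z.1, σ z.2)) := by
  refine IsLDMap.of_charts fun i => ⟨i,
    fun a => Sum.elim (a ∘ Sum.inl) (fun k => s (a (Sum.inr k))), ?_, ?_, ?_⟩
  · have := h.continuous
    refine continuous_pi ?_
    rintro (k | k)
    · exact continuous_apply _
    · exact this.comp (continuous_apply _)
  · rintro (k | k)
    · exact definableFun_proj' _
    · exact Set.DefinableFun.comp (g := fun a (_ : Fin 1) => a (Sum.inr k))
        (fun _ => definableFun_proj' _) h.definable
  · rintro ⟨m, t⟩ hm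
    refine ⟨⟨hm.1, trivial⟩, ?_⟩
    ext (k | k)
    · rfl
    · exact h.eq t

theorem isLDMap_fst : IsLDMap (D.prod (unitSpace L R)) D Prod.fst := by
  refine IsLDMap.of_charts fun i => ⟨i.1, fun a => a ∘ Sum.inl, by fun_prop,
    fun _ => definableFun_proj' _, fun m hm => ⟨hm.1, ?_⟩⟩
  ext k
  rfl

/-- First half of the interval, stretched. -/
def stretchL (t : Set.Icc (0 : R) 1) : Set.Icc (0 : R) 1 :=
  ⟨min 1 (2 * t), le_min zero_le_one (mul_nonneg zero_le_two t.2.1), min_le_left _ _⟩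

/-- Second half of the interval, stretched. -/
def stretchR (t : Set.Icc (0 : R) 1) : Set.Icc (0 : R) 1 :=
  ⟨max 0 (2 * t - 1), le_max_left _ _, max_le zero_le_one (by linarith [t.2.2])⟩

/-- The flip of the interval. -/
def flip01 (t : Set.Icc (0 : R) 1) : Set.Icc (0 : R) 1 :=
  ⟨1 - t, by linarith [t.2.2], by linarith [t.2.1]⟩

theorem isDefinableReparam_stretchL :
    IsDefinableReparam (R := R) L stretchL (fun t => min 1 (2 * t)) where
  continuous := by fun_prop
  definable := definableFun_min' (definableFun_const' _)
    (definableFun_mul' (definableFun_const' _) (definableFun_proj' _))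
  eq _ := rfl

theorem isDefinableReparam_stretchR :
    IsDefinableReparam (R := R) L stretchR (fun t => max 0 (2 * t - 1)) where
  continuous := by fun_prop
  definable := definableFun_max' (definableFun_const' _) (definableFun_sub'
    (definableFun_mul' (definableFun_const' _) (definableFun_proj' _)) (definableFun_const' _))
  eq _ := rfl

theorem isDefinableReparam_flip01 :
    IsDefinableReparam (R := R) L flip01 (fun t => 1 - t) where
  continuous := by fun_prop
  definable := definableFun_sub' (definableFun_const' _) (definableFun_proj' _)
  eq _ := rfl

variable {κ : Type z}

variable (D D') in
/-- Ld-maps `f : (M, A_k)_k → (N, B_k)_k` of systems of spaces, i.e. `f (A_k) ⊆ B_k` for all `k`. -/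
structure SystemMap (A : κ → Set M) (B : κ → Set N) where
  toLDMap : LDMap D D'
  mapsTo : ∀ k, ∀ m ∈ A k, toLDMap m ∈ B k

/-- Ld-homotopic ld-maps of systems of spaces. -/
def SystemMap.Homotopic {A : κ → Set M} {B : κ → Set N} (f g : SystemMap D D' A B) : Prop :=
  ∃ H : LDMap (D.prod (unitSpace L R)) D',
    (∀ m, H (m, 0) = f.toLDMap m) ∧ (∀ m, H (m, 1) = g.toLDMap m) ∧
      ∀ k, ∀ m ∈ A k, ∀ t, H (m, t) ∈ B k

theorem SystemMap.homotopic_refl {A : κ → Set M} {B : κ → Set N} (f : SystemMap D D' A B) :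
    f.Homotopic f :=
  ⟨⟨_, f.toLDMap.isLDMap.comp isLDMap_fst⟩, fun _ => rfl, fun _ => rfl,
    fun k m hm _ => f.mapsTo k m hm⟩

theorem SystemMap.Homotopic.symm {A : κ → Set M} {B : κ → Set N} {f g : SystemMap D D' A B}
    (h : f.Homotopic g) : g.Homotopic f := by
  obtain ⟨H, h0, h1, hH⟩ := h
  refine ⟨⟨_, H.isLDMap.comp isDefinableReparam_flip01.isLDMap_prod⟩, fun m => ?_, fun m => ?_,
    fun k m hm t => hH k m hm _⟩
  · rw [← h1]
    exact congrArg (fun t => H (m, t)) (Subtype.ext (by simp [flip01]))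
  · rw [← h0]
    exact congrArg (fun t => H (m, t)) (Subtype.ext (by simp [flip01]))

theorem SystemMap.Homotopic.trans {A : κ → Set M} {B : κ → Set N} {f g h : SystemMap D D' A B}
    (hfg : f.Homotopic g) (hgh : g.Homotopic h) : f.Homotopic h := by
  obtain ⟨H, h0, h1, hH⟩ := hfg
  obtain ⟨K, k0, k1, hK⟩ := hgh
  have hh : (0 : R) < 2⁻¹ := by positivity
  have hh' : (2⁻¹ : R) < 1 := by norm_num
  refine ⟨⟨_, (H.isLDMap.comp isDefinableReparam_stretchL.isLDMap_prod).glue_of_charts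
    (K.isLDMap.comp isDefinableReparam_stretchR.isLDMap_prod) (fun z => (z.2 : R)) 2⁻¹
    (fun i => ⟨Sum.inr (), fun _ _ => rfl⟩) ?_⟩, fun m => ?_, fun m => ?_, fun k m hm t => ?_⟩
  · rintro ⟨m, t⟩ ht
    have e1 : stretchL t = 1 := Subtype.ext (by simp [stretchL, show (t : R) = 2⁻¹ from ht])
    have e2 : stretchR t = 0 := Subtype.ext (by simp [stretchR, show (t : R) = 2⁻¹ from ht])
    change H (m, stretchL t) = K (m, stretchR t)
    rw [e1, e2, h1, k0]
  · change (if ((0 : Set.Icc (0 : R) 1) : R) ≤ 2⁻¹ then H (m, stretchL 0)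
      else K (m, stretchR 0)) = _
    have e1 : stretchL (0 : Set.Icc (0 : R) 1) = 0 := Subtype.ext (by simp [stretchL])
    rw [if_pos (by simp), e1, h0]
  · change (if ((1 : Set.Icc (0 : R) 1) : R) ≤ 2⁻¹ then H (m, stretchL 1)
      else K (m, stretchR 1)) = _
    have e1 : stretchR (1 : Set.Icc (0 : R) 1) = 1 := Subtype.ext (by norm_num [stretchR])
    rw [if_neg (by simpa using hh'), e1, k1]
  · change (if (t : R) ≤ 2⁻¹ then H (m, stretchL t) else K (m, stretchR t)) ∈ _
    split_ifs
    · exact hH k m hm _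
    · exact hK k m hm _

variable (D D') in
/-- Ld-homotopy as an equivalence relation. -/
def SystemMap.setoid (A : κ → Set M) (B : κ → Set N) : Setoid (SystemMap D D' A B) where
  r := SystemMap.Homotopic
  iseqv := ⟨SystemMap.homotopic_refl, SystemMap.Homotopic.symm, SystemMap.Homotopic.trans⟩

variable (D D') in
/-- The homotopy set `[(M, A_k)_k, (N, B_k)_k]`. -/
def HomotopySet (A : κ → Set M) (B : κ → Set N) : Type _ :=
  Quotient (SystemMap.setoid D D' A B)

/-! ### Concatenation of maps on cubes in the first coordinate -/

/-- Replace the first coordinate of a point of the cube. -/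
def setFirst {n : ℕ} (a : Cube R (n + 1)) (t : Set.Icc (0 : R) 1) : Cube R (n + 1) :=
  ⟨Function.update a.1 0 t, by
    constructor <;> intro i <;> by_cases hi : i = 0
    · subst hi
      simpa using t.2.1
    · simpa [hi] using a.2.1 i
    · subst hi
      simpa using t.2.2
    · simpa [hi] using a.2.2 i⟩

/-- The first coordinate of a point of the cube. -/
def getFirst {n : ℕ} (a : Cube R (n + 1)) : Set.Icc (0 : R) 1 := ⟨a.1 0, a.2.1 0, a.2.2 0⟩

@[simp] theorem getFirst_setFirst {n : ℕ} (a : Cube R (n + 1)) (t : Set.Icc (0 : R) 1) :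
    getFirst (setFirst a t) = t := Subtype.ext (by simp [getFirst, setFirst])

@[simp] theorem setFirst_setFirst {n : ℕ} (a : Cube R (n + 1)) (t t' : Set.Icc (0 : R) 1) :
    setFirst (setFirst a t) t' = setFirst a t' := Subtype.ext (by simp [setFirst])

@[simp] theorem setFirst_getFirst {n : ℕ} (a : Cube R (n + 1)) :
    setFirst a (getFirst a) = a := Subtype.ext (by simp [setFirst, getFirst])

theorem definableMap_update {n : ℕ} {α : Type x''} {q : (α → R) → Fin (n + 1) → R}
    {s : (α → R) → R} (hq : (Set.univ : Set R).DefinableMap L q)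
    (hs : (Set.univ : Set R).DefinableFun L s) :
    (Set.univ : Set R).DefinableMap L fun a => Function.update (q a) 0 (s a) := by
  intro k
  by_cases hk : k = 0
  · subst hk
    simpa using hs
  · simpa [hk] using hq k

theorem IsDefinableReparam.isLDMap_cube {n : ℕ} {σ : Set.Icc (0 : R) 1 → Set.Icc (0 : R) 1}
    {s : R → R} (h : IsDefinableReparam L σ s) :
    IsLDMap (cubeSpace L R (n + 1)) (cubeSpace L R (n + 1))
      (fun a => setFirst a (σ (getFirst a))) := by
  have hc : Continuous fun a : Fin (n + 1) → R => Function.update a 0 (s (a 0)) :=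
    continuous_id.update 0 (h.continuous.comp (continuous_apply 0))
  have hd : (Set.univ : Set R).DefinableMap L
      fun a : Fin (n + 1) → R => Function.update a 0 (s (a 0)) :=
    definableMap_update (fun _ => definableFun_proj' _)
      (Set.DefinableFun.comp (g := fun (a : Fin (n + 1) → R) (_ : Fin 1) => a 0)
        (fun _ => definableFun_proj' _) h.definable)
  refine IsLDMap.of_charts fun _ => ⟨(), _, hc, hd, ?_⟩
  intro a _
  refine ⟨trivial, ?_⟩
  change Function.update a.1 0 _ = Function.update a.1 0 _
  rw [h.eq]
  rfl

theorem IsDefinableReparam.isLDMap_cube_prod {n : ℕ} {σ : Set.Icc (0 : R) 1 → Set.Icc (0 : R) 1}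
    {s : R → R} (h : IsDefinableReparam L σ s) :
    IsLDMap ((cubeSpace L R (n + 1)).prod (unitSpace L R))
      ((cubeSpace L R (n + 1)).prod (unitSpace L R))
      (fun z => (setFirst z.1 (σ (getFirst z.1)), z.2)) := by
  have hc : Continuous fun a : Fin (n + 1) ⊕ Unit → R =>
      Function.update (a ∘ Sum.inl) 0 (s (a (Sum.inl 0))) :=
    Continuous.update (by fun_prop) 0 (h.continuous.comp (continuous_apply _))
  have hd : (Set.univ : Set R).DefinableMap L fun a : Fin (n + 1) ⊕ Unit → R =>
      Function.update (a ∘ Sum.inl) 0 (s (a (Sum.inl 0))) :=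
    definableMap_update (fun _ => definableFun_proj' _)
      (Set.DefinableFun.comp (g := fun (a : Fin (n + 1) ⊕ Unit → R) (_ : Fin 1) => a (Sum.inl 0))
        (fun _ => definableFun_proj' _) h.definable)
  have hc' : Continuous fun a : Fin (n + 1) ⊕ Unit → R =>
      (Sum.elim (Function.update (a ∘ Sum.inl) 0 (s (a (Sum.inl 0)))) (a ∘ Sum.inr) :
        Fin (n + 1) ⊕ Unit → R) := by
    refine continuous_pi ?_
    rintro (k | k)
    · exact (continuous_apply k).comp hc
    · exact continuous_apply _
  have hd' : (Set.univ : Set R).DefinableMap L fun a : Fin (n + 1) ⊕ Unit → R =>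
      (Sum.elim (Function.update (a ∘ Sum.inl) 0 (s (a (Sum.inl 0)))) (a ∘ Sum.inr) :
        Fin (n + 1) ⊕ Unit → R) := by
    rintro (k | k)
    · exact hd k
    · exact definableFun_proj' _
  refine IsLDMap.of_charts fun i => ⟨i, _, hc', hd', ?_⟩
  rintro ⟨a, t⟩ _
  refine ⟨⟨trivial, trivial⟩, ?_⟩
  change Sum.elim (Function.update a.1 0 _) _ = Sum.elim (Function.update a.1 0 _) _
  rw [h.eq]
  rfl

/-- The common shape of the systems defining absolute and relative homotopy groups: `κ`-indexed
conditions on maps of cubes that are compatible with concatenation in the first coordinate. -/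
structure IsLoopSystem {n : ℕ} (A : κ → Set (Cube R (n + 1))) (B : κ → Set N) (b : N) : Prop where
  base : ∃ k, (∀ a, getFirst a = 0 ∨ getFirst a = 1 → a ∈ A k) ∧ B k = {b}
  mem : ∀ k, b ∈ B k
  saturated : ∀ k, ∀ a ∈ A k, getFirst a = 0 ∨ getFirst a = 1 ∨ ∀ t, setFirst a t ∈ A k

namespace IsLoopSystem

variable {n : ℕ} {A : κ → Set (Cube R (n + 1))} {B : κ → Set N} {b : N}

theorem eq_base (h : IsLoopSystem A B b) {F : Cube R (n + 1) → N}
    (hF : ∀ k, ∀ a ∈ A k, F a ∈ B k) {a : Cube R (n + 1)}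
    (ha : getFirst a = 0 ∨ getFirst a = 1) : F a = b := by
  obtain ⟨k, h1, h2⟩ := h.base
  simpa [h2] using hF k a (h1 a ha)

theorem reparam_mem (h : IsLoopSystem A B b) {F : Cube R (n + 1) → N}
    (hF : ∀ k, ∀ a ∈ A k, F a ∈ B k) {σ : Set.Icc (0 : R) 1}
    {k : κ} {a : Cube R (n + 1)} (ha : a ∈ A k)
    (hσ : getFirst a = 0 ∨ getFirst a = 1 → σ = 0 ∨ σ = 1) :
    F (setFirst a σ) ∈ B k := by
  have key : getFirst a = 0 ∨ getFirst a = 1 → F (setFirst a σ) ∈ B k := fun h' => by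
    rw [h.eq_base hF (by simpa using hσ h')]
    exact h.mem k
  rcases h.saturated k a ha with h' | h' | h'
  · exact key (Or.inl h')
  · exact key (Or.inr h')
  · exact hF k _ (h' σ)

end IsLoopSystem

theorem stretchL_end {t : Set.Icc (0 : R) 1} (ht : t = 0 ∨ t = 1) :
    stretchL t = 0 ∨ stretchL t = 1 := by
  rcases ht with rfl | rfl
  · exact Or.inl (Subtype.ext (by simp [stretchL]))
  · exact Or.inr (Subtype.ext (by simp [stretchL]))

theorem stretchR_end {t : Set.Icc (0 : R) 1} (ht : t = 0 ∨ t = 1) :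
    stretchR t = 0 ∨ stretchR t = 1 := by
  rcases ht with rfl | rfl
  · exact Or.inl (Subtype.ext (by simp [stretchR]))
  · exact Or.inr (Subtype.ext (by norm_num [stretchR]))

theorem flip01_end {t : Set.Icc (0 : R) 1} (ht : t = 0 ∨ t = 1) :
    flip01 t = 0 ∨ flip01 t = 1 := by
  rcases ht with rfl | rfl
  · exact Or.inr (Subtype.ext (by simp [flip01]))
  · exact Or.inl (Subtype.ext (by simp [flip01]))

theorem stretchL_half {t : Set.Icc (0 : R) 1} (ht : (t : R) = 2⁻¹) : stretchL t = 1 :=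
  Subtype.ext (by simp [stretchL, ht])

theorem stretchR_half {t : Set.Icc (0 : R) 1} (ht : (t : R) = 2⁻¹) : stretchR t = 0 :=
  Subtype.ext (by simp [stretchR, ht])

section Group

variable {n : ℕ} {A : κ → Set (Cube R (n + 1))} {B : κ → Set N} {b : N}

/-- The usual concatenation of maps on the cube: `f (2 t₁, t₂, …)` for `t₁ ≤ 1/2` and
`g (2 t₁ - 1, t₂, …)` for `t₁ ≥ 1/2`. -/
def concat (h : IsLoopSystem A B b) (f g : SystemMap (cubeSpace L R (n + 1)) D' A B) :
    SystemMap (cubeSpace L R (n + 1)) D' A B where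
  toLDMap := ⟨fun a => if (getFirst a : R) ≤ 2⁻¹ then
      f.toLDMap (setFirst a (stretchL (getFirst a)))
      else g.toLDMap (setFirst a (stretchR (getFirst a))),
    (f.toLDMap.isLDMap.comp isDefinableReparam_stretchL.isLDMap_cube).glue_of_charts
      (g.toLDMap.isLDMap.comp isDefinableReparam_stretchR.isLDMap_cube)
      (fun a => (getFirst a : R)) 2⁻¹ (fun _ => ⟨(0 : Fin (n + 1)), fun _ _ => rfl⟩) (by
        intro a ha
        have e1 := h.eq_base f.mapsTo (a := setFirst a (stretchL (getFirst a)))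
          (Or.inr (by simpa using stretchL_half ha))
        have e2 := h.eq_base g.mapsTo (a := setFirst a (stretchR (getFirst a)))
          (Or.inl (by simpa using stretchR_half ha))
        exact e1.trans e2.symm)⟩
  mapsTo k a ha := by
    change (if (getFirst a : R) ≤ 2⁻¹ then _ else _) ∈ B k
    split_ifs
    · exact h.reparam_mem f.mapsTo ha stretchL_end
    · exact h.reparam_mem g.mapsTo ha stretchR_end

theorem concat_homotopic (h : IsLoopSystem A B b)
    {f f' g g' : SystemMap (cubeSpace L R (n + 1)) D' A B}
    (hf : f.Homotopic f') (hg : g.Homotopic g') :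
    (concat h f g).Homotopic (concat h f' g') := by
  obtain ⟨H, h0, h1, hH⟩ := hf
  obtain ⟨K, k0, k1, hK⟩ := hg
  refine ⟨⟨_, (H.isLDMap.comp isDefinableReparam_stretchL.isLDMap_cube_prod).glue_of_charts
      (K.isLDMap.comp isDefinableReparam_stretchR.isLDMap_cube_prod)
      (fun z => (getFirst z.1 : R)) 2⁻¹
      (fun _ => ⟨(Sum.inl (0 : Fin (n + 1))), fun _ _ => rfl⟩) ?_⟩,
    fun a => ?_, fun a => ?_, fun k a ha t => ?_⟩
  · rintro ⟨a, t⟩ ha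
    have e1 := h.eq_base (F := fun a => H (a, t)) (fun k a ha => hH k a ha t)
      (a := setFirst a (stretchL (getFirst a)))
      (Or.inr (by simpa using stretchL_half ha))
    have e2 := h.eq_base (F := fun a => K (a, t)) (fun k a ha => hK k a ha t)
      (a := setFirst a (stretchR (getFirst a)))
      (Or.inl (by simpa using stretchR_half ha))
    exact e1.trans e2.symm
  · change (if (getFirst a : R) ≤ 2⁻¹ then H (_, 0) else K (_, 0)) =
      (if (getFirst a : R) ≤ 2⁻¹ then _ else _)
    rw [h0, k0]
  · change (if (getFirst a : R) ≤ 2⁻¹ then H (_, 1) else K (_, 1)) =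
      (if (getFirst a : R) ≤ 2⁻¹ then _ else _)
    rw [h1, k1]
  · change (if (getFirst a : R) ≤ 2⁻¹ then H (setFirst a (stretchL (getFirst a)), t)
      else K (setFirst a (stretchR (getFirst a)), t)) ∈ B k
    split_ifs
    · exact h.reparam_mem (F := fun a => H (a, t)) (fun k a ha => hH k a ha t) ha stretchL_end
    · exact h.reparam_mem (F := fun a => K (a, t)) (fun k a ha => hK k a ha t) ha stretchR_end

/-- The constant map at the base point. -/
def constLoop (h : IsLoopSystem A B b) : SystemMap (cubeSpace L R (n + 1)) D' A B where
  toLDMap := ⟨fun _ => b, by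
    obtain ⟨j, hj⟩ := D'.covers b
    exact IsLDMap.of_charts fun _ => ⟨j, fun _ => D'.chart j b, continuous_const,
      fun _ => definableFun_const' _, fun _ _ => ⟨hj, rfl⟩⟩⟩
  mapsTo k _ _ := h.mem k

/-- The reversed map. -/
def reverse (h : IsLoopSystem A B b) (f : SystemMap (cubeSpace L R (n + 1)) D' A B) :
    SystemMap (cubeSpace L R (n + 1)) D' A B where
  toLDMap := ⟨fun a => f.toLDMap (setFirst a (flip01 (getFirst a))),
    f.toLDMap.isLDMap.comp isDefinableReparam_flip01.isLDMap_cube⟩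
  mapsTo _ _ ha := h.reparam_mem f.mapsTo ha flip01_end

theorem reverse_homotopic (h : IsLoopSystem A B b)
    {f f' : SystemMap (cubeSpace L R (n + 1)) D' A B} (hf : f.Homotopic f') :
    (reverse h f).Homotopic (reverse h f') := by
  obtain ⟨H, h0, h1, hH⟩ := hf
  refine ⟨⟨_, H.isLDMap.comp isDefinableReparam_flip01.isLDMap_cube_prod⟩,
    fun a => h0 _, fun a => h1 _, fun k a ha t => ?_⟩
  exact h.reparam_mem (F := fun a => H (a, t)) (fun k a ha => hH k a ha t) ha flip01_end

theorem homotopic_of_reparam (h : IsLoopSystem A B b)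
    (F f g : SystemMap (cubeSpace L R (n + 1)) D' A B)
    (θ : Set.Icc (0 : R) 1 → Set.Icc (0 : R) 1 → Set.Icc (0 : R) 1) (s : R → R → R)
    (hs : Continuous fun r : R × R => s r.1 r.2)
    (hd : (Set.univ : Set R).DefinableFun L fun a : Fin 2 → R => s (a 0) (a 1))
    (hθ : ∀ r t, (θ r t : R) = s r t)
    (hend : ∀ r t, r = 0 ∨ r = 1 → θ r t = 0 ∨ θ r t = 1)
    (hf : ∀ a, f.toLDMap a = F.toLDMap (setFirst a (θ (getFirst a) 0)))
    (hg : ∀ a, g.toLDMap a = F.toLDMap (setFirst a (θ (getFirst a) 1))) : f.Homotopic g := by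
  have hL : IsLDMap ((cubeSpace L R (n + 1)).prod (unitSpace L R)) (cubeSpace L R (n + 1))
      (fun z => setFirst z.1 (θ (getFirst z.1) z.2)) := by
    have hc : Continuous fun a : Fin (n + 1) ⊕ Unit → R =>
        Function.update (a ∘ Sum.inl) 0 (s (a (Sum.inl 0)) (a (Sum.inr ()))) :=
      Continuous.update (by fun_prop) 0 (hs.comp
        (f := fun a : Fin (n + 1) ⊕ Unit → R => (a (Sum.inl 0), a (Sum.inr ())))
        ((continuous_apply (Sum.inl 0)).prodMk (continuous_apply (Sum.inr ()))))
    have hm : (Set.univ : Set R).DefinableMap L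
        (fun a : Fin (n + 1) ⊕ Unit → R => ![a (Sum.inl 0), a (Sum.inr ())]) := by
      intro j
      fin_cases j <;> exact definableFun_proj' _
    have hd' : (Set.univ : Set R).DefinableMap L fun a : Fin (n + 1) ⊕ Unit → R =>
        Function.update (a ∘ Sum.inl) 0 (s (a (Sum.inl 0)) (a (Sum.inr ()))) :=
      definableMap_update (fun _ => definableFun_proj' _)
        (by simpa using Set.DefinableFun.comp hm hd)
    refine IsLDMap.of_charts fun i => ⟨(), _, hc, hd', ?_⟩
    rintro ⟨a, t⟩ _
    refine ⟨trivial, ?_⟩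
    change Function.update a.1 0 _ = Function.update a.1 0 _
    rw [hθ]
    rfl
  refine ⟨⟨_, F.toLDMap.isLDMap.comp hL⟩, fun a => (hf a).symm, fun a => (hg a).symm,
    fun k a ha t => ?_⟩
  exact h.reparam_mem F.mapsTo ha (hend _ t)

/-- The straight line homotopy between two maps of the interval. -/
def lineIcc (σ τ t : Set.Icc (0 : R) 1) : Set.Icc (0 : R) 1 :=
  ⟨(1 - t) * σ + t * τ, by
    have := mul_nonneg (sub_nonneg.2 t.2.2) σ.2.1
    have := mul_nonneg t.2.1 τ.2.1
    linarith, by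
    have := mul_le_mul_of_nonneg_left σ.2.2 (sub_nonneg.2 t.2.2)
    have := mul_le_mul_of_nonneg_left τ.2.2 t.2.1
    linarith⟩

theorem homotopic_of_line (h : IsLoopSystem A B b)
    (F f g : SystemMap (cubeSpace L R (n + 1)) D' A B)
    {σ τ : Set.Icc (0 : R) 1 → Set.Icc (0 : R) 1} {s s' : R → R}
    (hσ : IsDefinableReparam L σ s) (hτ : IsDefinableReparam L τ s')
    (hend : ∀ r, r = 0 ∨ r = 1 → σ r = τ r ∧ (σ r = 0 ∨ σ r = 1))
    (hf : ∀ a, f.toLDMap a = F.toLDMap (setFirst a (σ (getFirst a))))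
    (hg : ∀ a, g.toLDMap a = F.toLDMap (setFirst a (τ (getFirst a)))) : f.Homotopic g := by
  have e0 : ∀ p q : Set.Icc (0 : R) 1, lineIcc p q 0 = p := fun p q =>
    Subtype.ext (by simp [lineIcc])
  have e1 : ∀ p q : Set.Icc (0 : R) 1, lineIcc p q 1 = q := fun p q =>
    Subtype.ext (by simp [lineIcc])
  have e2 : ∀ p t : Set.Icc (0 : R) 1, lineIcc p p t = p := fun p q =>
    Subtype.ext (by simp [lineIcc]; ring)
  have c1 := hσ.continuous
  have c2 := hτ.continuous
  have d1 : (Set.univ : Set R).DefinableFun L fun a : Fin 2 → R => s (a 0) :=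
    Set.DefinableFun.comp (g := fun (a : Fin 2 → R) (_ : Fin 1) => a 0)
      (fun _ => definableFun_proj' _) hσ.definable
  have d2 : (Set.univ : Set R).DefinableFun L fun a : Fin 2 → R => s' (a 0) :=
    Set.DefinableFun.comp (g := fun (a : Fin 2 → R) (_ : Fin 1) => a 0)
      (fun _ => definableFun_proj' _) hτ.definable
  refine homotopic_of_reparam h F f g (fun r t => lineIcc (σ r) (τ r) t)
    (fun r t => (1 - t) * s r + t * s' r) (by fun_prop) ?_ ?_ ?_ ?_ ?_
  · exact definableFun_add' (definableFun_mul' (definableFun_sub' (definableFun_const' _)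
      (definableFun_proj' _)) d1) (definableFun_mul' (definableFun_proj' _) d2)
  · intro r t
    simp [lineIcc, hσ.eq, hτ.eq]
  · intro r t hr
    obtain ⟨h1, h2⟩ := hend r hr
    simpa [← h1, e2] using h2
  · intro a
    rw [hf, e0]
  · intro a
    rw [hg, e1]

theorem isDefinableReparam_id : IsDefinableReparam (R := R) L id (fun t => t) where
  continuous := continuous_id
  definable := definableFun_proj' _
  eq _ := rfl

theorem isDefinableReparam_one : IsDefinableReparam (R := R) L (fun _ => 1) (fun _ => 1) where
  continuous := continuous_const
  definable := definableFun_const' _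
  eq _ := rfl

theorem concat_apply (h : IsLoopSystem A B b) (f g : SystemMap (cubeSpace L R (n + 1)) D' A B)
    (a : Cube R (n + 1)) : (concat h f g).toLDMap a = if (getFirst a : R) ≤ 2⁻¹ then
      f.toLDMap (setFirst a (stretchL (getFirst a)))
      else g.toLDMap (setFirst a (stretchR (getFirst a))) := rfl

theorem constLoop_concat (h : IsLoopSystem A B b)
    (f : SystemMap (cubeSpace L R (n + 1)) D' A B) :
    (concat h (constLoop h) f).Homotopic f := by
  refine homotopic_of_line h f _ _ isDefinableReparam_stretchR isDefinableReparam_id ?_ ?_ ?_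
  · rintro r (rfl | rfl)
    · have : stretchR (0 : Set.Icc (0 : R) 1) = 0 := Subtype.ext (by simp [stretchR])
      simp [this]
    · have : stretchR (1 : Set.Icc (0 : R) 1) = 1 := Subtype.ext (by norm_num [stretchR])
      simp [this]
  · intro a
    rw [concat_apply]
    split_ifs with ha
    · have e : stretchR (getFirst a) = 0 := Subtype.ext (by
        change max 0 (2 * (getFirst a : R) - 1) = 0
        refine max_eq_left ?_
        have : 2 * (getFirst a : R) ≤ 2 * 2⁻¹ := by gcongr
        have h2 : (2 : R) * 2⁻¹ = 1 := by norm_num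
        linarith)
      rw [e]
      exact (h.eq_base f.mapsTo (Or.inl (by simp))).symm
    · rfl
  · intro a
    simp

theorem reverse_concat (h : IsLoopSystem A B b)
    (f : SystemMap (cubeSpace L R (n + 1)) D' A B) :
    (concat h (reverse h f) f).Homotopic (constLoop h) := by
  have hρ : ∀ t : Set.Icc (0 : R) 1, max (1 - 2 * (t : R)) (2 * t - 1) ∈ Set.Icc (0 : R) 1 := by
    rintro ⟨t, h0, h1⟩
    refine ⟨?_, max_le (by simp only; linarith) (by simp only; linarith)⟩
    rcases le_total (2 * t) 1 with h' | h'
    · exact le_max_of_le_left (by simp only; linarith)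
    · exact le_max_of_le_right (by simp only; linarith)
  have hr : IsDefinableReparam (R := R) L (fun t => ⟨_, hρ t⟩)
      (fun t => max (1 - 2 * t) (2 * t - 1)) := by
    refine ⟨by fun_prop, ?_, fun _ => rfl⟩
    have h2 := definableFun_mul' (L := L) (definableFun_const' (2 : R))
      (definableFun_proj' (0 : Fin 1))
    exact definableFun_max' (definableFun_sub' (definableFun_const' _) h2)
      (definableFun_sub' h2 (definableFun_const' _))
  have h2 : (2 : R) * 2⁻¹ = 1 := by norm_num
  refine homotopic_of_line h f _ _ hr isDefinableReparam_one ?_ ?_ ?_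
  · have key : ∀ r : Set.Icc (0 : R) 1, r = 0 ∨ r = 1 →
        (⟨_, hρ r⟩ : Set.Icc (0 : R) 1) = 1 := by
      rintro r (rfl | rfl)
      · exact Subtype.ext (by norm_num)
      · exact Subtype.ext (by norm_num)
    intro r hr
    exact ⟨key r hr, Or.inr (key r hr)⟩
  · intro a
    rw [concat_apply]
    split_ifs with ha
    · have : 2 * (getFirst a : R) ≤ 2 * 2⁻¹ := by gcongr
      change f.toLDMap (setFirst (setFirst a _) (flip01 (getFirst (setFirst a _)))) = _
      rw [getFirst_setFirst, setFirst_setFirst]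
      congr 2
      refine Subtype.ext ?_
      change 1 - min 1 (2 * (getFirst a : R)) = max (1 - 2 * (getFirst a : R)) _
      rw [min_eq_right (by linarith), max_eq_left (by linarith)]
    · have : 2 * 2⁻¹ < 2 * (getFirst a : R) := by
        push Not at ha
        gcongr
      congr 2
      refine Subtype.ext ?_
      change max 0 (2 * (getFirst a : R) - 1) = max _ (2 * (getFirst a : R) - 1)
      rw [max_eq_right (by linarith), max_eq_right (by linarith)]
  · intro a
    exact (h.eq_base f.mapsTo (Or.inr (by simp))).symm

theorem concat_assoc (h : IsLoopSystem A B b)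
    (f g k : SystemMap (cubeSpace L R (n + 1)) D' A B) :
    (concat h (concat h f g) k).Homotopic (concat h f (concat h g k)) := by
  have hρ : ∀ t : Set.Icc (0 : R) 1,
      min (2 * (t : R)) (min (t + 4⁻¹) (2⁻¹ * t + 2⁻¹)) ∈ Set.Icc (0 : R) 1 := by
    rintro ⟨t, h0, h1⟩
    refine ⟨le_min (by positivity) (le_min (by positivity) (by positivity)), ?_⟩
    refine (min_le_right _ _).trans ((min_le_right _ _).trans ?_)
    simp only
    linarith [mul_le_mul_of_nonneg_left h1 (by positivity : (0 : R) ≤ 2⁻¹),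
      (by norm_num : (2⁻¹ : R) * 1 + 2⁻¹ = 1)]
  have hr : IsDefinableReparam (R := R) L (fun t => ⟨_, hρ t⟩)
      (fun t => min (2 * t) (min (t + 4⁻¹) (2⁻¹ * t + 2⁻¹))) := by
    refine ⟨by fun_prop, ?_, fun _ => rfl⟩
    have hp := definableFun_proj' (L := L) (R := R) (0 : Fin 1)
    exact definableFun_min' (definableFun_mul' (definableFun_const' _) hp)
      (definableFun_min' (definableFun_add' hp (definableFun_const' _))
        (definableFun_add' (definableFun_mul' (definableFun_const' _) hp)
          (definableFun_const' _)))
  refine homotopic_of_line h (concat h f (concat h g k)) _ _ hr isDefinableReparam_id ?_ ?_ ?_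
  · rintro r (rfl | rfl)
    · have : (⟨_, hρ 0⟩ : Set.Icc (0 : R) 1) = 0 := Subtype.ext (by
        change min (2 * (0 : R)) (min (0 + 4⁻¹) (2⁻¹ * 0 + 2⁻¹)) = 0
        simp)
      exact ⟨this, Or.inl this⟩
    · have : (⟨_, hρ 1⟩ : Set.Icc (0 : R) 1) = 1 := Subtype.ext (by
        change min (2 * (1 : R)) (min (1 + 4⁻¹) (2⁻¹ * 1 + 2⁻¹)) = 1
        norm_num)
      exact ⟨this, Or.inr this⟩
  · intro a
    obtain ⟨t, ht⟩ : ∃ t, t = getFirst a := ⟨_, rfl⟩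
    have h0 := t.2.1
    have h1 := t.2.2
    simp only [concat_apply, getFirst_setFirst, setFirst_setFirst, ← ht]
    have i2 : (2⁻¹ : R) = 1 / 2 := by norm_num
    have i4 : (4⁻¹ : R) = 1 / 4 := by norm_num
    rcases le_or_gt (t : R) 4⁻¹ with c1 | c1
    · have e : min (2 * (t : R)) (min (t + 4⁻¹) (2⁻¹ * t + 2⁻¹)) = 2 * t :=
        min_eq_left (le_min (by linarith) (by rw [i2] at *; rw [i4] at *; linarith))
      have e1 : min 1 (2 * (t : R)) = 2 * t := min_eq_right (by rw [i4] at c1; linarith)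
      have l1 : (t : R) ≤ 2⁻¹ := by rw [i2]; rw [i4] at c1; linarith
      have l2 : 2 * (t : R) ≤ 2⁻¹ := by rw [i2]; rw [i4] at c1; linarith
      rw [if_pos l1, if_pos (by simpa [stretchL, e1] using l2), if_pos (by simpa [e] using l2)]
      congr 3
      exact Subtype.ext (by simp [stretchL, e1, e])
    · rw [i4] at c1
      rcases le_or_gt (t : R) 2⁻¹ with c2 | c2
      · rw [i2] at c2
        have e : min (2 * (t : R)) (min (t + 4⁻¹) (2⁻¹ * t + 2⁻¹)) = t + 1 / 4 := by
          rw [i2, i4, min_eq_right (min_le_of_left_le (by linarith)), min_eq_left (by linarith)]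
        have e1 : min 1 (2 * (t : R)) = 2 * t := min_eq_right (by linarith)
        have e2 : max 0 (2 * (t + 1 / 4) - 1 : R) = 2 * t - 1 / 2 := by
          rw [max_eq_right (by linarith)]
          ring
        have s1 : (stretchL t : R) = 2 * t := e1
        have s2 : (stretchR ⟨_, hρ t⟩ : R) = 2 * t - 1 / 2 := by
          rw [← e2, ← e]
          rfl
        rw [if_pos (by rw [i2]; exact c2), if_neg (by rw [s1, i2]; linarith),
          if_neg (by rw [e, i2]; linarith), if_pos (by rw [s2, i2]; linarith)]
        congr 2
        refine Subtype.ext ?_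
        change max 0 (2 * (stretchL t : R) - 1) = min 1 (2 * (stretchR ⟨_, hρ t⟩ : R))
        rw [s1, s2, max_eq_right (by linarith), min_eq_right (by linarith)]
        ring
      · rw [i2] at c2
        have e : min (2 * (t : R)) (min (t + 4⁻¹) (2⁻¹ * t + 2⁻¹)) = 1 / 2 * t + 1 / 2 := by
          rw [i2, i4, min_eq_right (min_le_of_left_le (by linarith)), min_eq_right (by linarith)]
        have s2 : stretchR ⟨_, hρ t⟩ = t := by
          refine Subtype.ext ?_
          change max 0 (2 * min (2 * (t : R)) (min (t + 4⁻¹) (2⁻¹ * t + 2⁻¹)) - 1) = t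
          rw [e, max_eq_right (by linarith)]
          ring
        rw [if_neg (by rw [i2]; linarith), if_neg (by rw [e, i2]; linarith), s2,
          if_neg (by rw [i2]; linarith)]
  · intro a
    simp

theorem homotopySet_eq {f g : SystemMap (cubeSpace L R (n + 1)) D' A B} (h : f.Homotopic g) :
    (Quotient.mk (SystemMap.setoid (cubeSpace L R (n + 1)) D' A B) f) =
      Quotient.mk (SystemMap.setoid (cubeSpace L R (n + 1)) D' A B) g :=
  Quotient.sound h

variable (D') in
/-- The group structure, given by concatenation, on the homotopy classes. -/
@[reducible]
def homotopyGroup (h : IsLoopSystem A B b) :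
    Group (HomotopySet (cubeSpace L R (n + 1)) D' A B) :=
  letI : Mul (HomotopySet (cubeSpace L R (n + 1)) D' A B) :=
    ⟨Quotient.map₂ (concat h) fun _ _ h1 _ _ h2 => concat_homotopic h h1 h2⟩
  letI : One (HomotopySet (cubeSpace L R (n + 1)) D' A B) := ⟨Quotient.mk _ (constLoop h)⟩
  letI : Inv (HomotopySet (cubeSpace L R (n + 1)) D' A B) :=
    ⟨Quotient.map (reverse h) fun _ _ h1 => reverse_homotopic h h1⟩
  Group.ofLeftAxioms
    (by
      rintro ⟨f⟩ ⟨g⟩ ⟨k⟩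
      exact homotopySet_eq (concat_assoc h f g k))
    (by
      rintro ⟨f⟩
      exact homotopySet_eq (constLoop_concat h f))
    (by
      rintro ⟨f⟩
      exact homotopySet_eq (reverse_concat h f))

end Group

/-! ### Homotopy groups -/

variable (R) in
/-- The boundary `∂ I ^ n`. -/
def cubeBoundary (n : ℕ) : Set (Cube R n) := {a | ∃ i, a.1 i = 0 ∨ a.1 i = 1}

variable (R) in
/-- The face `I ^ (n - 1)` of `I ^ n`, where the last coordinate vanishes. -/
def cubeFace (n : ℕ) : Set (Cube R n) := {a | ∀ i : Fin n, i.1 + 1 = n → a.1 i = 0}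

variable (R) in
/-- The union `J ^ (n - 1)` of the closed faces of `I ^ n` other than `I ^ (n - 1)`, i.e. the
closure of `∂ I ^ n \ I ^ (n - 1)`. -/
def cubeJ (n : ℕ) : Set (Cube R n) := {a | ∃ i : Fin n, a.1 i = 1 ∨ (a.1 i = 0 ∧ i.1 + 1 ≠ n)}

variable (D) in
/-- The homotopy group `π_n (M, x₀) = [(I ^ n, ∂ I ^ n), (M, x₀)]`. -/
def HomotopyPi (n : ℕ) (x₀ : M) : Type _ :=
  HomotopySet (cubeSpace L R n) D (fun _ : Unit => cubeBoundary R n) (fun _ => {x₀})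

variable (D) in
/-- The relative homotopy group
`π_n (M, A, x₀) = [(I ^ n, I ^ (n - 1), J ^ (n - 1)), (M, A, x₀)]`, for `n ≥ 1`. -/
def RelHomotopyPi (n : ℕ) (A : Set M) (x₀ : A) : Type _ :=
  HomotopySet (cubeSpace L R n) D ![cubeFace R n, cubeJ R n] ![A, {(x₀ : M)}]

theorem isLoopSystem_absolute (n : ℕ) (x₀ : M) :
    IsLoopSystem (fun _ : Unit => cubeBoundary R (n + 1)) (fun _ => {x₀}) x₀ where
  base := by
    refine ⟨(), fun a ha => ⟨0, ?_⟩, rfl⟩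
    simpa [getFirst, Subtype.ext_iff] using ha
  mem _ := rfl
  saturated := by
    rintro _ a ⟨i, hi⟩
    by_cases h : i = 0
    · subst h
      rcases hi with hi | hi
      · exact Or.inl (Subtype.ext hi)
      · exact Or.inr (Or.inl (Subtype.ext hi))
    · exact Or.inr (Or.inr fun t => ⟨i, by simpa [setFirst, h] using hi⟩)

theorem isLoopSystem_relative (n : ℕ) (A : Set M) (x₀ : M) (hA : x₀ ∈ A) :
    IsLoopSystem ![cubeFace R (n + 2), cubeJ R (n + 2)] ![A, {x₀}] x₀ where
  base := by
    refine ⟨1, fun a ha => ⟨0, ?_⟩, rfl⟩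
    have : a.1 0 = 0 ∨ a.1 0 = 1 := by simpa [getFirst, Subtype.ext_iff] using ha
    rcases this with h | h
    · exact Or.inr ⟨h, by simp⟩
    · exact Or.inl h
  mem k := by
    fin_cases k
    · exact hA
    · exact rfl
  saturated := by
    intro k a ha
    fin_cases k
    · refine Or.inr (Or.inr fun t i hi => ?_)
      have h : i ≠ 0 := by
        rintro rfl
        simp at hi
      have := ha i hi
      simpa [setFirst, h] using this
    · obtain ⟨i, hi⟩ := ha
      by_cases h : i = 0
      · subst h
        rcases hi with hi | hi
        · exact Or.inr (Or.inl (Subtype.ext hi))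
        · exact Or.inl (Subtype.ext hi.1)
      · exact Or.inr (Or.inr fun t => ⟨i, by simpa [setFirst, h] using hi⟩)

instance (n : ℕ) (x₀ : M) : Group (HomotopyPi D (n + 1) x₀) :=
  homotopyGroup D (isLoopSystem_absolute n x₀)

/-- The group structure on `π_n (M, A, x₀)` for `n ≥ 2`. -/
instance (n : ℕ) (A : Set M) (x₀ : A) : Group (RelHomotopyPi D (n + 2) A x₀) :=
  homotopyGroup D (isLoopSystem_relative n A x₀ x₀.2)

/-- The map induced on homotopy sets of systems by an ld-map of the targets. -/
def HomotopySet.map {P : Type x''} {D'' : LocDefSpace.{u, v, w, x'', y''} L R P}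
    {κ' : Type z'} {A : κ → Set M} {B : κ → Set N} {A' : κ' → Set M} {C : κ' → Set P}
    (p : LDMap D' D'')
    (hp : ∀ F : M → N, (∀ k, ∀ m ∈ A k, F m ∈ B k) → ∀ k, ∀ m ∈ A' k, p (F m) ∈ C k) :
    HomotopySet D D' A B → HomotopySet D D'' A' C :=
  Quotient.map (fun f => ⟨p.comp f.toLDMap, hp f.toLDMap f.mapsTo⟩) (by
    rintro f g ⟨H, h0, h1, hH⟩
    refine ⟨p.comp H, fun m => congrArg p (h0 m), fun m => congrArg p (h1 m),
      fun k m hm t => ?_⟩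
    exact hp (fun m => H (m, t)) (fun k m hm => hH k m hm t) k m hm)

/-- The induced map `p_* : π_n (M, x₀) → π_n (N, y₀)`, `[f] ↦ [p ∘ f]`, of an ld-map `p` with
`p x₀ = y₀`. -/
def HomotopyPi.map (n : ℕ) (p : LDMap D D') {x₀ : M} {y₀ : N} (h : p x₀ = y₀) :
    HomotopyPi D n x₀ → HomotopyPi D' n y₀ :=
  HomotopySet.map p (by
    intro F hF k m hm
    have := hF k m hm
    simp only [Set.mem_singleton_iff] at this ⊢
    rw [this, h])

theorem cubeBoundary_subset (n : ℕ) : cubeBoundary R n ⊆ cubeFace R n ∪ cubeJ R n := by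
  rintro a ⟨i, hi | hi⟩
  · by_cases h : i.1 + 1 = n
    · refine Or.inl fun j hj => ?_
      have : j = i := Fin.ext (by omega)
      rw [this, hi]
    · exact Or.inr ⟨i, Or.inr ⟨hi, h⟩⟩
  · exact Or.inr ⟨i, Or.inl hi⟩

/-- The induced map `p_* : π_n (E, F, e₀) → π_n (B, b₀)`, `[f] ↦ [p ∘ f]`, where `F` is the fibre
of `p` over `b₀`. -/
def RelHomotopyPi.map (n : ℕ) (p : LDMap D D') (b₀ : N) (e₀ : p ⁻¹' {b₀}) :
    RelHomotopyPi D n (p ⁻¹' {b₀}) e₀ → HomotopyPi D' n b₀ :=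
  HomotopySet.map p (by
    intro F hF k m hm
    rcases cubeBoundary_subset n hm with h | h
    · exact hF 0 m h
    · have : F m = e₀ := hF 1 m h
      rw [this]
      exact e₀.2)

/-! ### Fibrations and coverings -/

/-- `p` has the homotopy lifting property for the definable set `X`. -/
def HasHomotopyLifting (p : LDMap D D') {n : ℕ} (X : Set (Fin n → R)) (hX : IsDefinable L X) :
    Prop :=
  ∀ (f : LDMap (LocDefSpace.ofDefinable X hX) D)
    (H : LDMap ((LocDefSpace.ofDefinable X hX).prod (unitSpace L R)) D'),
    (∀ a, H (a, 0) = p (f a)) →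
      ∃ G : LDMap ((LocDefSpace.ofDefinable X hX).prod (unitSpace L R)) D,
        (∀ a, G (a, 0) = f a) ∧ ∀ z, p (G z) = H z

/-- Fibrations: homotopy lifting for all definable sets. -/
def IsFibration (p : LDMap D D') : Prop :=
  ∀ (n : ℕ) (X : Set (Fin n → R)) (hX : IsDefinable L X), HasHomotopyLifting p X hX

/-- Serre fibrations: homotopy lifting for all closed and bounded definable sets. -/
def IsSerreFibration (p : LDMap D D') : Prop :=
  ∀ (n : ℕ) (X : Set (Fin n → R)) (hX : IsDefinable L X), IsClosed X →
    (∃ r : R, ∀ a ∈ X, ∀ i, |a i| ≤ r) → HasHomotopyLifting p X hX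

end Homotopy

section Covering

universe x' y'

variable {L : FirstOrder.Language.{u, v}} {R : Type w} [L.Structure R] [TopologicalSpace R]
  {M : Type x} {N : Type x'} {D : LocDefSpace.{u, v, w, x, y} L R M}
  {D' : LocDefSpace.{u, v, w, x', y'} L R N}

/-- The restriction of `p` is an ld-homeomorphism from the admissible subspace `V` onto the
admissible subspace `U`. -/
def RestrictsToLDHomeo (p : LDMap D D') (V : Set M) (hV : D.IsAdmissible V) (U : Set N)
    (hU : D'.IsAdmissible U) : Prop :=
  ∃ e : V ≃ U, (∀ m : V, (e m : N) = p m) ∧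
    IsLDMap (D.restrict V hV) (D'.restrict U hU) e ∧
    IsLDMap (D'.restrict U hU) (D.restrict V hV) e.symm

/-- Covering maps: surjective ld-maps `p` such that the target has an admissible covering by open
definable subspaces `U` for which `p` restricts to an ld-homeomorphism `V → U` on every connected
component `V` of `p⁻¹(U)`. -/
def IsLDCovering (p : LDMap D D') : Prop :=
  Function.Surjective p ∧
    ∃ S : Set (Set N), D'.IsOpenAdmissibleCovering S ∧
      ∀ (U : Set N) (_ : U ∈ S) (hU : D'.IsDefinableSubspace U) (V : Set M)
        (hV : D.IsConnComponent (p ⁻¹' U) V),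
        RestrictsToLDHomeo p V hV.1.1 U hU.isAdmissible

end Covering

/-! For a Serre fibration the argument is classical. A cube retracts by central projection onto the
union of all its faces but one. This retraction is the start of a homotopy that brings every point
back to itself at some time, and that time is zero on the retained faces. Homotopy lifting on cubes
therefore lifts any map of a cube with prescribed values on all faces but one
(`HasHomotopyLifting.exists_box_lift`). Prescribing the base point on `J` gives surjectivity of
`p_*`. Lifting a homotopy downstairs, with the two given maps at its ends and the base point on `J ×
I`, gives injectivity.

The substance lies in homotopy lifting for coverings. The field `R` may be non-archimedean and the
definable set `X` need not be closed or bounded, so no Lebesgue number is at hand. Instead, `H`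
takes values in finitely many evenly covered sets `U k`. For fixed `x` the set of `t` with `H (x, t)
∈ U k` is definable, so it has finitely many frontier points, and their number is bounded uniformly
in `x`. Hence one number of steps subdivides `I` suitably for all `x` (`exists_reach`). The break
points are chosen definably, not continuously, and the lift is built step by step
(`exists_isLiftOn`); at first it is known to be definable and continuous along each `{x} × I` only.
Joint continuity is a separate argument (`IsLiftOn.contAt`): if the lift is continuous in `x` where
a step begins, then by a definable tube lemma and the connectedness of intervals all nearby paths
stay in one sheet during that step, and there the lift is the inverse of `p` on the sheet composed
with `H`.

The o-minimal input is uniform finiteness of fibres and the decomposition of definable sets into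
finitely many definably connected pieces. Both come from an induction from `X` to `X × R` on the
package `IsTame`, which takes the place of cell decomposition: generic behaviour on open sets,
pieces, uniform finiteness, and the reduction of sets without interior to lower dimension. The
pieces also show that connected components of admissible subspaces are admissible, open in open
subspaces, and finite in number in each chart, so the components of `p⁻¹(U)` serve as sheets.

For the homotopy groups of a covering, lifts of maps on cubes are unique because cubes are definably
connected (`IsLDCovering.lift_unique`). Hence a lift over the constant map at the base point is
constant. This closes up lifted spheroids in dimension at least two and keeps lifted homotopies
fixed on the boundary. -/

/-! ### Spaces with coordinates in a finite power of `R` -/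

section Coordinates

/-- A topological space with global coordinates in a finite power of `R`. -/
class Coords (R : Type w) [TopologicalSpace R] (X : Type x) [TopologicalSpace X] where
  κ : Type
  finite : Finite κ
  e : X ≃ₜ (κ → R)

attribute [instance] Coords.finite

variable {R : Type w} [TopologicalSpace R] {X : Type x} {Y : Type y} [TopologicalSpace X]
  [TopologicalSpace Y]

instance Coords.self : Coords R R := ⟨Unit, inferInstance, (Homeomorph.funUnique Unit R).symm⟩

instance Coords.pi {κ : Type} [Finite κ] : Coords R (κ → R) := ⟨κ, inferInstance, .refl _⟩

instance Coords.punit : Coords R PUnit :=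
  ⟨Empty, inferInstance, ⟨⟨fun _ i => i.elim, fun _ => ⟨⟩, fun _ => rfl,
    fun _ => funext fun i => i.elim⟩, continuous_const, continuous_const⟩⟩

instance Coords.prod [Coords R X] [Coords R Y] : Coords R (X × Y) where
  κ := Coords.κ R X ⊕ Coords.κ R Y
  finite := inferInstance
  e := {
    toFun z := Sum.elim (Coords.e z.1) (Coords.e z.2)
    invFun c := (Coords.e.symm (c ∘ Sum.inl), Coords.e.symm (c ∘ Sum.inr))
    left_inv z := by simp
    right_inv c := by simp
    continuous_toFun := by
      refine continuous_pi ?_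
      rintro (i | i)
      · exact (continuous_apply i).comp (Coords.e.continuous.comp continuous_fst)
      · exact (continuous_apply i).comp (Coords.e.continuous.comp continuous_snd)
    continuous_invFun := by
      have h1 := (Coords.e (R := R) (X := X)).symm.continuous
      have h2 := (Coords.e (R := R) (X := Y)).symm.continuous
      exact (h1.comp (by fun_prop)).prodMk (h2.comp (by fun_prop)) }

end Coordinates

/-! ### Definable predicates and definable maps -/

section Calculus

variable (L : FirstOrder.Language.{u, v}) (R : Type w) [L.Structure R] [TopologicalSpace R]

universe x₁ x₂ x₃

variable {X : Type x₁} {Y : Type x₂} {Z : Type x₃} [TopologicalSpace X] [TopologicalSpace Y]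
  [TopologicalSpace Z] [Coords R X] [Coords R Y] [Coords R Z]

/-- Definable predicates on a space with coordinates. -/
@[fun_prop]
def DPred (P : X → Prop) : Prop :=
  IsDefinable L {c : Coords.κ R X → R | P (Coords.e.symm c)}

/-- Definable maps between spaces with coordinates. -/
@[fun_prop]
def DFun (f : X → Y) : Prop := DPred L R fun z : X × Y => z.2 = f z.1

variable {L R}

namespace DPred

variable {P Q : X → Prop}

@[fun_prop]
theorem and (hP : DPred L R P) (hQ : DPred L R Q) : DPred L R fun x => P x ∧ Q x :=
  Set.Definable.inter hP hQ

@[fun_prop]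
theorem or (hP : DPred L R P) (hQ : DPred L R Q) : DPred L R fun x => P x ∨ Q x :=
  Set.Definable.union hP hQ

@[fun_prop]
theorem not (hP : DPred L R P) : DPred L R fun x => ¬ P x :=
  Set.Definable.compl hP

@[fun_prop]
theorem imp (hP : DPred L R P) (hQ : DPred L R Q) : DPred L R fun x => P x → Q x := by
  simp only [imp_iff_not_or]
  fun_prop

@[fun_prop]
theorem const (q : Prop) : DPred L R fun _ : X => q := by
  by_cases h : q
  · simp [DPred, h]
  · simp [DPred, h]

theorem congr (hP : DPred L R P) (h : ∀ x, Q x ↔ P x) : DPred L R Q := by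
  rwa [show Q = P from funext fun x => propext (h x)]

theorem forall_finite {ι : Type*} [Finite ι] {P : ι → X → Prop} (h : ∀ i, DPred L R (P i)) :
    DPred L R fun x => ∀ i, P i x := by
  have := Set.definable_iInter_of_finite (L := L) (A := (Set.univ : Set R)) h
  unfold DPred
  convert! this using 1
  ext c
  simp

theorem exists_finite {ι : Type*} [Finite ι] {P : ι → X → Prop} (h : ∀ i, DPred L R (P i)) :
    DPred L R fun x => ∃ i, P i x := by
  have := Set.definable_iUnion_of_finite (L := L) (A := (Set.univ : Set R)) h
  unfold DPred
  convert! this using 1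
  ext c
  simp

-- Existential quantifiers are projections. Together with the Boolean rules and substitution of
-- definable maps, this lets `fun_prop` read off definability from a first-order formula.
@[fun_prop]
theorem ex {P : X → Y → Prop} (h : DPred L R fun z : X × Y => P z.1 z.2) :
    DPred L R fun x => ∃ y, P x y := by
  have := Set.Definable.exists_of_finite (α := Coords.κ R X) (β := Coords.κ R Y) h
  unfold DPred
  convert! this using 1
  ext c
  simp only [Set.mem_ofPred_eq]
  constructor
  · rintro ⟨y, hy⟩
    refine ⟨Coords.e y, ?_⟩
    change P (Coords.e.symm (Sum.elim _ _ ∘ Sum.inl)) (Coords.e.symm (Sum.elim _ _ ∘ Sum.inr))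
    simpa using hy
  · rintro ⟨y, hy⟩
    refine ⟨Coords.e.symm y, ?_⟩
    change P (Coords.e.symm (Sum.elim _ _ ∘ Sum.inl)) (Coords.e.symm (Sum.elim _ _ ∘ Sum.inr)) at hy
    simpa using hy

@[fun_prop]
theorem all {P : X → Y → Prop} (h : DPred L R fun z : X × Y => P z.1 z.2) :
    DPred L R fun x => ∀ y, P x y := by
  have : DPred L R fun x => ¬ ∃ y, ¬ P x y := by fun_prop
  simpa using this

end DPred

theorem DPred.preimage_fst {P : X → Prop} (hP : DPred L R P) :
    DPred L R fun z : X × Y => P z.1 :=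
  Set.Definable.preimage_comp (L := L) (A := (Set.univ : Set R))
    (Sum.inl : Coords.κ R X → Coords.κ R X ⊕ Coords.κ R Y) hP

theorem DPred.preimage_snd {P : Y → Prop} (hP : DPred L R P) :
    DPred L R fun z : X × Y => P z.2 :=
  Set.Definable.preimage_comp (L := L) (A := (Set.univ : Set R))
    (Sum.inr : Coords.κ R Y → Coords.κ R X ⊕ Coords.κ R Y) hP

@[fun_prop]
theorem DPred.comp {P : Y → Prop} {f : X → Y} (hP : DPred L R P) (hf : DFun L R f) :
    DPred L R fun x => P (f x) := by
  have h : DPred L R fun x => ∃ y, y = f x ∧ P y := .ex (.and hf hP.preimage_snd)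
  simpa using h

theorem DFun.of_coord {f : X → Y} (h : ∀ i, (Set.univ : Set R).DefinableFun L
    fun c : Coords.κ R X → R => Coords.e (f (Coords.e.symm c)) i) : DFun L R f := by
  have h1 : ∀ i, IsDefinable L {c : Coords.κ R X ⊕ Coords.κ R Y → R |
      c (Sum.inr i) = Coords.e (f (Coords.e.symm (c ∘ Sum.inl))) i} := fun i =>
    Set.DefinableFun.ofPred_eq (definableFun_proj' _)
      (Set.DefinableFun.comp (g := fun c : Coords.κ R X ⊕ Coords.κ R Y → R => c ∘ Sum.inl)
          (fun r => definableFun_proj' (Sum.inl r)) (h i))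
  have := Set.definable_iInter_of_finite (L := L) (A := (Set.univ : Set R)) h1
  unfold DFun DPred
  convert! this using 1
  ext c
  change Coords.e.symm (c ∘ Sum.inr) = f (Coords.e.symm (c ∘ Sum.inl)) ↔ _
  rw [Homeomorph.symm_apply_eq, funext_iff, Set.mem_iInter]
  rfl

theorem DFun.coord {f : X → Y} (h : DFun L R f) (i) : (Set.univ : Set R).DefinableFun L
    fun c : Coords.κ R X → R => Coords.e (f (Coords.e.symm c)) i := by
  have h2 := (Set.Definable.image_comp (L := L) (A := (Set.univ : Set R)) h
    (fun | none => Sum.inr i | some j => Sum.inl j :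
      Option (Coords.κ R X) → Coords.κ R X ⊕ Coords.κ R Y))
  unfold Set.DefinableFun
  convert! h2 using 1
  ext c
  constructor
  · intro hc
    refine ⟨Sum.elim (c ∘ some) (Coords.e (f (Coords.e.symm (c ∘ some)))), ?_, ?_⟩
    · change Coords.e.symm (_ ∘ Sum.inr) = f (Coords.e.symm (_ ∘ Sum.inl))
      simp
    · ext (_ | j)
      · exact hc
      · rfl
  · rintro ⟨d, hd, rfl⟩
    change Coords.e.symm (d ∘ Sum.inr) = f (Coords.e.symm (d ∘ Sum.inl)) at hd
    change Coords.e (f (Coords.e.symm (d ∘ Sum.inl))) i = d (Sum.inr i)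
    rw [← hd]
    simp

namespace DFun

@[fun_prop]
theorem id : DFun L R fun x : X => x :=
  .of_coord fun i => by simpa using definableFun_proj' i

@[fun_prop]
theorem const (y : Y) : DFun L R fun _ : X => y :=
  .of_coord fun _ => definableFun_const' _

@[fun_prop]
theorem comp {g : Y → Z} {f : X → Y} (hg : DFun L R g) (hf : DFun L R f) :
    DFun L R fun x => g (f x) :=
  .of_coord fun i => by
    have := Set.DefinableFun.comp hf.coord (hg.coord i)
    simpa using this

@[fun_prop]
theorem fst {f : X → Y × Z} (hf : DFun L R f) : DFun L R fun x => (f x).1 :=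
  .of_coord fun i => hf.coord (Sum.inl i)

@[fun_prop]
theorem snd {f : X → Y × Z} (hf : DFun L R f) : DFun L R fun x => (f x).2 :=
  .of_coord fun i => hf.coord (Sum.inr i)

@[fun_prop]
theorem prodMk {f : X → Y} {g : X → Z} (hf : DFun L R f) (hg : DFun L R g) :
    DFun L R fun x => (f x, g x) := by
  refine .of_coord ?_
  rintro (i | i)
  · exact hf.coord i
  · exact hg.coord i

@[fun_prop]
theorem apply {κ : Type} [Finite κ] (i : κ) : DFun L R fun c : κ → R => c i :=
  .of_coord fun _ => definableFun_proj' i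

@[fun_prop]
theorem pi {κ : Type} [Finite κ] {f : X → κ → R} (hf : ∀ i, DFun L R fun x => f x i) :
    DFun L R f := .of_coord fun i => (hf i).coord ()

theorem of_existsUnique {P : X → Y → Prop} (hP : DPred L R fun z : X × Y => P z.1 z.2)
    (h : ∀ x, ∃! y, P x y) : ∃ f : X → Y, DFun L R f ∧ ∀ x, P x (f x) := by
  choose f hf hu using h
  refine ⟨f, ?_, hf⟩
  unfold DFun
  convert! hP using 2 with z
  exact ⟨fun h => h ▸ hf _, hu _ _⟩

end DFun

@[fun_prop]
theorem DPred.eq {f g : X → Y} (hf : DFun L R f) (hg : DFun L R g) :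
    DPred L R fun x => f x = g x := by
  have h : DPred L R fun x => (x, g x).2 = f (x, g x).1 :=
    DPred.comp (P := fun z : X × Y => z.2 = f z.1) hf (by fun_prop)
  simpa [eq_comm] using h

theorem dPred_iff_isDefinable {κ : Type} [Finite κ] {S : Set (κ → R)} :
    DPred L R (fun c => c ∈ S) ↔ IsDefinable L S := Iff.rfl

open Classical in
@[fun_prop]
theorem DFun.ite {P : X → Prop} {f g : X → Y} (hP : DPred L R P) (hf : DFun L R f)
    (hg : DFun L R g) : DFun L R fun x => if P x then f x else g x := by
  have : DPred L R fun z : X × Y => (P z.1 ∧ z.2 = f z.1) ∨ (¬ P z.1 ∧ z.2 = g z.1) := by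
    fun_prop
  unfold DFun
  convert! this using 2 with z
  by_cases h : P z.1 <;> simp [h]

section Field

variable [Field R] [LinearOrder R] [IsOMinimalExpansion L R] {f g : X → R}

@[fun_prop]
theorem DFun.add (hf : DFun L R f) (hg : DFun L R g) : DFun L R fun x => f x + g x :=
  .of_coord fun _ => definableFun_add' (hf.coord ()) (hg.coord ())

@[fun_prop]
theorem DFun.mul (hf : DFun L R f) (hg : DFun L R g) : DFun L R fun x => f x * g x :=
  .of_coord fun _ => definableFun_mul' (hf.coord ()) (hg.coord ())

@[fun_prop]
theorem DFun.sub (hf : DFun L R f) (hg : DFun L R g) : DFun L R fun x => f x - g x :=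
  .of_coord fun _ => definableFun_sub' (hf.coord ()) (hg.coord ())

@[fun_prop]
theorem DFun.neg (hf : DFun L R f) : DFun L R fun x => - f x := by
  simpa using (DFun.const (0 : R)).sub hf

@[fun_prop]
theorem DFun.max (hf : DFun L R f) (hg : DFun L R g) : DFun L R fun x => max (f x) (g x) :=
  .of_coord fun _ => definableFun_max' (hf.coord ()) (hg.coord ())

@[fun_prop]
theorem DFun.min (hf : DFun L R f) (hg : DFun L R g) : DFun L R fun x => min (f x) (g x) :=
  .of_coord fun _ => definableFun_min' (hf.coord ()) (hg.coord ())

@[fun_prop]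
theorem DFun.abs (hf : DFun L R f) : DFun L R fun x => |f x| := by
  simpa only [abs_eq_max_neg] using hf.max hf.neg

@[fun_prop]
theorem DFun.inv (hf : DFun L R f) : DFun L R fun x => (f x)⁻¹ := by
  have : DPred L R fun z : X × R => (f z.1 = 0 ∧ z.2 = 0) ∨ (f z.1 ≠ 0 ∧ z.2 * f z.1 = 1) := by
    fun_prop
  unfold DFun
  convert! this using 2 with z
  by_cases h : f z.1 = 0
  · simp [h]
  · simp [h, ← one_div, eq_div_iff h]

@[fun_prop]
theorem DFun.div (hf : DFun L R f) (hg : DFun L R g) : DFun L R fun x => f x / g x := by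
  simp only [div_eq_mul_inv]
  fun_prop

@[fun_prop]
theorem DPred.le (hf : DFun L R f) (hg : DFun L R g) : DPred L R fun x => f x ≤ g x :=
  isDefinable_le (hf.coord ()) (hg.coord ())

@[fun_prop]
theorem DPred.lt (hf : DFun L R f) (hg : DFun L R g) : DPred L R fun x => f x < g x := by
  simpa using (DPred.le hg hf).not

end Field

end Calculus

/-! ### Consequences of o-minimality on the line -/

section Line

variable {L : FirstOrder.Language.{u, v}} {R : Type w} [L.Structure R] [TopologicalSpace R]
  [Field R] [LinearOrder R] [IsStrictOrderedRing R] [OrderTopology R] [IsOMinimalExpansion L R]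

/-- The exceptional set `F` consists of the isolated points and interval end points of a
decomposition of `P`: a convex set that avoids `F` and meets one of the intervals cannot leave it.
The o-minimality axiom enters the proof through this form. -/
theorem DPred.exists_finite_tame {P : R → Prop} (hP : DPred L R P) :
    ∃ F : Set R, F.Finite ∧ ∀ J : Set R, J.OrdConnected → Disjoint J F →
      (∀ x ∈ J, P x) ∨ ∀ x ∈ J, ¬ P x := by
  have h1 : (Set.univ : Set R).Definable₁ L {x | P x} :=
    dPred_iff_isDefinable.1 (hP.comp (f := fun c : Fin 1 → R => c 0) (by fun_prop))
  obtain ⟨T, hT, hS, hT'⟩ := IsOMinimalExpansion.finite_union _ h1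
  have key : ∀ t ∈ T, ∃ F : Set R, F.Finite ∧ ∀ J : Set R, J.OrdConnected → Disjoint J F →
      ∀ x ∈ J, x ∈ t → J ⊆ t := by
    intro t ht
    rcases hT' t ht with ⟨a, rfl⟩ | ⟨a, b, rfl⟩ | ⟨a, rfl⟩ | ⟨a, rfl⟩ | rfl
    · refine ⟨{a}, Set.finite_singleton _, fun J _ hd x hx hxa => ?_⟩
      exact (Set.disjoint_left.1 hd hx hxa).elim
    · refine ⟨{a, b}, (Set.finite_singleton _).insert _, fun J hJ hd x hx hxt y hy => ?_⟩
      refine ⟨lt_of_not_ge fun h => ?_, lt_of_not_ge fun h => ?_⟩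
      · exact Set.disjoint_left.1 hd (hJ.out hy hx ⟨h, hxt.1.le⟩) (by simp)
      · exact Set.disjoint_left.1 hd (hJ.out hx hy ⟨hxt.2.le, h⟩) (by simp)
    · refine ⟨{a}, Set.finite_singleton _, fun J hJ hd x hx hxt y hy => lt_of_not_ge fun h => ?_⟩
      exact Set.disjoint_left.1 hd (hJ.out hx hy ⟨hxt.le, h⟩) (by simp)
    · refine ⟨{a}, Set.finite_singleton _, fun J hJ hd x hx hxt y hy => lt_of_not_ge fun h => ?_⟩
      exact Set.disjoint_left.1 hd (hJ.out hy hx ⟨h, hxt.le⟩) (by simp)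
    · exact ⟨∅, Set.finite_empty, fun J _ _ x _ _ => Set.subset_univ J⟩
  choose! F hF hJ using key
  refine ⟨⋃ t ∈ T, F t, hT.biUnion hF, fun J hJc hd => ?_⟩
  by_cases h : ∃ x ∈ J, P x
  · obtain ⟨x, hx, hPx⟩ := h
    have hx' : x ∈ ⋃₀ T := hS ▸ hPx
    obtain ⟨t, ht, hxt⟩ := hx'
    refine Or.inl fun y hy => ?_
    have : y ∈ {x | P x} := hS ▸ ⟨t, ht, hJ t ht J hJc
      (hd.mono_right (Set.subset_biUnion_of_mem ht)) x hx hxt hy⟩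
    exact this
  · push Not at h
    exact Or.inr h

theorem Set.Finite.exists_gt_disjoint_Ioo {F : Set R} (hF : F.Finite) (a : R) :
    ∃ b > a, Disjoint (Ioo a b) F := by
  have h : ∀ᶠ b in 𝓝[>] a, ∀ c ∈ F, ¬ (a < c ∧ c < b) := by
    refine (Set.Finite.eventually_all hF).2 fun c _ => ?_
    by_cases hc : a < c
    · filter_upwards [Ioo_mem_nhdsGT hc] with b hb h
      exact (hb.2.trans h.2).false
    · exact Filter.Eventually.of_forall fun b h => hc h.1
  obtain ⟨b, hb, hb'⟩ := (h.and self_mem_nhdsWithin).exists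
  exact ⟨b, hb', Set.disjoint_left.2 fun c hc hcF => hb c hcF hc⟩

theorem Set.Finite.exists_lt_disjoint_Ioo {F : Set R} (hF : F.Finite) (a : R) :
    ∃ b < a, Disjoint (Ioo b a) F := by
  have h : ∀ᶠ b in 𝓝[<] a, ∀ c ∈ F, ¬ (b < c ∧ c < a) := by
    refine (Set.Finite.eventually_all hF).2 fun c _ => ?_
    by_cases hc : c < a
    · filter_upwards [Ioo_mem_nhdsLT hc] with b hb h
      exact (hb.1.trans h.1).false
    · exact Filter.Eventually.of_forall fun b h => hc h.2
  obtain ⟨b, hb, hb'⟩ := (h.and self_mem_nhdsWithin).exists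
  exact ⟨b, hb', Set.disjoint_left.2 fun c hc hcF => hb c hcF hc⟩

namespace DPred

variable {P : R → Prop}

theorem right_dichotomy (hP : DPred L R P) (a : R) :
    ∃ b > a, (∀ x ∈ Ioo a b, P x) ∨ ∀ x ∈ Ioo a b, ¬ P x := by
  obtain ⟨F, hF, h⟩ := hP.exists_finite_tame
  obtain ⟨b, hb, hd⟩ := hF.exists_gt_disjoint_Ioo a
  exact ⟨b, hb, h _ ordConnected_Ioo hd⟩

theorem left_dichotomy (hP : DPred L R P) (a : R) :
    ∃ b < a, (∀ x ∈ Ioo b a, P x) ∨ ∀ x ∈ Ioo b a, ¬ P x := by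
  obtain ⟨F, hF, h⟩ := hP.exists_finite_tame
  obtain ⟨b, hb, hd⟩ := hF.exists_lt_disjoint_Ioo a
  exact ⟨b, hb, h _ ordConnected_Ioo hd⟩

theorem bot_dichotomy (hP : DPred L R P) :
    ∃ b, (∀ x < b, P x) ∨ ∀ x < b, ¬ P x := by
  obtain ⟨F, hF, h⟩ := hP.exists_finite_tame
  obtain ⟨b, hb⟩ := hF.bddBelow
  exact ⟨b, h (Iio b) ordConnected_Iio (Set.disjoint_left.2 fun c hc hcF => (hb hcF).not_gt hc)⟩

theorem exists_Ioo_of_infinite (hP : DPred L R P) (hi : {x | P x}.Infinite) :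
    ∃ a b, a < b ∧ ∀ x ∈ Ioo a b, P x := by
  obtain ⟨F, hF, h⟩ := hP.exists_finite_tame
  obtain ⟨x, hx, hxF⟩ := hi.exists_notMem_finite hF
  obtain ⟨b, hb, hd⟩ := hF.exists_gt_disjoint_Ioo x
  have hd' : Disjoint (Ico x b) F := by
    refine Set.disjoint_left.2 fun c hc hcF => ?_
    rcases hc.1.eq_or_lt with rfl | h
    · exact hxF hcF
    · exact Set.disjoint_left.1 hd ⟨h, hc.2⟩ hcF
  refine ⟨x, b, hb, fun y hy => ?_⟩
  rcases h _ ordConnected_Ico hd' with h | h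
  · exact h y ⟨hy.1.le, hy.2⟩
  · exact (h x ⟨le_rfl, hb⟩ hx).elim

/-- Definable sets have suprema although `R` need not be Dedekind complete: the supremum is one of
finitely many candidates, namely the exceptional points, a point `a` of the set and an upper bound
`u`. -/
theorem exists_isLUB (hP : DPred L R P) (hne : ∃ x, P x) (hb : BddAbove {x | P x}) :
    ∃ s, IsLUB {x | P x} s := by
  obtain ⟨F, hF, h⟩ := hP.exists_finite_tame
  obtain ⟨a, ha⟩ := hne
  obtain ⟨u, hu⟩ := hb
  have hF' : (F ∪ {a, u}).Finite := hF.union ((Set.finite_singleton _).insert _)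
  obtain ⟨m, ⟨hm, hmu⟩, hmin⟩ := Set.exists_min_image {c ∈ F ∪ {a, u} | c ∈ upperBounds {x | P x}}
    id (hF'.subset fun c hc => hc.1) ⟨u, by simp, hu⟩
  refine ⟨m, hmu, fun b hb => ?_⟩
  by_contra! hbm
  have ham : a < m := (hb ha).trans_lt hbm
  -- `c` is the candidate just below the least candidate bound `m`. Thus `(c, m)` misses `F`, so `P`
  -- is constant there; but `P` holds somewhere in it and fails between `b` and `m`.
  obtain ⟨c, ⟨hc, hcm⟩, hmax⟩ := Set.exists_max_image {c ∈ F ∪ {a, u} | c < m} id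
    (hF'.subset fun c hc => hc.1) ⟨a, by simp, ham⟩
  have hcu : c ∉ upperBounds {x | P x} := fun h => (hmin c ⟨hc, h⟩).not_gt hcm
  obtain ⟨s, hs, hcs⟩ : ∃ s, P s ∧ c < s := by simpa [mem_upperBounds] using hcu
  have hsb : s ≤ b := hb hs
  have hd : Disjoint (Ioo c m) F := Set.disjoint_left.2 fun d hd hdF =>
    (hmax d ⟨Or.inl hdF, hd.2⟩).not_gt hd.1
  obtain ⟨d, hd1, hd2⟩ := exists_between hbm
  rcases h _ ordConnected_Ioo hd with h | h
  · exact (hb (h d ⟨hcs.trans (hsb.trans_lt hd1), hd2⟩)).not_gt hd1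
  · exact h s ⟨hcs, hsb.trans_lt hbm⟩ hs

/-- Induction along a closed interval for definable predicates. -/
theorem Icc_induction (hP : DPred L R P) {a b : R} (ha : P a)
    (hsucc : ∀ s, a ≤ s → s < b → P s → ∃ s' > s, ∀ t ∈ Ioo s s', P t)
    (hlim : ∀ s, a < s → s ≤ b → (∀ t ∈ Ico a s, P t) → P s) : ∀ t ∈ Icc a b, P t := by
  intro t ht
  -- The supremum of the points up to which `P` holds satisfies `P` by `hlim`, and `hsucc` moves
  -- beyond it unless it is `b`.
  let Q : R → Prop := fun s => a ≤ s ∧ s ≤ b ∧ ∀ t, a ≤ t → t ≤ s → P t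
  have hQ : DPred L R Q := by fun_prop
  have hab : a ≤ b := ht.1.trans ht.2
  obtain ⟨s, hs⟩ := hQ.exists_isLUB ⟨a, le_rfl, hab, fun t h1 h2 => le_antisymm h2 h1 ▸ ha⟩
    ⟨b, fun s hs => hs.2.1⟩
  have has : a ≤ s := hs.1 ⟨le_rfl, hab, fun t h1 h2 => le_antisymm h2 h1 ▸ ha⟩
  have hsb : s ≤ b := hs.2 fun s hs => hs.2.1
  have hlt : ∀ t ∈ Ico a s, P t := by
    intro t ht
    obtain ⟨r, hr, htr, -⟩ := hs.exists_between ht.2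
    exact hr.2.2 t ht.1 htr.le
  have hPs : P s := by
    rcases has.eq_or_lt with rfl | h
    · exact ha
    · exact hlim s h hsb hlt
  have hle : ∀ t, a ≤ t → t ≤ s → P t := fun t h1 h2 => by
    rcases h2.eq_or_lt with rfl | h
    · exact hPs
    · exact hlt t ⟨h1, h⟩
  rcases hsb.eq_or_lt with rfl | h
  · exact hle t ht.1 ht.2
  · obtain ⟨s', hs', h'⟩ := hsucc s has h hPs
    obtain ⟨r, hr, hr'⟩ := exists_between (lt_min hs' h)
    rw [lt_min_iff] at hr'
    have : r ≤ s := hs.1 ⟨has.trans hr.le, hr'.2.le, fun t h1 h2 => by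
      rcases le_or_gt t s with h3 | h3
      · exact hle t h1 h3
      · exact h' t ⟨h3, h2.trans_lt hr'.1⟩⟩
    exact (this.not_gt hr).elim

end DPred

section Choice

variable {X : Type x} [TopologicalSpace X] [Coords R X]

theorem exists_dFun_isLUB {P : X → R → Prop} (hP : DPred L R fun z : X × R => P z.1 z.2) :
    ∃ s : X → R, DFun L R s ∧ ∀ x, (∃ y, P x y) → BddAbove {y | P x y} →
      IsLUB {y | P x y} (s x) := by
  let Q : X → R → Prop := fun x s => (∀ y, P x y → y ≤ s) ∧ ∀ b, (∀ y, P x y → y ≤ b) → s ≤ b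
  have hQ : DPred L R fun z : X × R => Q z.1 z.2 := by fun_prop
  -- The default value `0` where there is no supremum makes `T` the graph of a total function.
  let T : X → R → Prop := fun x s => ((∃ s, Q x s) ∧ Q x s) ∨ ((¬ ∃ s, Q x s) ∧ s = 0)
  have hT : DPred L R fun z : X × R => T z.1 z.2 := by fun_prop
  obtain ⟨s, hs, hs'⟩ := DFun.of_existsUnique hT fun x => by
    by_cases h : ∃ s, Q x s
    · obtain ⟨s, hs⟩ := h
      refine ⟨s, Or.inl ⟨⟨s, hs⟩, hs⟩, ?_⟩
      rintro s' (⟨-, h⟩ | ⟨h, -⟩)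
      · exact le_antisymm (h.2 _ hs.1) (hs.2 _ h.1)
      · exact (h ⟨s, hs⟩).elim
    · exact ⟨0, Or.inr ⟨h, rfl⟩, by rintro s' (⟨h', -⟩ | ⟨-, rfl⟩) <;> [exact (h h').elim; rfl]⟩
  refine ⟨s, hs, fun x hne hb => ?_⟩
  have hPx : DPred L R (P x) := hP.comp (f := fun y => (x, y)) (by fun_prop)
  obtain ⟨m, hm⟩ := hPx.exists_isLUB hne hb
  rcases hs' x with ⟨-, h⟩ | ⟨h, -⟩
  · exact ⟨fun y hy => h.1 y hy, fun b hb => h.2 b fun y hy => hb hy⟩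
  · exact (h ⟨m, fun y hy => hm.1 hy, fun b hb => hm.2 fun y hy => hb y hy⟩).elim

theorem exists_dFun_isGLB {P : X → R → Prop} (hP : DPred L R fun z : X × R => P z.1 z.2) :
    ∃ s : X → R, DFun L R s ∧ ∀ x, (∃ y, P x y) → BddBelow {y | P x y} →
      IsGLB {y | P x y} (s x) := by
  obtain ⟨s, hs, h⟩ := exists_dFun_isLUB (P := fun x y => P x (-y)) (L := L)
    (hP.comp (f := fun z : X × R => (z.1, -z.2)) (by fun_prop))
  refine ⟨fun x => - s x, by fun_prop, fun x ⟨y, hy⟩ ⟨b, hb⟩ => ?_⟩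
  have := h x ⟨-y, by simpa using hy⟩ ⟨-b, fun z hz => le_neg.2 (hb hz)⟩
  refine ⟨fun z hz => neg_le.2 (this.1 (by simpa using hz)), fun c hc => ?_⟩
  exact le_neg.2 (this.2 fun z hz => le_neg.2 (hc hz))

/-- Definable choice. -/
theorem exists_dFun_choice {P : X → R → Prop} (hP : DPred L R fun z : X × R => P z.1 z.2) :
    ∃ g : X → R, DFun L R g ∧ ∀ x, (∃ y, P x y) → P x (g x) := by
  classical
  -- The infimum `a x` is chosen if it lies in the fibre. If it does not but the fibre is bounded
  -- below, an interval `(a x, a x + d)` lies in the fibre; `m x` is the supremum of such `d`, and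
  -- `a x + m x / 2` is chosen. If the fibre is unbounded below it contains some `(-∞, -1/d)`, and
  -- `k x` plays the role of `m x`. The cap `d ≤ 1` makes these suprema exist.
  obtain ⟨a, ha, hinf⟩ := exists_dFun_isGLB hP
  obtain ⟨m, hm, hsup⟩ := exists_dFun_isLUB (L := L)
    (P := fun x d => 0 < d ∧ d ≤ 1 ∧ ∀ y, a x < y → y < a x + d → P x y) (by fun_prop)
  obtain ⟨k, hk, hksup⟩ := exists_dFun_isLUB (L := L)
    (P := fun x d => 0 < d ∧ d ≤ 1 ∧ ∀ y, y < - d⁻¹ → P x y) (by fun_prop)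
  refine ⟨fun x => if P x (a x) then a x else
    if ∃ b, ∀ y, P x y → b ≤ y then a x + m x / 2 else - (k x / 2)⁻¹ - 1, ?_, fun x hx => ?_⟩
  · fun_prop
  have hPx : DPred L R (P x) := hP.comp (f := fun y => (x, y)) (by fun_prop)
  dsimp only
  split_ifs with h1 h2
  · exact h1
  · have hg := hinf x hx h2
    obtain ⟨b, hb, hd⟩ := hPx.right_dichotomy (a x)
    have hin : ∀ y ∈ Ioo (a x) b, P x y := by
      refine hd.resolve_right fun hn => ?_
      have : b ≤ a x := hg.2 fun y hy => by
        by_contra! hyb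
        rcases (hg.1 hy).eq_or_lt with h | h
        · exact h1 (h ▸ hy)
        · exact hn y ⟨h, hyb⟩ hy
      exact this.not_gt hb
    have hD : 0 < min 1 (b - a x) := lt_min one_pos (sub_pos.2 hb)
    have hs := hsup x ⟨min 1 (b - a x), hD, min_le_left _ _, fun y hy hy' => hin y ⟨hy, by
      linarith [min_le_right 1 (b - a x)]⟩⟩ ⟨1, fun d hd => hd.2.1⟩
    have hm0 : 0 < m x := hD.trans_le (hs.1 ⟨hD, min_le_left _ _, fun y hy hy' => hin y ⟨hy, by
      linarith [min_le_right 1 (b - a x)]⟩⟩)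
    obtain ⟨d, hd, hlt, -⟩ := hs.exists_between (half_lt_self hm0)
    exact hd.2.2 _ (by linarith [half_pos hm0]) (by linarith)
  · obtain ⟨b, hb⟩ := hPx.bot_dichotomy
    have hin : ∀ y < b, P x y := by
      refine hb.resolve_right fun hn => h2 ⟨b, fun y hy => ?_⟩
      by_contra! hyb
      exact hn y hyb hy
    have hD : 0 < min 1 (1 / (1 + |b|)) := by positivity
    have hD' : ∀ y, y < - (min 1 (1 / (1 + |b|)))⁻¹ → P x y := fun y hy => hin y (by
      have h3 : (1 + |b|) ≤ (min 1 (1 / (1 + |b|)))⁻¹ := by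
        rw [le_inv_comm₀ (by positivity) hD, ← one_div]
        exact min_le_right _ _
      linarith [neg_abs_le b])
    have hs := hksup x ⟨_, hD, min_le_left _ _, hD'⟩ ⟨1, fun d hd => hd.2.1⟩
    have hm0 : 0 < k x := hD.trans_le (hs.1 ⟨hD, min_le_left _ _, hD'⟩)
    obtain ⟨d, hd, hlt, -⟩ := hs.exists_between (half_lt_self hm0)
    refine hd.2.2 _ ?_
    have : d⁻¹ < (k x / 2)⁻¹ := (inv_lt_inv₀ hd.1 (by positivity)).2 hlt
    linarith

end Choice

end Line

/-! ### Tame behaviour of definable sets and functions on small open sets -/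

section Generic

variable {L : FirstOrder.Language.{u, v}} {R : Type w} [L.Structure R] [TopologicalSpace R]
  [Field R] [LinearOrder R] [IsStrictOrderedRing R] [OrderTopology R] [IsOMinimalExpansion L R]

/-! ### Generic behaviour on the line -/

/-- One of the two sets is infinite in `(a, b)`, and an infinite definable subset of the line
contains an interval. -/
theorem line_split {P Q : R → Prop} (hP : DPred L R P) (hQ : DPred L R Q) {a b : R} (hab : a < b)
    (h : ∀ t ∈ Ioo a b, P t ∨ Q t) : ∃ c d, a ≤ c ∧ c < d ∧ d ≤ b ∧
      ((∀ t ∈ Ioo c d, P t) ∨ ∀ t ∈ Ioo c d, Q t) := by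
  have key : ∀ P : R → Prop, DPred L R P → {t | (a < t ∧ t < b) ∧ P t}.Infinite →
      ∃ c d, a ≤ c ∧ c < d ∧ d ≤ b ∧ ∀ t ∈ Ioo c d, P t := by
    intro P hP hi
    obtain ⟨c, d, hcd, h⟩ := DPred.exists_Ioo_of_infinite (L := L)
      (P := fun t => (a < t ∧ t < b) ∧ P t) (by fun_prop) hi
    refine ⟨c, d, ?_, hcd, ?_, fun t ht => (h t ht).2⟩
    · by_contra! hc
      obtain ⟨t, h1, h2⟩ := exists_between (lt_min hcd hc)
      rw [lt_min_iff] at h2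
      exact (h t ⟨h1, h2.1⟩).1.1.not_gt h2.2
    · by_contra! hc
      obtain ⟨t, h1, h2⟩ := exists_between (max_lt hcd hc)
      rw [max_lt_iff] at h1
      exact (h t ⟨h1.1, h2⟩).1.2.not_gt h1.2
  have hi : ({t | (a < t ∧ t < b) ∧ P t} ∪ {t | (a < t ∧ t < b) ∧ Q t}).Infinite := by
    refine (Ioo_infinite hab).mono fun t ht => ?_
    rcases h t ht with h | h
    · exact Or.inl ⟨ht, h⟩
    · exact Or.inr ⟨ht, h⟩
  rcases Set.infinite_union.1 hi with hi | hi
  · obtain ⟨c, d, h1, h2, h3, h4⟩ := key P hP hi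
    exact ⟨c, d, h1, h2, h3, Or.inl h4⟩
  · obtain ⟨c, d, h1, h2, h3, h4⟩ := key Q hQ hi
    exact ⟨c, d, h1, h2, h3, Or.inr h4⟩

/-- Otherwise every set `{δ ≥ ε}` is finite in `(a, b)`. Call `t` a record if `δ s < δ t` for all
earlier `s`. Near `a`, either all points are records or none is. If all are, `δ` increases there and
is bounded below to the right of any point. If none is, the first `t ≤ m` with `δ t ≥ δ m`, which
exists by finiteness, is nevertheless a record. -/
theorem line_pos {δ : R → R} (hδ : DFun L R δ) {a b : R} (hab : a < b)
    (h : ∀ t ∈ Ioo a b, 0 < δ t) : ∃ c d, a ≤ c ∧ c < d ∧ d ≤ b ∧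
      ∃ ε > 0, ∀ t ∈ Ioo c d, ε ≤ δ t := by
  by_contra! hcon
  have hfin : ∀ ε > 0, {t | (a < t ∧ t < b) ∧ ε ≤ δ t}.Finite := by
    intro ε hε
    by_contra hi
    obtain ⟨m, hm⟩ := exists_between hab
    obtain ⟨c, d, h1, h2, h3, h4⟩ := line_split (L := L) (P := fun t => ε ≤ δ t)
      (Q := fun t => ¬ ε ≤ δ t) (by fun_prop) (by fun_prop) hab fun t _ => em _
    obtain ⟨c, d, hcd, h⟩ := DPred.exists_Ioo_of_infinite (L := L)
      (P := fun t => (a < t ∧ t < b) ∧ ε ≤ δ t) (by fun_prop) hi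
    obtain ⟨c', h1, h2⟩ := exists_between hcd
    obtain ⟨d', h3, h4⟩ := exists_between h2
    have hc := h c' ⟨h1, h2⟩
    have hd := h d' ⟨h1.trans h3, h4⟩
    obtain ⟨t, ht, ht'⟩ := hcon c' d' hc.1.1.le h3 hd.1.2.le ε hε
    exact ((h t ⟨h1.trans ht.1, ht.2.trans h4⟩).2).not_gt ht'
  have hrec : DPred L R fun t => ∀ s, a < s → s < t → δ s < δ t := by fun_prop
  obtain ⟨c, hc, hd⟩ := hrec.right_dichotomy a
  rcases hd with hd | hd
  · obtain ⟨m, hm⟩ := exists_between (lt_min hc hab)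
    rw [lt_min_iff] at hm
    obtain ⟨t, ht, ht'⟩ := hcon m (min c b) hm.1.le (lt_min hm.2.1 hm.2.2) (min_le_right _ _)
      (δ m) (h m ⟨hm.1, hm.2.2⟩)
    exact (hd t ⟨hm.1.trans ht.1, ht.2.trans_le (min_le_left _ _)⟩ m hm.1 ht.1).not_gt ht'
  · obtain ⟨m, hm⟩ := exists_between (lt_min hc hab)
    rw [lt_min_iff] at hm
    have hpos := h m ⟨hm.1, hm.2.2⟩
    obtain ⟨t, ht, hmin⟩ := Set.exists_min_image {t | ((a < t ∧ t < b) ∧ δ m ≤ δ t) ∧ t ≤ m} id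
      ((hfin _ hpos).subset fun t ht => ht.1) ⟨m, ⟨⟨hm.1, hm.2.2⟩, le_rfl⟩, le_rfl⟩
    refine hd t ⟨ht.1.1.1, ht.2.trans_lt hm.2.1⟩ fun s hs hst => ?_
    by_contra! hle
    exact (hmin s ⟨⟨⟨hs, hst.trans ht.1.1.2⟩, ht.1.2.trans hle⟩, (hst.trans_le ht.2).le⟩).not_gt hst

/-- Choose the jump height `c` and the length `δ` definably, and shrink to an interval shorter than
a lower bound of `δ`. There `f t < c t < f s` for `t < s`, so `f` is injective and its image
contains an interval; yet the image omits every gap between `f t` and `c t`. -/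
theorem line_no_right_jump {f : R → R} (hf : DFun L R f) {a b : R} (hab : a < b)
    (h : ∀ t ∈ Ioo a b, ∃ c > f t, ∃ δ > 0, ∀ s ∈ Ioo t (t + δ), c < f s) : False := by
  obtain ⟨c, hc, hc'⟩ := exists_dFun_choice (L := L) (R := R)
    (P := fun t c => c > f t ∧ ∃ δ, δ > 0 ∧ ∀ s, t < s → s < t + δ → c < f s) (by fun_prop)
  obtain ⟨δ, hδ, hδ'⟩ := exists_dFun_choice (L := L) (R := R)
    (P := fun t δ => δ > 0 ∧ ∀ s, t < s → s < t + δ → c t < f s) (by fun_prop)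
  have H : ∀ t ∈ Ioo a b, f t < c t ∧ 0 < δ t ∧ ∀ s, t < s → s < t + δ t → c t < f s := by
    intro t ht
    obtain ⟨c, h1, δ, h2, h3⟩ := h t ht
    have h4 := hc' t ⟨c, h1, δ, h2, fun s h4 h5 => h3 s ⟨h4, h5⟩⟩
    have h5 := hδ' t h4.2
    exact ⟨h4.1, h5⟩
  obtain ⟨p, q, hp, hpq, hq, ε, hε, hle⟩ := line_pos hδ hab fun t ht => (H t ht).2.1
  obtain ⟨r, hr⟩ := exists_between (lt_min hpq (lt_add_of_pos_right p hε))
  rw [lt_min_iff] at hr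
  have hmono : ∀ t ∈ Ioo p r, ∀ s ∈ Ioo p r, t < s → c t < f s := by
    intro t ht s hs hts
    have ht' : t ∈ Ioo p q := ⟨ht.1, ht.2.trans hr.2.1⟩
    refine (H t ⟨hp.trans_lt ht.1, ht'.2.trans_le hq⟩).2.2 s hts ?_
    linarith [hle t ht', hs.2, ht.1]
  have hfc : ∀ t ∈ Ioo p r, f t < c t := fun t ht =>
    (H t ⟨hp.trans_lt ht.1, (ht.2.trans hr.2.1).trans_le hq⟩).1
  have hinj : InjOn f (Ioo p r) := by
    intro t ht s hs hts
    by_contra hne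
    rcases lt_or_gt_of_ne hne with h' | h'
    · exact (((hfc t ht).trans (hmono t ht s hs h')).ne hts)
    · exact (((hfc s hs).trans (hmono s hs t ht h')).ne hts.symm)
  have him : DPred L R fun v => ∃ t, (p < t ∧ t < r) ∧ f t = v := by fun_prop
  obtain ⟨u, v, huv, himg⟩ := him.exists_Ioo_of_infinite
    (((Ioo_infinite hr.1).image hinj).mono (by
      rintro _ ⟨t, ht, rfl⟩
      exact ⟨t, ht, rfl⟩))
  obtain ⟨m, hm⟩ := exists_between huv
  obtain ⟨t, ht, rfl⟩ := himg m hm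
  obtain ⟨k, hk⟩ := exists_between (lt_min hm.2 (hfc t ht))
  rw [lt_min_iff] at hk
  obtain ⟨s, hs, rfl⟩ := himg k ⟨hm.1.trans hk.1, hk.2.1⟩
  rcases lt_trichotomy t s with h' | rfl | h'
  · exact (hmono t ht s hs h').not_gt hk.2.2
  · exact hk.1.false
  · exact ((hfc s hs).trans (hmono s hs t ht h')).not_gt hk.1

theorem line_no_left_jump {f : R → R} (hf : DFun L R f) {a b : R} (hab : a < b)
    (h : ∀ t ∈ Ioo a b, ∃ c > f t, ∃ δ > 0, ∀ s ∈ Ioo (t - δ) t, c < f s) : False := by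
  refine line_no_right_jump (L := L) (f := fun t => f (-t)) (by fun_prop) (neg_lt_neg hab)
    fun t ht => ?_
  obtain ⟨c, hc, δ, hδ, h⟩ := h (-t) ⟨by linarith [ht.2], by linarith [ht.1]⟩
  exact ⟨c, hc, δ, hδ, fun s hs => h (-s) ⟨by linarith [hs.2], by linarith [hs.1]⟩⟩

theorem line_eventually_lt {f : R → R} (hf : DFun L R f) {t : R}
    (h1 : ¬ ∃ c > f t, ∃ δ > 0, ∀ s ∈ Ioo t (t + δ), c < f s)
    (h2 : ¬ ∃ c > f t, ∃ δ > 0, ∀ s ∈ Ioo (t - δ) t, c < f s) :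
    ∀ c > f t, ∀ᶠ s in 𝓝 t, f s < c := by
  intro c hc
  obtain ⟨c', h3, h4⟩ := exists_between hc
  have hd : DPred L R fun s => c' < f s := by fun_prop
  obtain ⟨b, hb, hb'⟩ := hd.right_dichotomy t
  obtain ⟨a, ha, ha'⟩ := hd.left_dichotomy t
  have hb'' := hb'.resolve_left fun h => h1 ⟨c', h3, b - t, sub_pos.2 hb, by simpa using h⟩
  have ha'' := ha'.resolve_left fun h => h2 ⟨c', h3, t - a, sub_pos.2 ha, by simpa using h⟩
  filter_upwards [Ioo_mem_nhds ha hb] with s hs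
  rcases lt_trichotomy s t with h | rfl | h
  · exact (not_lt.1 (ha'' s ⟨hs.1, h⟩)).trans_lt h4
  · exact hc
  · exact (not_lt.1 (hb'' s ⟨h, hs.2⟩)).trans_lt h4

/-- On some subinterval no point has an upward jump on either side, so `f` is upper semicontinuous
there by the dichotomy. The same for `-f` gives continuity. -/
theorem line_cont {f : R → R} (hf : DFun L R f) {a b : R} (hab : a < b) :
    ∃ c d, a ≤ c ∧ c < d ∧ d ≤ b ∧ ∀ t ∈ Ioo c d, ContinuousAt f t := by
  have key : ∀ {f : R → R}, DFun L R f → ∀ {a b : R}, a < b →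
      ∃ c d, a ≤ c ∧ c < d ∧ d ≤ b ∧ ∀ t ∈ Ioo c d, ∀ c > f t, ∀ᶠ s in 𝓝 t, f s < c := by
    intro f hf a b hab
    obtain ⟨c, d, h1, h2, h3, h4⟩ := line_split (L := L)
      (P := fun t => ∃ c, c > f t ∧ ∃ δ, δ > 0 ∧ ∀ s, t < s ∧ s < t + δ → c < f s)
      (Q := fun t => ¬ ∃ c, c > f t ∧ ∃ δ, δ > 0 ∧ ∀ s, t < s ∧ s < t + δ → c < f s)
      (by fun_prop) (by fun_prop) hab fun t _ => em _
    rcases h4 with h4 | h4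
    · exact (line_no_right_jump hf h2 h4).elim
    obtain ⟨c', d', h1', h2', h3', h4'⟩ := line_split (L := L)
      (P := fun t => ∃ c, c > f t ∧ ∃ δ, δ > 0 ∧ ∀ s, t - δ < s ∧ s < t → c < f s)
      (Q := fun t => ¬ ∃ c, c > f t ∧ ∃ δ, δ > 0 ∧ ∀ s, t - δ < s ∧ s < t → c < f s)
      (by fun_prop) (by fun_prop) h2 fun t _ => em _
    rcases h4' with h4' | h4'
    · exact (line_no_left_jump hf h2' h4').elim
    exact ⟨c', d', h1.trans h1', h2', h3'.trans h3, fun t ht =>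
      line_eventually_lt hf (h4 t ⟨h1'.trans_lt ht.1, ht.2.trans_le h3'⟩) (h4' t ht)⟩
  obtain ⟨c, d, h1, h2, h3, h4⟩ := key hf hab
  obtain ⟨c', d', h1', h2', h3', h4'⟩ := key hf.neg h2
  refine ⟨c', d', h1.trans h1', h2', h3'.trans h3, fun t ht => tendsto_order.2 ⟨fun e he => ?_,
    fun e he => h4 t ⟨h1'.trans_lt ht.1, ht.2.trans_le h3'⟩ e he⟩⟩
  filter_upwards [h4' t ht (-e) (neg_lt_neg he)] with s hs
  exact neg_lt_neg_iff.1 hs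

/-! ### Definable neighbourhoods -/

section Near

variable {X : Type x} {Y : Type y} [TopologicalSpace X] [Coords R X] [TopologicalSpace Y]
  [Coords R Y]

/-- The coordinates of `x` and `y` differ by less than `δ`. -/
def Near (x y : X) (δ : R) : Prop := ∀ i : Coords.κ R X, |Coords.e y i - Coords.e x i| < δ

@[fun_prop]
theorem DFun.coordinate (i : Coords.κ R X) : DFun L R fun x : X => (Coords.e x : _ → R) i :=
  .of_coord fun _ => by simpa using! definableFun_proj' i

@[fun_prop]
theorem DPred.near {f g : Y → X} {δ : Y → R} (hf : DFun L R f) (hg : DFun L R g)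
    (hδ : DFun L R δ) : DPred L R fun y => Near (f y) (g y) (δ y) := by
  refine DPred.forall_finite fun i => ?_
  fun_prop

theorem near_comm {x y : X} {δ : R} : Near x y δ ↔ Near y x δ := by
  simp only [Near, abs_sub_comm]

theorem Near.mono {x y : X} {δ δ' : R} (h : Near x y δ) (hle : δ ≤ δ') : Near x y δ' :=
  fun i => (h i).trans_le hle

theorem near_self (x : X) {δ : R} (h : 0 < δ) : Near x x δ := fun i => by simpa using h

theorem near_prod {z z' : X × Y} {δ : R} :
    Near z z' δ ↔ Near z.1 z'.1 δ ∧ Near z.2 z'.2 δ := Sum.forall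

theorem near_line {t s δ : R} : Near t s δ ↔ |s - t| < δ :=
  ⟨fun h => h (), fun h _ => h⟩

theorem exists_pos_le_of_finite {ι : Type*} [Finite ι] {δ : ι → R} (h : ∀ i, 0 < δ i) :
    ∃ ε > 0, ∀ i, ε ≤ δ i := by
  have : ∀ᶠ ε in 𝓝[>] (0 : R), ∀ i, ε ≤ δ i := by
    refine Filter.eventually_all.2 fun i => ?_
    filter_upwards [Ioo_mem_nhdsGT (h i)] with ε hε using hε.2.le
  obtain ⟨ε, h1, h2⟩ := (this.and self_mem_nhdsWithin).exists
  exact ⟨ε, h2, h1⟩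

theorem near_mem_nhds (x : X) {δ : R} (hδ : 0 < δ) : {y | Near x y δ} ∈ 𝓝 x := by
  refine Filter.eventually_all.2 fun i => ?_
  have hc : Continuous fun y : X => |(Coords.e y : _ → R) i - Coords.e x i| :=
    (((continuous_apply i).comp Coords.e.continuous).sub continuous_const).abs
  exact hc.continuousAt.eventually_lt continuousAt_const (by simpa using hδ)

theorem mem_nhds_iff_near {x : X} {s : Set X} :
    s ∈ 𝓝 x ↔ ∃ δ > (0 : R), ∀ y, Near x y δ → y ∈ s := by
  constructor
  · intro hs
    have h1 : Coords.e.symm ⁻¹' s ∈ 𝓝 (Coords.e x : Coords.κ R X → R) :=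
      Coords.e.symm.continuous.continuousAt.preimage_mem_nhds (by simpa using hs)
    rw [nhds_pi, Filter.mem_pi] at h1
    obtain ⟨I, -, t, ht, hts⟩ := h1
    have h2 : ∀ i, ∃ δ > 0, ∀ b, |b - Coords.e x i| < δ → b ∈ t i := fun i => by
      obtain ⟨δ, hδ, h⟩ := (nhds_basis_abs_sub_lt (Coords.e x i : R)).mem_iff.1 (ht i)
      exact ⟨δ, hδ, fun b hb => h hb⟩
    choose δ hδ h using h2
    obtain ⟨ε, hε, hle⟩ := exists_pos_le_of_finite hδ
    refine ⟨ε, hε, fun y hy => ?_⟩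
    simpa using hts fun i _ => h i _ ((hy i).trans_le (hle i))
  · rintro ⟨δ, hδ, h⟩
    exact Filter.mem_of_superset (near_mem_nhds x hδ) h

/-- Continuity becomes a first-order condition on coordinates; in this way the set of continuity
points of a definable function is seen to be definable. -/
theorem continuousWithinAt_iff_near {f : X → Y} {s : Set X} {x : X} :
    ContinuousWithinAt f s x ↔
      ∀ η > (0 : R), ∃ δ > (0 : R), ∀ y, Near x y δ → y ∈ s → Near (f x) (f y) η := by
  rw [ContinuousWithinAt, Filter.tendsto_def]
  constructor
  · intro h η hη
    have := h _ (near_mem_nhds (f x) hη)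
    rw [mem_nhdsWithin_iff_eventually, Filter.Eventually, mem_nhds_iff_near (R := R)] at this
    exact this
  · intro h t ht
    obtain ⟨η, hη, h'⟩ := (mem_nhds_iff_near (R := R)).1 ht
    rw [mem_nhdsWithin_iff_eventually, Filter.Eventually, mem_nhds_iff_near (R := R)]
    obtain ⟨δ, hδ, h⟩ := h η hη
    exact ⟨δ, hδ, fun y hy hys => h' _ (h y hy hys)⟩

theorem continuousAt_iff_near {f : X → Y} {x : X} :
    ContinuousAt f x ↔ ∀ η > (0 : R), ∃ δ > (0 : R), ∀ y, Near x y δ → Near (f x) (f y) η := by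
  rw [← continuousWithinAt_univ, continuousWithinAt_iff_near (R := R)]
  simp

end Near

/-! ### Generic behaviour on spaces with coordinates -/

variable (L R) in
/-- On every nonempty open set, definable sets, positive definable functions and definable
functions are well-behaved on some smaller nonempty open set. -/
structure IsGeneric (X : Type x) [TopologicalSpace X] [Coords R X] : Prop where
  split : ∀ {P Q : X → Prop}, DPred L R P → DPred L R Q → ∀ U : Set X, IsOpen U → U.Nonempty →
    (∀ x ∈ U, P x ∨ Q x) → ∃ V ⊆ U, IsOpen V ∧ V.Nonempty ∧ ((∀ x ∈ V, P x) ∨ ∀ x ∈ V, Q x)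
  pos : ∀ {δ : X → R}, DFun L R δ → ∀ U : Set X, IsOpen U → U.Nonempty →
    (∀ x ∈ U, 0 < δ x) → ∃ V ⊆ U, IsOpen V ∧ V.Nonempty ∧ ∃ ε > 0, ∀ x ∈ V, ε ≤ δ x
  cont : ∀ {f : X → R}, DFun L R f → ∀ U : Set X, IsOpen U → U.Nonempty →
    ∃ V ⊆ U, IsOpen V ∧ V.Nonempty ∧ ∀ x ∈ V, ContinuousAt f x

theorem isGeneric_punit : IsGeneric L R PUnit where
  split _ _ U hU hne h := ⟨U, subset_rfl, hU, hne, by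
    obtain ⟨x, hx⟩ := hne
    rcases h x hx with h | h
    · exact Or.inl fun y _ => h
    · exact Or.inr fun y _ => h⟩
  pos {δ} _ U hU hne h := ⟨U, subset_rfl, hU, hne, δ ⟨⟩, by
    obtain ⟨x, hx⟩ := hne
    exact h x hx, fun _ _ => le_rfl⟩
  cont _ U hU hne := ⟨U, subset_rfl, hU, hne, fun x _ => continuous_of_discreteTopology.continuousAt⟩

namespace IsGeneric

variable {X : Type x} [TopologicalSpace X] [Coords R X]

theorem exists_box {U : Set (X × R)} (hU : IsOpen U) (hne : U.Nonempty) :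
    ∃ A : Set X, IsOpen A ∧ A.Nonempty ∧ ∃ a b : R, a < b ∧ ∀ x ∈ A, ∀ t ∈ Ioo a b, (x, t) ∈ U := by
  obtain ⟨⟨x, t⟩, hz⟩ := hne
  obtain ⟨A, B, hA, hB, hx, ht, h⟩ := isOpen_prod_iff.1 hU x t hz
  obtain ⟨a, b, hab, h'⟩ := mem_nhds_iff_exists_Ioo_subset.1 (hB.mem_nhds ht)
  exact ⟨A, hA, ⟨x, hx⟩, a, b, hab.1.trans hab.2, fun x hx t ht => h ⟨hx, h' ht⟩⟩

/-- The end points of an interval in each fibre can be chosen definably, hence continuously on a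
smaller open set. Around a point of it a fixed interval `(p, q)` fits between them. -/
theorem open_of_fibers (hX : IsGeneric L R X) {P : X × R → Prop} (hP : DPred L R P) {A : Set X}
    (hA : IsOpen A) (hne : A.Nonempty)
    (h : ∀ x ∈ A, ∃ c d, c < d ∧ ∀ t ∈ Ioo c d, P (x, t)) :
    ∃ W : Set (X × R), IsOpen W ∧ W.Nonempty ∧ ∀ z ∈ W, z.1 ∈ A ∧ P z := by
  obtain ⟨c, hc, hc'⟩ := exists_dFun_choice (L := L) (X := X)
    (P := fun x c => ∃ d, c < d ∧ ∀ t, c < t ∧ t < d → P (x, t)) (by fun_prop)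
  obtain ⟨d, hd, hd'⟩ := exists_dFun_choice (L := L) (X := X)
    (P := fun x d => c x < d ∧ ∀ t, c x < t ∧ t < d → P (x, t)) (by fun_prop)
  have H : ∀ x ∈ A, c x < d x ∧ ∀ t, c x < t ∧ t < d x → P (x, t) :=
    fun x hx => hd' x (hc' x (h x hx))
  obtain ⟨V, hVA, hV, hVne, hcV⟩ := hX.cont hc A hA hne
  obtain ⟨V', hV'V, hV', ⟨x, hx⟩, hdV⟩ := hX.cont hd V hV hVne
  obtain ⟨p, hp1, hp⟩ := exists_between (H x (hVA (hV'V hx))).1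
  obtain ⟨q, hpq, hq⟩ := exists_between hp
  have hev : ∀ᶠ y in 𝓝 x, y ∈ V' ∧ c y < p ∧ q < d y :=
    Filter.Eventually.and (hV'.mem_nhds hx)
      (((hcV x (hV'V hx)).eventually_lt continuousAt_const hp1).and
        (continuousAt_const.eventually_lt (hdV x hx) hq))
  obtain ⟨W, hW, hWo, hxW⟩ := eventually_nhds_iff.1 hev
  refine ⟨W ×ˢ Ioo p q, hWo.prod isOpen_Ioo, ⟨(x, (p + q) / 2), hxW, by
    constructor <;> simp only <;> linarith⟩, ?_⟩
  rintro ⟨y, t⟩ ⟨hy, ht⟩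
  obtain ⟨h1, h2, h3⟩ := hW y hy
  exact ⟨hVA (hV'V h1), (H y (hVA (hV'V h1))).2 t ⟨h2.trans ht.1, ht.2.trans h3⟩⟩

theorem box_of_fibers (hX : IsGeneric L R X) {P : X × R → Prop} (hP : DPred L R P) {A : Set X}
    (hA : IsOpen A) (hne : A.Nonempty) {a b : R}
    (h : ∀ x ∈ A, ∃ c d, a ≤ c ∧ c < d ∧ d ≤ b ∧ ∀ t ∈ Ioo c d, P (x, t)) :
    ∃ W : Set (X × R), IsOpen W ∧ W.Nonempty ∧ W ⊆ A ×ˢ Ioo a b ∧ ∀ z ∈ W, P z := by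
  obtain ⟨W, hW, hWne, hWP⟩ := hX.open_of_fibers (P := fun z => (a < z.2 ∧ z.2 < b) ∧ P z)
    (by fun_prop) hA hne fun x hx => by
      obtain ⟨c, d, h1, h2, h3, h4⟩ := h x hx
      exact ⟨c, d, h2, fun t ht => ⟨⟨h1.trans_lt ht.1, ht.2.trans_le h3⟩, h4 t ht⟩⟩
  exact ⟨W, hW, hWne, fun z hz => ⟨(hWP z hz).1, (hWP z hz).2.1⟩, fun z hz => (hWP z hz).2.2⟩

/-- On each fibre of a box one of the alternatives holds on an interval. Which one it is can be
decided uniformly over a smaller open subset of the base, and the fibre intervals are then thickened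
to an open set. -/
theorem prod_split (hX : IsGeneric L R X) {P Q : X × R → Prop} (hP : DPred L R P)
    (hQ : DPred L R Q) (U : Set (X × R)) (hU : IsOpen U) (hne : U.Nonempty)
    (h : ∀ x ∈ U, P x ∨ Q x) :
    ∃ V ⊆ U, IsOpen V ∧ V.Nonempty ∧ ((∀ x ∈ V, P x) ∨ ∀ x ∈ V, Q x) := by
  obtain ⟨A, hA, hAne, a, b, hab, hbox⟩ := exists_box hU hne
  have key : ∀ {P : X × R → Prop}, DPred L R P → ∀ {V}, V ⊆ A → IsOpen V → V.Nonempty →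
      (∀ x ∈ V, ∃ c d, a ≤ c ∧ c < d ∧ d ≤ b ∧ ∀ t, c < t ∧ t < d → P (x, t)) →
      ∃ V ⊆ U, IsOpen V ∧ V.Nonempty ∧ ∀ x ∈ V, P x := by
    intro P hP V hVA hV hVne h
    obtain ⟨W, hW, hWne, hWs, hPW⟩ := hX.box_of_fibers hP hV hVne h
    exact ⟨W, fun z hz => hbox _ (hVA (hWs hz).1) _ (hWs hz).2, hW, hWne, hPW⟩
  obtain ⟨V, hVA, hV, hVne, h'⟩ := hX.split
    (P := fun x => ∃ c d, a ≤ c ∧ c < d ∧ d ≤ b ∧ ∀ t, c < t ∧ t < d → P (x, t))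
    (Q := fun x => ∃ c d, a ≤ c ∧ c < d ∧ d ≤ b ∧ ∀ t, c < t ∧ t < d → Q (x, t))
    (by fun_prop) (by fun_prop) A hA hAne fun x hx => by
      obtain ⟨c, d, h1, h2, h3, h4⟩ := line_split (L := L) (P := fun t => P (x, t))
        (Q := fun t => Q (x, t)) (by fun_prop) (by fun_prop) hab fun t ht => h _ (hbox x hx t ht)
      exact h4.imp (fun h => ⟨c, d, h1, h2, h3, h⟩) fun h => ⟨c, d, h1, h2, h3, h⟩
  rcases h' with h' | h'
  · obtain ⟨W, h1, h2, h3, h4⟩ := key hP hVA hV hVne h'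
    exact ⟨W, h1, h2, h3, Or.inl h4⟩
  · obtain ⟨W, h1, h2, h3, h4⟩ := key hQ hVA hV hVne h'
    exact ⟨W, h1, h2, h3, Or.inr h4⟩

theorem prod_pos (hX : IsGeneric L R X) {δ : X × R → R} (hδ : DFun L R δ) (U : Set (X × R))
    (hU : IsOpen U) (hne : U.Nonempty) (h : ∀ x ∈ U, 0 < δ x) :
    ∃ V ⊆ U, IsOpen V ∧ V.Nonempty ∧ ∃ ε > 0, ∀ x ∈ V, ε ≤ δ x := by
  obtain ⟨A, hA, hAne, a, b, hab, hbox⟩ := exists_box hU hne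
  obtain ⟨ε, hε, hε'⟩ := exists_dFun_choice (L := L) (X := X)
    (P := fun x ε => 0 < ε ∧ ∃ c d, a ≤ c ∧ c < d ∧ d ≤ b ∧ ∀ t, c < t ∧ t < d → ε ≤ δ (x, t))
    (by fun_prop)
  have H := fun x hx => hε' x (by
    obtain ⟨c, d, h1, h2, h3, ε, h4, h5⟩ := line_pos (L := L) (δ := fun t => δ (x, t))
      (by fun_prop) hab fun t ht => h _ (hbox x hx t ht)
    exact ⟨ε, h4, c, d, h1, h2, h3, h5⟩)
  obtain ⟨V, hVA, hV, hVne, ε₀, hε₀, hle⟩ := hX.pos hε A hA hAne fun x hx => (H x hx).1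
  obtain ⟨W, hW, hWne, hWs, hPW⟩ := hX.box_of_fibers (a := a) (b := b) (P := fun z => ε₀ ≤ δ z)
    (by fun_prop) hV hVne fun x hx => by
      obtain ⟨-, c, d, h1, h2, h3, h4⟩ := H x (hVA hx)
      exact ⟨c, d, h1, h2, h3, fun t ht => (hle x hx).trans (h4 t ht)⟩
  exact ⟨W, fun z hz => hbox _ (hVA (hWs hz).1) _ (hWs hz).2, hW, hWne, ε₀, hε₀, hPW⟩

/-- If `f` were discontinuous throughout an open set, its oscillation could be bounded below by a
fixed `ε₀` on a smaller one. But `f` is continuous in each variable separately at generic points, so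
it changes by less than `ε₀ / 2` along each of the two legs from `z` through `(y.1, z.2)` to `y`.
The second leg starts at a varying point, so the radius in the line direction must be made uniform;
the radius in the `X` direction is needed at `z` only. -/
theorem prod_cont (hX : IsGeneric L R X) {f : X × R → R} (hf : DFun L R f) (U : Set (X × R))
    (hU : IsOpen U) (hne : U.Nonempty) :
    ∃ V ⊆ U, IsOpen V ∧ V.Nonempty ∧ ∀ x ∈ V, ContinuousAt f x := by
  obtain ⟨V, hVU, hV, hVne, h⟩ := hX.prod_split
    (P := fun z => ∀ η : R, η > 0 → ∃ δ : R, δ > 0 ∧ ∀ y, Near z y δ → Near (f z) (f y) η)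
    (Q := fun z => ¬ ∀ η : R, η > 0 → ∃ δ : R, δ > 0 ∧ ∀ y, Near z y δ → Near (f z) (f y) η)
    (by fun_prop) (by fun_prop) U hU hne fun z _ => em _
  rcases h with h | h
  · exact ⟨V, hVU, hV, hVne, fun z hz => (continuousAt_iff_near (R := R)).2 (h z hz)⟩
  obtain ⟨ε, hε, hε'⟩ := exists_dFun_choice (L := L) (X := X × R)
    (P := fun z (η : R) => 0 < η ∧ ∀ δ : R, δ > 0 → ∃ y, Near z y δ ∧ ¬ Near (f z) (f y) η) (by fun_prop)
  have H := fun z hz => hε' z (by simpa using h z hz)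
  obtain ⟨W, hWV, hW, hWne, ε₀, hε₀, hle⟩ := hX.prod_pos hε V hV hVne fun z hz => (H z hz).1
  let η := ε₀ / 2
  have hη : 0 < η := half_pos hε₀
  obtain ⟨W₁, hW₁W, hW₁, hW₁ne, h₁⟩ := hX.prod_split
    (P := fun z => ∃ δ, δ > 0 ∧ ∀ s, |s - z.2| < δ → |f (z.1, s) - f z| < η)
    (Q := fun z => ¬ ∃ δ, δ > 0 ∧ ∀ s, |s - z.2| < δ → |f (z.1, s) - f z| < η)
    (by fun_prop) (by fun_prop) W hW hWne fun z _ => em _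
  have h₁ : ∀ z ∈ W₁, ∃ δ, δ > 0 ∧ ∀ s, |s - z.2| < δ → |f (z.1, s) - f z| < η := by
    refine h₁.resolve_right fun h₁ => ?_
    obtain ⟨A, hA, ⟨x, hx⟩, a, b, hab, hbox⟩ := exists_box hW₁ hW₁ne
    obtain ⟨c, d, h1, h2, h3, h4⟩ := line_cont (L := L) (f := fun t => f (x, t)) (by fun_prop) hab
    obtain ⟨m, hm⟩ := exists_between h2
    refine h₁ _ (hbox x hx m ⟨h1.trans_lt hm.1, hm.2.trans_le h3⟩) ?_
    obtain ⟨δ, hδ, h⟩ := (continuousAt_iff_near (R := R)).1 (h4 m hm) η hη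
    exact ⟨δ, hδ, fun s hs => near_line.1 (h s (near_line.2 hs))⟩
  obtain ⟨W₂, hW₂W, hW₂, hW₂ne, h₂⟩ := hX.prod_split
    (P := fun z => ∃ δ : R, δ > 0 ∧ ∀ y, Near z.1 y δ → |f (y, z.2) - f z| < η)
    (Q := fun z => ¬ ∃ δ : R, δ > 0 ∧ ∀ y, Near z.1 y δ → |f (y, z.2) - f z| < η)
    (by fun_prop) (by fun_prop) W₁ hW₁ hW₁ne fun z _ => em _
  have h₂ : ∀ z ∈ W₂, ∃ δ : R, δ > 0 ∧ ∀ y, Near z.1 y δ → |f (y, z.2) - f z| < η := by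
    refine h₂.resolve_right fun h₂ => ?_
    obtain ⟨A, hA, hAne, a, b, hab, hbox⟩ := exists_box hW₂ hW₂ne
    obtain ⟨t, ht⟩ := exists_between hab
    obtain ⟨B, hBA, hB, ⟨x, hx⟩, hc⟩ := hX.cont (f := fun x => f (x, t)) (by fun_prop) A hA hAne
    refine h₂ _ (hbox x (hBA hx) t ht) ?_
    obtain ⟨δ, hδ, h⟩ := (continuousAt_iff_near (R := R)).1 (hc x hx) η hη
    exact ⟨δ, hδ, fun s hs => near_line.1 (h s hs)⟩
  obtain ⟨δ, hδ, hδ'⟩ := exists_dFun_choice (L := L) (X := X × R)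
    (P := fun z δ => δ > 0 ∧ ∀ s, |s - z.2| < δ → |f (z.1, s) - f z| < η) (by fun_prop)
  obtain ⟨W₃, hW₃W, hW₃, ⟨z, hz⟩, δ₁, hδ₁, hle₁⟩ := hX.prod_pos hδ W₂ hW₂ hW₂ne fun z hz =>
    (hδ' z (h₁ z (hW₂W hz))).1
  obtain ⟨δ₂, hδ₂, hd₂⟩ := h₂ z (hW₃W hz)
  obtain ⟨δ₃, hδ₃, hd₃⟩ := (mem_nhds_iff_near (R := R)).1 (hW₃.mem_nhds hz)
  have hzW := hW₁W (hW₂W (hW₃W hz))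
  obtain ⟨y, hy, hy'⟩ := (H z (hWV hzW)).2 (min δ₁ (min δ₂ δ₃)) (lt_min hδ₁ (lt_min hδ₂ hδ₃))
  refine (hy' (Near.mono (near_line.2 ?_) (hle z hzW))).elim
  rw [near_prod] at hy
  have hmem : (y.1, z.2) ∈ W₃ := hd₃ _ (near_prod.2
    ⟨hy.1.mono ((min_le_right _ _).trans (min_le_right _ _)), near_self _ hδ₃⟩)
  have e1 := (hδ' _ (h₁ _ (hW₂W (hW₃W hmem)))).2 y.2
    ((near_line.1 (hy.2.mono (min_le_left _ _))).trans_le (hle₁ _ hmem))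
  have e2 := hd₂ y.1 (hy.1.mono ((min_le_right _ _).trans (min_le_left _ _)))
  have e3 := abs_sub_le (f y) (f (y.1, z.2)) (f z)
  have e4 : ε₀ = η + η := (add_halves ε₀).symm
  rw [e4]
  exact e3.trans_lt (add_lt_add e1 e2)

theorem prod (hX : IsGeneric L R X) : IsGeneric L R (X × R) :=
  ⟨hX.prod_split, hX.prod_pos, hX.prod_cont⟩

end IsGeneric

end Generic

/-! ### Connected pieces and uniform finiteness by induction on dimension -/

section Tame

variable {L : FirstOrder.Language.{u, v}} {R : Type w} [L.Structure R] [TopologicalSpace R]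
  [Field R] [LinearOrder R] [IsStrictOrderedRing R] [OrderTopology R] [IsOMinimalExpansion L R]

/-! ### Finite unions of sets of a given kind -/

section FinUnion

variable {X : Type x}

/-- `Z` is a finite union of sets satisfying `K`. -/
def FinUnion (K : Set X → Prop) (Z : Set X) : Prop :=
  ∃ 𝒞 : Set (Set X), 𝒞.Finite ∧ (∀ C ∈ 𝒞, K C) ∧ ⋃₀ 𝒞 = Z

variable {K K' : Set X → Prop}

theorem FinUnion.single {Z : Set X} (h : K Z) : FinUnion K Z :=
  ⟨{Z}, Set.finite_singleton _, by simpa using h, by simp⟩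

theorem FinUnion.iUnion {ι : Type*} [Finite ι] {Z : ι → Set X} (h : ∀ i, FinUnion K (Z i)) :
    FinUnion K (⋃ i, Z i) := by
  choose 𝒞 h1 h2 h3 using h
  refine ⟨⋃ i, 𝒞 i, Set.finite_iUnion h1, ?_, ?_⟩
  · intro C hC
    obtain ⟨i, hi⟩ := Set.mem_iUnion.1 hC
    exact h2 i C hi
  · rw [Set.sUnion_iUnion]
    exact Set.iUnion_congr h3

theorem FinUnion.union {Z Z' : Set X} (h : FinUnion K Z) (h' : FinUnion K Z') :
    FinUnion K (Z ∪ Z') := by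
  rw [Set.union_eq_iUnion]
  exact .iUnion fun b => by cases b <;> assumption

theorem FinUnion.bind {Z : Set X} (h : FinUnion K Z) (hK : ∀ C ⊆ Z, K C → FinUnion K' C) :
    FinUnion K' Z := by
  obtain ⟨𝒞, h1, h2, rfl⟩ := h
  rw [Set.sUnion_eq_iUnion]
  have := h1.to_subtype
  exact .iUnion fun C => hK C (Set.subset_sUnion_of_mem C.2) (h2 C C.2)

theorem FinUnion.exists_bound {Z : Set X} {b : ℕ → X → Prop} (h : FinUnion K Z)
    (hb : ∀ m n x, m ≤ n → b m x → b n x) (hK : ∀ C ⊆ Z, K C → ∃ N, ∀ x ∈ C, b N x) :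
    ∃ N, ∀ x ∈ Z, b N x := by
  obtain ⟨𝒞, h1, h2, rfl⟩ := h
  choose! N hN using fun C (hC : C ∈ 𝒞) => hK C (Set.subset_sUnion_of_mem hC) (h2 C hC)
  obtain ⟨M, hM⟩ := (h1.image N).bddAbove
  refine ⟨M, ?_⟩
  rintro x ⟨C, hC, hx⟩
  exact hb _ _ _ (hM ⟨C, hC, rfl⟩) (hN C hC x hx)

end FinUnion

variable {X : Type x} {Y : Type y} [TopologicalSpace X] [Coords R X] [TopologicalSpace Y]
  [Coords R Y]

theorem DPred.image {f : X → Y} (hf : DFun L R f) {C : Set X} (hC : DPred L R (· ∈ C)) :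
    DPred L R (· ∈ f '' C) := by
  have : DPred L R fun y => ∃ x, x ∈ C ∧ f x = y := by fun_prop
  exact this

/-! ### Definable connectedness -/

variable (L R) in
/-- Definably connected sets (the empty set included). -/
def DConn (C : Set X) : Prop :=
  ∀ U : Set X, DPred L R (· ∈ U) → (∀ x ∈ C, x ∈ U → U ∈ 𝓝[C] x) →
    (∀ x ∈ C, x ∉ U → Uᶜ ∈ 𝓝[C] x) → ∀ x ∈ C, ∀ y ∈ C, x ∈ U → y ∈ U

theorem DConn.image {f : X → Y} (hf : DFun L R f) {C : Set X} (hC : DConn L R C)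
    (hc : ContinuousOn f C) : DConn L R (f '' C) := by
  rintro U hU h1 h2 _ ⟨x, hx, rfl⟩ _ ⟨y, hy, rfl⟩ hxU
  have ht : ∀ x ∈ C, Filter.Tendsto f (𝓝[C] x) (𝓝[f '' C] (f x)) := fun x hx =>
    (hc x hx).tendsto_nhdsWithin_image
  exact hC (f ⁻¹' U) (hU.comp hf) (fun x hx hxU => ht x hx (h1 _ ⟨x, hx, rfl⟩ hxU))
    (fun x hx hxU => ht x hx (h2 _ ⟨x, hx, rfl⟩ hxU)) x hx y hy hxU

/-- Induction along closed intervals, valid for definable predicates, replaces completeness. -/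
theorem dConn_of_ordConnected {J : Set R} (hJ : J.OrdConnected) : DConn L R J := by
  have key : ∀ U : Set R, DPred L R (· ∈ U) → (∀ x ∈ J, x ∈ U → U ∈ 𝓝[J] x) →
      (∀ x ∈ J, x ∉ U → Uᶜ ∈ 𝓝[J] x) → ∀ a ∈ J, ∀ b ∈ J, a ≤ b → a ∈ U → b ∈ U := by
    intro U hU h1 h2 a ha b hb hab haU
    have hsub : Icc a b ⊆ J := hJ.out ha hb
    refine hU.Icc_induction haU ?_ ?_ b ⟨hab, le_rfl⟩
    · intro s h3 h4 hs
      have := nhdsWithin_mono s hsub (h1 s (hsub ⟨h3, h4.le⟩) hs)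
      have h5 : U ∈ 𝓝[>] s := by
        refine nhdsWithin_le_iff.2 ?_ this
        exact Filter.mem_of_superset (Ioo_mem_nhdsGT h4) fun t ht => ⟨h3.trans ht.1.le, ht.2.le⟩
      obtain ⟨s', hs', h6⟩ := (mem_nhdsGT_iff_exists_Ioo_subset).1 h5
      exact ⟨s', hs', h6⟩
    · intro s h3 h4 hs
      by_contra hsU
      have := nhdsWithin_mono s hsub (h2 s (hsub ⟨h3.le, h4⟩) hsU)
      have h5 : Uᶜ ∈ 𝓝[<] s := by
        refine nhdsWithin_le_iff.2 ?_ this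
        exact Filter.mem_of_superset (Ioo_mem_nhdsLT h3) fun t ht => ⟨ht.1.le, ht.2.le.trans h4⟩
      obtain ⟨t, ht, ht'⟩ := (Filter.inter_mem h5 (Ioo_mem_nhdsLT h3) |> fun h =>
        Filter.nonempty_of_mem h)
      exact ht (hs t ⟨ht'.1.le, ht'.2⟩)
  intro U hU h1 h2 a ha b hb haU
  rcases le_total a b with h | h
  · exact key U hU h1 h2 a ha b hb h haU
  · by_contra hbU
    exact key Uᶜ hU.not h2 (fun x hx hxU => by simpa using h1 x hx (by simpa using hxU))
      b hb a ha h hbU haU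

/-- A relatively clopen subset of `T` contains each fibre, which is convex, entirely or not at all.
Local horizontal sections, provided by `hopen`, make its projection relatively clopen in `C`. -/
theorem DConn.of_fibers {C : Set X} (hC : DConn L R C) {T : Set (X × R)}
    (hT : DPred L R (· ∈ T)) (hTC : ∀ z ∈ T, z.1 ∈ C) (hne : ∀ x ∈ C, ∃ t, (x, t) ∈ T)
    (hord : ∀ x, OrdConnected {t | (x, t) ∈ T})
    (hopen : ∀ z ∈ T, ∀ᶠ x in 𝓝[C] z.1, (x, z.2) ∈ T) : DConn L R T := by
  intro U hU h1 h2
  have hfib : ∀ x t s, (x, t) ∈ T → (x, s) ∈ T → (x, t) ∈ U → (x, s) ∈ U := by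
    intro x t s ht hs htU
    have ht' : ∀ t, (x, t) ∈ T → Filter.Tendsto (fun s => (x, s)) (𝓝[{t | (x, t) ∈ T}] t)
        (𝓝[T] (x, t)) := fun t _ =>
      tendsto_nhdsWithin_iff.2 ⟨((by fun_prop : Continuous fun s : R => (x, s)).tendsto t).mono_left
        nhdsWithin_le_nhds, self_mem_nhdsWithin⟩
    exact dConn_of_ordConnected (L := L) (hord x) {t | (x, t) ∈ U}
      (hU.comp (f := fun t => (x, t)) (by fun_prop)) (fun t ht htU => ht' t ht (h1 _ ht htU))
      (fun t ht htU => ht' t ht (h2 _ ht htU)) t ht s hs htU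
  have hsec : ∀ z ∈ T, Filter.Tendsto (fun x => (x, z.2)) (𝓝[C] z.1) (𝓝[T] z) := fun z hz =>
    tendsto_nhdsWithin_iff.2 ⟨((by fun_prop : Continuous fun x : X => (x, z.2)).tendsto
      z.1).mono_left nhdsWithin_le_nhds, hopen z hz⟩
  have hproj := hC {x | ∃ t, (x, t) ∈ T ∧ (x, t) ∈ U}
    (show DPred L R fun x => ∃ t, (x, t) ∈ T ∧ (x, t) ∈ U by fun_prop)
    (by
      rintro x hx ⟨t, htT, htU⟩
      filter_upwards [hsec _ htT (h1 _ htT htU), hopen _ htT] with y hy hy'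
      exact ⟨t, hy', hy⟩)
    (by
      intro x hx hxU
      obtain ⟨t, ht⟩ := hne x hx
      have htU : (x, t) ∉ U := fun h => hxU ⟨t, ht, h⟩
      filter_upwards [hsec _ ht (h2 _ ht htU), hopen _ ht] with y hy hy'
      rintro ⟨s, hs, hsU⟩
      exact hy (hfib y s t hs hy' hsU))
  rintro ⟨x, t⟩ ht ⟨y, s⟩ hs htU
  obtain ⟨s', hs', hsU'⟩ := hproj x (hTC _ ht) y (hTC _ hs) ⟨t, ht, htU⟩
  exact hfib y s' s hs' hs hsU'

/-! ### Embeddings -/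

variable (L R) in
/-- The set `Z ⊆ X` is definably homeomorphic to a subset of `Y`. -/
def EmbedsIn (Z : Set X) (Y : Type y) [TopologicalSpace Y] [Coords R Y] : Prop :=
  ∃ (φ : X → Y) (ψ : Y → X), DFun L R φ ∧ DFun L R ψ ∧ ContinuousOn φ Z ∧
    ContinuousOn ψ (φ '' Z) ∧ ∀ x ∈ Z, ψ (φ x) = x

theorem EmbedsIn.mono {Z Z' : Set X} (h : EmbedsIn L R Z Y) (hs : Z' ⊆ Z) :
    EmbedsIn L R Z' Y := by
  obtain ⟨φ, ψ, h1, h2, h3, h4, h5⟩ := h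
  exact ⟨φ, ψ, h1, h2, h3.mono hs, h4.mono (Set.image_mono hs), fun x hx => h5 x (hs hx)⟩

theorem EmbedsIn.prod {Z : Set X} (h : EmbedsIn L R Z Y) :
    EmbedsIn L R (Z ×ˢ (univ : Set R)) (Y × R) := by
  obtain ⟨φ, ψ, h1, h2, h3, h4, h5⟩ := h
  refine ⟨fun z => (φ z.1, z.2), fun z => (ψ z.1, z.2), by fun_prop, by fun_prop, ?_, ?_, ?_⟩
  · exact (h3.comp continuousOn_fst fun z hz => hz.1).prodMk continuousOn_snd
  · refine (h4.comp continuousOn_fst ?_).prodMk continuousOn_snd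
    rintro _ ⟨z, hz, rfl⟩
    exact ⟨z.1, hz.1, rfl⟩
  · rintro z hz
    simp [h5 z.1 hz.1]

/-! ### Finite fibres -/

variable (L R) in
/-- Definable sets decompose into finitely many definably connected pieces on which a given
definable function is continuous. -/
def HasPieces (X : Type x) [TopologicalSpace X] [Coords R X] : Prop :=
  ∀ D : Set X, DPred L R (· ∈ D) → ∀ f : X → R, DFun L R f →
    FinUnion (fun C => DPred L R (· ∈ C) ∧ DConn L R C ∧ ContinuousOn f C) D

variable (L R) in
/-- Uniform finiteness over `X`. -/
def HasUniformFiniteness (X : Type x) [TopologicalSpace X] [Coords R X] : Prop :=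
  ∀ P : X → R → Prop, DPred L R (fun z : X × R => P z.1 z.2) → (∀ x, {t | P x t}.Finite) →
    ∃ N : ℕ, ∀ x, {t | P x t}.ncard ≤ N

variable (L R) in
/-- Definable subsets `D` of `X` without interior are finite unions of sets `C` such that
`C × R` is definably homeomorphic to a subset of `X`. -/
def HasThinReduction (X : Type x) [TopologicalSpace X] [Coords R X] : Prop :=
  ∀ D : Set X, DPred L R (· ∈ D) → interior D = ∅ →
    FinUnion (fun D' => DPred L R (· ∈ D') ∧ EmbedsIn L R (D' ×ˢ (univ : Set R)) X) D

/-- Definable choice picks one point of each nonempty fibre; removing it lowers the bound by one. -/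
theorem exists_selectors (N : ℕ) : ∀ {P : X → R → Prop}, DPred L R (fun z : X × R => P z.1 z.2) →
    (∀ x, {t | P x t}.Finite) → (∀ x, {t | P x t}.ncard ≤ N) →
    ∃ f : Fin N → X → R, (∀ i, DFun L R (f i)) ∧ ∀ x t, P x t → ∃ i, f i x = t := by
  induction N with
  | zero =>
    intro P _ hfin hN
    refine ⟨fun i => i.elim0, fun i => i.elim0, fun x t ht => ?_⟩
    have := (Set.ncard_eq_zero (hfin x)).1 (Nat.le_zero.1 (hN x))
    exact (this.subset ht : t ∈ (∅ : Set R)).elim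
  | succ N ih =>
    intro P hP hfin hN
    obtain ⟨g, hg, hgP⟩ := exists_dFun_choice hP
    obtain ⟨f, hf, hf'⟩ := ih (P := fun x t => P x t ∧ t ≠ g x) (by fun_prop)
      (fun x => (hfin x).subset fun t ht => ht.1) (fun x => by
        by_cases h : ∃ t, P x t
        · have e : {t | P x t ∧ t ≠ g x} = {t | P x t} \ {g x} := by
            ext t
            simp
          have h1 : g x ∈ {t | P x t} := hgP x h
          rw [e, Set.ncard_sdiff_singleton_of_mem h1]
          exact Nat.sub_le_of_le_add (hN x)
        · have e : {t | P x t ∧ t ≠ g x} = ∅ := by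
            ext t
            simpa using fun ht => (h ⟨t, ht⟩).elim
          simp [e])
    refine ⟨Fin.cons g f, fun i => ?_, fun x t ht => ?_⟩
    · refine Fin.cases ?_ (fun i => ?_) i
      · simpa using hg
      · simpa using hf i
    · by_cases h : t = g x
      · exact ⟨0, by simp [h]⟩
      · obtain ⟨i, hi⟩ := hf' x t ⟨ht, h⟩
        exact ⟨i.succ, by simpa using hi⟩

/-- Again a definably chosen point is removed. Definability of the level sets of the count allows it
to be tested on definably connected sets. -/
theorem DPred.ncard_eq (k : ℕ) : ∀ {P : X → R → Prop}, DPred L R (fun z : X × R => P z.1 z.2) →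
    (∀ x, {t | P x t}.Finite) → DPred L R fun x => {t | P x t}.ncard = k := by
  induction k with
  | zero =>
    intro P hP hfin
    have : DPred L R fun x => ∀ t, ¬ P x t := by fun_prop
    refine this.congr fun x => ?_
    rw [Set.ncard_eq_zero (hfin x), Set.eq_empty_iff_forall_notMem]
    rfl
  | succ k ih =>
    intro P hP hfin
    obtain ⟨g, hg, hgP⟩ := exists_dFun_choice hP
    have h1 := ih (P := fun x t => P x t ∧ t ≠ g x) (by fun_prop)
      (fun x => (hfin x).subset fun t ht => ht.1)
    have h2 : DPred L R fun x => (∃ t, P x t) ∧ {t | P x t ∧ t ≠ g x}.ncard = k := by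
      exact .and (by fun_prop) h1
    refine h2.congr fun x => ?_
    by_cases h : ∃ t, P x t
    · have e : {t | P x t ∧ t ≠ g x} = {t | P x t} \ {g x} := by
        ext t
        simp
      rw [e]
      have h1 : g x ∈ {t | P x t} := hgP x h
      have := Set.ncard_sdiff_singleton_add_one h1 (hfin x)
      simp only [h, true_and]
      rw [← this]
      omega
    · have e : {t | P x t} = ∅ := by
        ext t
        simpa using fun ht => h ⟨t, ht⟩
      simp [h, e]

/-! ### Connected pieces of a definable subset of `X × R` -/

theorem DPred.of_no_frontier {P : R → Prop} (hP : DPred L R P) {J : Set R} (hJ : J.OrdConnected)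
    (h : ∀ t ∈ J, ∃ δ > 0, (∀ s, |s - t| < δ → P s) ∨ ∀ s, |s - t| < δ → ¬ P s) {a b : R}
    (ha : a ∈ J) (hb : b ∈ J) (hPa : P a) : P b := by
  have hn : ∀ (t : R) {δ : R}, 0 < δ → {s | |s - t| < δ} ∈ 𝓝[J] t := fun t δ hδ =>
    mem_nhdsWithin_of_mem_nhds ((nhds_basis_abs_sub_lt t).mem_of_mem hδ)
  refine dConn_of_ordConnected (L := L) hJ {t | P t} hP (fun t ht htP => ?_) (fun t ht htP => ?_)
    a ha b hb hPa
  · obtain ⟨δ, hδ, h | h⟩ := h t ht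
    · exact Filter.mem_of_superset (hn t hδ) h
    · exact (h t (by simpa using hδ) htP).elim
  · obtain ⟨δ, hδ, h | h⟩ := h t ht
    · exact (htP (h t (by simpa using hδ))).elim
    · exact Filter.mem_of_superset (hn t hδ) h

/-- Uniform bound and selectors for the frontiers of the fibres of a definable set. -/
theorem HasUniformFiniteness.exists_frontier_selectors (hX : HasUniformFiniteness L R X)
    {P : X × R → Prop} (hP : DPred L R P) :
    ∃ (N : ℕ) (f : Fin N → X → R), (∀ i, DFun L R (f i)) ∧ ∀ x t, (∀ i, f i x ≠ t) →
      ∃ δ > 0, (∀ s, |s - t| < δ → P (x, s)) ∨ ∀ s, |s - t| < δ → ¬ P (x, s) := by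
  have hF : DPred L R (fun z : X × R => ¬ ∃ δ, δ > 0 ∧
      ((∀ s, |s - z.2| < δ → P (z.1, s)) ∨ ∀ s, |s - z.2| < δ → ¬ P (z.1, s))) := by fun_prop
  have hfin : ∀ x, {t | ¬ ∃ δ, δ > 0 ∧
      ((∀ s, |s - t| < δ → P (x, s)) ∨ ∀ s, |s - t| < δ → ¬ P (x, s))}.Finite := by
    intro x
    obtain ⟨F, hF, h⟩ := DPred.exists_finite_tame (L := L) (P := fun t => P (x, t)) (by fun_prop)
    refine hF.subset fun t ht => ?_
    by_contra htF
    obtain ⟨δ, hδ, hs⟩ := (nhds_basis_abs_sub_lt t).mem_iff.1 (hF.isClosed.isOpen_compl.mem_nhds htF)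
    refine ht ⟨δ, hδ, ?_⟩
    have h1 := h (Ioo (t - δ) (t + δ)) ordConnected_Ioo (Set.disjoint_left.2 fun s hs' => hs
      (abs_lt.2 ⟨by linarith [hs'.1], by linarith [hs'.2]⟩))
    refine h1.imp (fun h s hs => ?_) (fun h s hs => ?_) <;>
    · rw [abs_lt] at hs
      exact h s ⟨by linarith, by linarith⟩
  obtain ⟨N, hN⟩ := hX (fun x t => _) hF hfin
  obtain ⟨f, hf, hf'⟩ := exists_selectors N hF hfin hN
  refine ⟨N, f, hf, fun x t ht => ?_⟩
  by_contra h
  obtain ⟨i, hi⟩ := hf' x t h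
  exact ht i hi

theorem HasPieces.continuousOn₂ (hX : HasPieces L R X) {D : Set X} (hD : DPred L R (· ∈ D))
    {f g : X → R} (hf : DFun L R f) (hg : DFun L R g) :
    FinUnion (fun C => DPred L R (· ∈ C) ∧ DConn L R C ∧ ContinuousOn f C ∧ ContinuousOn g C) D := by
  refine (hX D hD f hf).bind fun C _ hC => ?_
  refine (hX C hC.1 g hg).bind fun C' hs hC' => .single ?_
  exact ⟨hC'.1, hC'.2.1, hC.2.2.mono hs, hC'.2.2⟩

theorem HasPieces.graph (hX : HasPieces L R X) {D : Set X} (hD : DPred L R (· ∈ D)) {f : X → R}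
    (hf : DFun L R f) : FinUnion (fun C : Set (X × R) => DPred L R (· ∈ C) ∧ DConn L R C)
      ((fun x => (x, f x)) '' D) := by
  obtain ⟨𝒞, h1, h2, rfl⟩ := hX D hD f hf
  rw [Set.image_sUnion]
  refine ⟨_, h1.image _, ?_, rfl⟩
  rintro _ ⟨C, hC, rfl⟩
  obtain ⟨h3, h4, h5⟩ := h2 C hC
  exact ⟨DPred.image (by fun_prop) h3, h4.image (by fun_prop) (continuousOn_id.prodMk h5)⟩

/-- The propositions `p` and `q` switch the lower and the upper bound on, so unbounded bands are
included. Over a connected piece on which `f` and `g` are continuous, `DConn.of_fibers` applies. -/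
theorem HasPieces.band (hX : HasPieces L R X) {D : Set X} (hD : DPred L R (· ∈ D)) {f g : X → R}
    (hf : DFun L R f) (hg : DFun L R g) (p q : Prop)
    (hne : ∀ x ∈ D, ∃ t, (p → f x < t) ∧ (q → t < g x)) :
    FinUnion (fun C : Set (X × R) => DPred L R (· ∈ C) ∧ DConn L R C)
      {z | z.1 ∈ D ∧ (p → f z.1 < z.2) ∧ (q → z.2 < g z.1)} := by
  obtain ⟨𝒞, h1, h2, rfl⟩ := hX.continuousOn₂ hD hf hg
  refine ⟨(fun C => {z | z.1 ∈ C ∧ (p → f z.1 < z.2) ∧ (q → z.2 < g z.1)}) '' 𝒞, h1.image _, ?_, ?_⟩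
  · rintro _ ⟨C, hC, rfl⟩
    obtain ⟨h3, h4, h5, h6⟩ := h2 C hC
    have hT : DPred L R fun z : X × R => z.1 ∈ C ∧ (p → f z.1 < z.2) ∧ (q → z.2 < g z.1) := by
      fun_prop
    refine ⟨hT, h4.of_fibers hT (fun z hz => hz.1) (fun x hx => ?_) (fun x => ⟨?_⟩) ?_⟩
    · obtain ⟨t, ht⟩ := hne x ⟨C, hC, hx⟩
      exact ⟨t, hx, ht⟩
    · rintro a ⟨ha, ha1, ha2⟩ b ⟨hb, hb1, hb2⟩ t ht
      exact ⟨ha, fun h => (ha1 h).trans_le ht.1, fun h => ht.2.trans_lt (hb2 h)⟩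
    · rintro ⟨x, t⟩ ⟨hx, hp, hq⟩
      have e1 : ∀ᶠ y in 𝓝[C] x, p → f y < t := by
        by_cases h : p
        · filter_upwards [(h5 x hx).eventually_lt continuousWithinAt_const (hp h)] with y hy _ using hy
        · simp [h]
      have e2 : ∀ᶠ y in 𝓝[C] x, q → t < g y := by
        by_cases h : q
        · filter_upwards [(continuousWithinAt_const.eventually_lt (h6 x hx) (hq h))] with y hy _
            using hy
        · simp [h]
      filter_upwards [self_mem_nhdsWithin, e1, e2] with y hy hy1 hy2 using ⟨hy, hy1, hy2⟩
  · ext z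
    simp only [Set.mem_sUnion, Set.mem_image, exists_exists_and_eq_and]
    constructor
    · rintro ⟨C, hC, hz, h⟩
      exact ⟨⟨C, hC, hz⟩, h⟩
    · rintro ⟨⟨C, hC, hz⟩, h⟩
      exact ⟨C, hC, hz, h⟩

theorem exists_lower_bound_index {N : ℕ} (v : Fin N → R) (t : R) :
    ∃ o : Option (Fin N), (∀ i ∈ o, v i < t) ∧ ∀ j, v j < t → ∃ i ∈ o, v j ≤ v i := by
  by_cases h : ∃ i, v i < t
  · obtain ⟨i, hi, hmax⟩ := Set.exists_max_image {i | v i < t} v (Set.toFinite _) h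
    exact ⟨some i, by simpa using hi, fun j hj => ⟨i, rfl, hmax j hj⟩⟩
  · push Not at h
    exact ⟨none, by simp, fun j hj => ((h j).not_gt hj).elim⟩

theorem exists_upper_bound_index {N : ℕ} (v : Fin N → R) (t : R) :
    ∃ o : Option (Fin N), (∀ i ∈ o, t < v i) ∧ ∀ j, t < v j → ∃ i ∈ o, v i ≤ v j := by
  obtain ⟨o, h1, h2⟩ := exists_lower_bound_index (fun i => - v i) (-t)
  exact ⟨o, fun i hi => neg_lt_neg_iff.1 (h1 i hi), fun j hj => by
    obtain ⟨i, hi, h⟩ := h2 j (neg_lt_neg hj)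
    exact ⟨i, hi, neg_le_neg_iff.1 h⟩⟩

/-- Finitely many definable functions meet all frontier points of the fibres of `A`. Hence `A` is
the union of the parts of their graphs in `A` and of those bands between them that are contained in
`A`. The bands may overlap, since only a finite union is wanted. -/
theorem HasPieces.prod_connected (hX : HasPieces L R X) (hU : HasUniformFiniteness L R X)
    {A : Set (X × R)} (hA : DPred L R (· ∈ A)) :
    FinUnion (fun C : Set (X × R) => DPred L R (· ∈ C) ∧ DConn L R C) A := by
  obtain ⟨N, f, hf, hfr⟩ := hU.exists_frontier_selectors hA
  have hgr : FinUnion (fun C : Set (X × R) => DPred L R (· ∈ C) ∧ DConn L R C)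
      (⋃ i, (fun x => (x, f i x)) '' {x | (x, f i x) ∈ A}) :=
    .iUnion fun i => hX.graph (show DPred L R fun x => (x, f i x) ∈ A by
      have := hf i
      fun_prop) (hf i)
  -- The index `none` stands for an infinite bound; the value `0` is never used, because `isSome`
  -- guards it.
  let F : Option (Fin N) → X → R := fun o => o.elim 0 f
  have hF : ∀ o, DFun L R (F o) := by
    rintro (_ | i)
    · exact DFun.const 0
    · exact hf i
  let D : Option (Fin N) × Option (Fin N) → Set X := fun o =>
    {x | (∃ t, (o.1.isSome → F o.1 x < t) ∧ (o.2.isSome → t < F o.2 x)) ∧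
      ∀ t, (o.1.isSome → F o.1 x < t) ∧ (o.2.isSome → t < F o.2 x) → (x, t) ∈ A}
  have hD : ∀ o, DPred L R (· ∈ D o) := fun o => by
    have h1 := hF o.1
    have h2 := hF o.2
    have : DPred L R fun x =>
      (∃ t, (o.1.isSome → F o.1 x < t) ∧ (o.2.isSome → t < F o.2 x)) ∧
      ∀ t, (o.1.isSome → F o.1 x < t) ∧ (o.2.isSome → t < F o.2 x) → (x, t) ∈ A := by fun_prop
    exact this
  have hbd := FinUnion.iUnion fun o => hX.band (hD o) (hF o.1) (hF o.2) o.1.isSome o.2.isSome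
    fun x hx => hx.1
  convert! hgr.union hbd using 1
  ext ⟨x, t⟩
  constructor
  · intro hz
    by_cases h : ∃ i, f i x = t
    · obtain ⟨i, rfl⟩ := h
      exact Or.inl (Set.mem_iUnion.2 ⟨i, x, hz, rfl⟩)
    · push Not at h
      obtain ⟨o, ho1, ho2⟩ := exists_lower_bound_index (fun i => f i x) t
      obtain ⟨o', ho1', ho2'⟩ := exists_upper_bound_index (fun i => f i x) t
      have hF1 : ∀ s, (o.isSome → F o x < s) ↔ ∀ i ∈ o, f i x < s := by
        intro s
        cases o <;> simp [F]
      have hF2 : ∀ s, (o'.isSome → s < F o' x) ↔ ∀ i ∈ o', s < f i x := by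
        intro s
        cases o' <;> simp [F]
      have ht : (o.isSome → F o x < t) ∧ (o'.isSome → t < F o' x) :=
        ⟨(hF1 t).2 ho1, (hF2 t).2 ho1'⟩
      refine Or.inr (Set.mem_iUnion.2 ⟨(o, o'), ⟨⟨t, ht⟩, fun s hs => ?_⟩, ht⟩)
      refine DPred.of_no_frontier (L := L) (P := fun s => (x, s) ∈ A) (by fun_prop)
        (J := {s | (o.isSome → F o x < s) ∧ (o'.isSome → s < F o' x)}) ⟨?_⟩ ?_ ht hs hz
      · rintro a ⟨ha, -⟩ b ⟨-, hb⟩ s hs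
        exact ⟨fun h => (ha h).trans_le hs.1, fun h => hs.2.trans_lt (hb h)⟩
      · intro s hs
        rw [Set.mem_ofPred_eq, hF1, hF2] at hs
        refine hfr x s fun i hi => ?_
        rcases lt_or_gt_of_ne (h i) with h' | h'
        · obtain ⟨j, hj, hle⟩ := ho2 i h'
          exact ((hs.1 j hj).trans_le (hi ▸ le_rfl)).not_ge hle
        · obtain ⟨j, hj, hle⟩ := ho2' i h'
          exact (((hi ▸ le_rfl : f i x ≤ s)).trans_lt (hs.2 j hj)).not_ge hle
  · rintro (h | h)
    · obtain ⟨i, y, hy, e⟩ := Set.mem_iUnion.1 h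
      rw [← e]
      exact hy
    · obtain ⟨o, ho, ho'⟩ := Set.mem_iUnion.1 h
      exact ho.2 t ho'

/-! ### The inductive step -/

variable (L R) in
/-- The tameness properties that are propagated from `X` to `X × R`. -/
structure IsTame (X : Type x) [TopologicalSpace X] [Coords R X] : Prop where
  generic : IsGeneric L R X
  pieces : HasPieces L R X
  uniform : HasUniformFiniteness L R X
  thin : HasThinReduction L R X

theorem interior_eq_empty_of_forall {Z : Set X}
    (h : ∀ U : Set X, IsOpen U → U.Nonempty → ¬ U ⊆ Z) : interior Z = ∅ := by
  by_contra hne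
  exact h _ isOpen_interior (Set.nonempty_iff_ne_empty.2 hne) interior_subset

/-- Let `D` be the set of base points over which `Z` contains an interval. It has empty interior,
since otherwise `Z` would contain an open set, so the thin reduction for `X` embeds the part of `Z`
over `D`. Over the complement the fibres are finite, and that part lies on finitely many graphs;
these project homeomorphically to `X` where the functions are continuous. -/
theorem IsTame.thin_embeds (hX : IsTame L R X) {Z : Set (X × R)} (hZ : DPred L R (· ∈ Z))
    (hempty : interior Z = ∅) :
    FinUnion (fun Z' => DPred L R (· ∈ Z') ∧ EmbedsIn L R Z' X) Z := by
  let D : Set X := {x | ∃ c d, c < d ∧ ∀ t, c < t ∧ t < d → (x, t) ∈ Z}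
  have hD : DPred L R (· ∈ D) :=
    show DPred L R fun x => ∃ c d, c < d ∧ ∀ t, c < t ∧ t < d → (x, t) ∈ Z by fun_prop
  have hDint : interior D = ∅ := interior_eq_empty_of_forall fun U hU hne hUD => by
    obtain ⟨W, hW, ⟨z, hz⟩, hWZ⟩ := hX.generic.open_of_fibers hZ hU hne hUD
    have : z ∈ interior Z := mem_interior.2 ⟨W, fun z hz => (hWZ z hz).2, hW, hz⟩
    simp [hempty] at this
  have h1 : FinUnion (fun Z' => DPred L R (· ∈ Z') ∧ EmbedsIn L R Z' X) (Z ∩ D ×ˢ univ) := by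
    obtain ⟨𝒞, h1, h2, h3⟩ := hX.thin D hD hDint
    refine ⟨(fun D' => Z ∩ D' ×ˢ univ) '' 𝒞, h1.image _, ?_, ?_⟩
    · rintro _ ⟨D', hD', rfl⟩
      obtain ⟨h4, h5⟩ := h2 D' hD'
      refine ⟨?_, h5.mono Set.inter_subset_right⟩
      have : DPred L R fun z : X × R => z ∈ Z ∧ z.1 ∈ D' := by fun_prop
      exact this.congr fun z => by simp
    · rw [← h3]
      ext z
      simp only [Set.sUnion_image, Set.mem_iUnion, Set.mem_inter_iff, Set.mem_prod, Set.mem_sUnion,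
        Set.mem_univ, and_true, exists_prop]
      tauto
  have hY : DPred L R fun z : X × R => (z.1, z.2) ∈ Z ∧ z.1 ∉ D := by fun_prop
  have hfin : ∀ x, {t | (x, t) ∈ Z ∧ x ∉ D}.Finite := by
    intro x
    by_contra hi
    obtain ⟨a, b, hab, h⟩ := DPred.exists_Ioo_of_infinite (L := L)
      (P := fun t => (x, t) ∈ Z ∧ x ∉ D) (by fun_prop) hi
    obtain ⟨m, hm⟩ := exists_between hab
    exact (h m hm).2 ⟨a, b, hab, fun t ht => (h t ht).1⟩
  obtain ⟨N, hN⟩ := hX.uniform (fun x t => (x, t) ∈ Z ∧ x ∉ D) hY hfin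
  obtain ⟨f, hf, hf'⟩ := exists_selectors N hY hfin hN
  have h2 : FinUnion (fun Z' => DPred L R (· ∈ Z') ∧ EmbedsIn L R Z' X)
      (⋃ i, (fun x => (x, f i x)) '' {x | (x, f i x) ∈ Z ∧ x ∉ D}) := by
    refine .iUnion fun i => ?_
    have hfi := hf i
    obtain ⟨𝒞, h1, h2, h3⟩ := hX.pieces {x | (x, f i x) ∈ Z ∧ x ∉ D}
      (show DPred L R fun x => (x, f i x) ∈ Z ∧ x ∉ D by fun_prop) (f i) hfi
    rw [← h3, Set.image_sUnion]
    refine ⟨_, h1.image _, ?_, rfl⟩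
    rintro _ ⟨C, hC, rfl⟩
    obtain ⟨h4, -, h5⟩ := h2 C hC
    refine ⟨DPred.image (by fun_prop) h4, Prod.fst, fun x => (x, f i x), by fun_prop, by fun_prop,
      continuousOn_fst, ?_, ?_⟩
    · refine continuousOn_id.prodMk (h5.mono ?_)
      rintro _ ⟨_, ⟨x, hx, rfl⟩, rfl⟩
      exact hx
    · rintro _ ⟨x, hx, rfl⟩
      rfl
  convert! h1.union h2 using 1
  ext ⟨x, t⟩
  constructor
  · intro hz
    by_cases hx : x ∈ D
    · exact Or.inl ⟨hz, hx, trivial⟩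
    · obtain ⟨i, hi⟩ := hf' x t ⟨hz, hx⟩
      exact Or.inr (Set.mem_iUnion.2 ⟨i, x, ⟨hi ▸ hz, hx⟩, by simp [hi]⟩)
  · rintro (h | h)
    · exact h.1
    · obtain ⟨i, y, hy, e⟩ := Set.mem_iUnion.1 h
      rw [← e]
      exact hy.1

theorem HasPieces.of_embedsIn (hY : HasPieces L R Y) {Z : Set X} (hZ : DPred L R (· ∈ Z))
    (h : EmbedsIn L R Z Y) {f : X → R} (hf : DFun L R f) :
    FinUnion (fun C => DPred L R (· ∈ C) ∧ DConn L R C ∧ ContinuousOn f C) Z := by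
  obtain ⟨φ, ψ, h1, h2, h3, h4, h5⟩ := h
  obtain ⟨𝒞, hc1, hc2, hc3⟩ := hY (φ '' Z) (DPred.image h1 hZ) (fun y => f (ψ y)) (by fun_prop)
  have e : ψ '' (φ '' Z) = Z := by
    ext x
    constructor
    · rintro ⟨_, ⟨x, hx, rfl⟩, rfl⟩
      rwa [h5 x hx]
    · exact fun hx => ⟨_, ⟨x, hx, rfl⟩, h5 x hx⟩
  rw [← e, ← hc3, Set.image_sUnion]
  refine ⟨_, hc1.image _, ?_, rfl⟩
  rintro _ ⟨C, hC, rfl⟩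
  obtain ⟨h6, h7, h8⟩ := hc2 C hC
  have hCs : C ⊆ φ '' Z := hc3 ▸ Set.subset_sUnion_of_mem hC
  have hψφ : ∀ y ∈ C, φ (ψ y) = y := by
    intro y hy
    obtain ⟨x, hx, rfl⟩ := hCs hy
    rw [h5 x hx]
  have hCZ : ψ '' C ⊆ Z := by
    rintro _ ⟨y, hy, rfl⟩
    obtain ⟨x, hx, rfl⟩ := hCs hy
    rwa [h5 x hx]
  refine ⟨DPred.image h2 h6, h7.image h2 (h4.mono hCs), ?_⟩
  refine (h8.comp (h3.mono hCZ) ?_).congr ?_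
  · rintro _ ⟨y, hy, rfl⟩
    rwa [hψφ y hy]
  · rintro _ ⟨y, hy, rfl⟩
    simp [hψφ y hy]

theorem HasUniformFiniteness.of_embedsIn (hY : HasUniformFiniteness L R Y) {Z : Set X}
    (h : EmbedsIn L R Z Y) {P : X → R → Prop}
    (hP : DPred L R (fun z : X × R => P z.1 z.2)) (hfin : ∀ x, {t | P x t}.Finite) :
    ∃ N, ∀ x ∈ Z, {t | P x t}.ncard ≤ N := by
  obtain ⟨φ, ψ, h1, h2, -, -, h5⟩ := h
  obtain ⟨N, hN⟩ := hY (fun y t => P (ψ y) t)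
    (hP.comp (f := fun z : Y × R => (ψ z.1, z.2)) (by fun_prop)) fun y => hfin _
  exact ⟨N, fun x hx => by simpa [h5 x hx] using hN (φ x)⟩

/-- The part of `D` where `f` is continuous is cut into connected pieces. The part where it is
discontinuous has empty interior by generic continuity, so it embeds piecewise in `X` and inherits
pieces from there. -/
theorem IsTame.prod_pieces (hX : IsTame L R X) : HasPieces L R (X × R) := by
  intro D hD f hf
  have hc : DPred L R fun z : X × R => ∀ η : R, η > 0 → ∃ δ : R, δ > 0 ∧
    ∀ y, Near z y δ → Near (f z) (f y) η := by fun_prop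
  have hc : DPred L R fun z : X × R => ContinuousAt f z :=
    hc.congr fun z => continuousAt_iff_near
  have h1 : FinUnion (fun C => DPred L R (· ∈ C) ∧ DConn L R C ∧ ContinuousOn f C)
      {z | z ∈ D ∧ ContinuousAt f z} :=
    (hX.pieces.prod_connected hX.uniform (hD.and hc)).bind fun C hs hC => .single
      ⟨hC.1, hC.2, fun z hz => (hs hz).2.continuousWithinAt⟩
  have h2 : FinUnion (fun C => DPred L R (· ∈ C) ∧ DConn L R C ∧ ContinuousOn f C)
      {z | z ∈ D ∧ ¬ ContinuousAt f z} := by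
    refine (hX.thin_embeds (hD.and hc.not) ?_).bind fun C hs hC => hX.pieces.of_embedsIn hC.1 hC.2 hf
    refine interior_eq_empty_of_forall fun U hU hne hUD => ?_
    obtain ⟨V, hVU, -, ⟨z, hz⟩, hV⟩ := hX.generic.prod.cont hf U hU hne
    exact (hUD (hVU hz)).2 (hV z hz)
  convert! h1.union h2 using 1
  ext z
  by_cases hz : ContinuousAt f z <;> simp [hz]

/-! ### Uniform finiteness -/

theorem ncard_le_ncard_of_matched {S T : Set R} (hT : T.Finite) {ε : R}
    (hsep : ∀ y ∈ S, ∀ y' ∈ S, y ≠ y' → ε ≤ |y - y'|) (h : ∀ y ∈ S, ∃ y' ∈ T, |y' - y| < ε / 2) :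
    S.ncard ≤ T.ncard := by
  choose! m hm hm' using h
  refine Set.ncard_le_ncard_of_injOn m hm (fun y hy y' hy' e => ?_) hT
  by_contra hne
  have h1 := hsep y hy y' hy' hne
  have h2 := hm' y hy
  have h3 := hm' y' hy'
  rw [← e] at h3
  rw [abs_sub_comm] at h2
  have h4 := abs_sub_le y (m y) y'
  linarith

theorem Set.Finite.exists_separation {S : Set R} (hS : S.Finite) :
    ∃ ε > 0, ∀ y ∈ S, ∀ y' ∈ S, y ≠ y' → ε ≤ |y - y'| := by
  have := hS.to_subtype
  obtain ⟨ε, hε, h⟩ := exists_pos_le_of_finite (ι := {p : S × S // p.1.1 ≠ p.2.1})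
    (δ := fun p => |(p.1.1.1 - p.1.2.1 : R)|) fun p => abs_pos.2 (sub_ne_zero.2 p.2)
  exact ⟨ε, hε, fun y hy y' hy' hne => h ⟨(⟨y, hy⟩, ⟨y', hy'⟩), hne⟩⟩

/-- The fibres of `P` over points close to `x` are uniformly separated and matched with the fibre
over `x`. -/
def FibersMatchNear (P : X → R → Prop) (x : X) : Prop :=
  ∃ ε : R, 0 < ε ∧ ∃ δ : R, 0 < δ ∧ ∀ x', Near x x' δ →
    (∀ y y', P x' y → P x' y' → y ≠ y' → ε ≤ |y - y'|) ∧
    (∀ y, P x y → ∃ y', P x' y' ∧ |y' - y| < ε / 2) ∧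
    (∀ y', P x' y' → ∃ y, P x y ∧ |y - y'| < ε / 2)

theorem FibersMatchNear.eventually_ncard {P : X → R → Prop} (hfin : ∀ x, {t | P x t}.Finite)
    {x : X} (h : FibersMatchNear P x) : ∀ᶠ x' in 𝓝 x, {t | P x' t}.ncard = {t | P x t}.ncard := by
  obtain ⟨ε, hε, δ, hδ, h⟩ := h
  have h0 := h x (near_self x hδ)
  filter_upwards [near_mem_nhds x hδ] with x' hx'
  obtain ⟨h1, h2, h3⟩ := h x' hx'
  exact le_antisymm
    (ncard_le_ncard_of_matched (hfin x) (fun y hy y' hy' => h1 y y' hy hy') fun y hy => h3 y hy)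
    (ncard_le_ncard_of_matched (hfin x') (fun y hy y' hy' => h0.1 y y' hy hy') fun y hy => h2 y hy)

/-- Shrinking makes the fibres uniformly `ε₀`-separated. If all fibres over an open set had a point
without matches over arbitrarily near `x'`, a definable choice `g` of such points would be
continuous somewhere, and `g x'` would be a match for `g x`. Otherwise the matching radius can be
chosen definably and bounded below; uniformity is needed because the reverse matching uses the
radius at `x'`. -/
theorem IsGeneric.exists_fibersMatchNear (hX : IsGeneric L R X) {P : X → R → Prop}
    (hP : DPred L R (fun z : X × R => P z.1 z.2)) (hfin : ∀ x, {t | P x t}.Finite) {U : Set X}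
    (hU : IsOpen U) (hne : U.Nonempty) : ∃ x ∈ U, FibersMatchNear P x := by
  obtain ⟨ε, hε, hε'⟩ := exists_dFun_choice (L := L) (X := X)
    (P := fun x ε => 0 < ε ∧ ∀ y y', P x y → P x y' → y ≠ y' → ε ≤ |y - y'|) (by fun_prop)
  have hsep := fun x => hε' x (by
    obtain ⟨ε, h1, h2⟩ := (hfin x).exists_separation
    exact ⟨ε, h1, fun y y' hy hy' => h2 y hy y' hy'⟩)
  obtain ⟨V, hVU, hV, hVne, ε₀, hε₀, hle⟩ := hX.pos hε U hU hne fun x _ => (hsep x).1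
  obtain ⟨V₁, hV₁V, hV₁, hV₁ne, h⟩ := hX.split
    (P := fun x => ∃ y, P x y ∧ ∀ δ : R, δ > 0 →
      ∃ x', Near x x' δ ∧ ¬ ∃ y', P x' y' ∧ |y' - y| < ε₀ / 2)
    (Q := fun x => ¬ ∃ y, P x y ∧ ∀ δ : R, δ > 0 →
      ∃ x', Near x x' δ ∧ ¬ ∃ y', P x' y' ∧ |y' - y| < ε₀ / 2)
    (by fun_prop) (by fun_prop) V hV hVne fun x _ => em _
  rcases h with h | h
  · obtain ⟨g, hg, hg'⟩ := exists_dFun_choice (L := L) (X := X)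
      (P := fun x y => P x y ∧ ∀ δ : R, δ > 0 →
        ∃ x', Near x x' δ ∧ ¬ ∃ y', P x' y' ∧ |y' - y| < ε₀ / 2) (by fun_prop)
    have H := fun x hx => hg' x (h x hx)
    obtain ⟨V₂, hV₂V, hV₂, ⟨x, hx⟩, hc⟩ := hX.cont hg V₁ hV₁ hV₁ne
    obtain ⟨δ, hδ, h1⟩ := (continuousAt_iff_near (R := R)).1 (hc x hx) (ε₀ / 2) (half_pos hε₀)
    obtain ⟨δ', hδ', h2⟩ := (mem_nhds_iff_near (R := R)).1 (hV₂.mem_nhds hx)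
    obtain ⟨x', hx', hn⟩ := (H x (hV₂V hx)).2 (min δ δ') (lt_min hδ hδ')
    have hx'V := h2 x' (hx'.mono (min_le_right _ _))
    exact (hn ⟨g x', (H x' (hV₂V hx'V)).1,
      near_line.1 (h1 x' (hx'.mono (min_le_left _ _)))⟩).elim
  · push Not at h
    obtain ⟨δ, hδ, hδ'⟩ := exists_dFun_choice (L := L) (X := X)
      (P := fun x (δ : R) => 0 < δ ∧ ∀ y, P x y → ∀ x', Near x x' δ → ∃ y', P x' y' ∧ |y' - y| < ε₀ / 2)
      (by fun_prop)
    have H := fun x (hx : x ∈ V₁) => hδ' x (by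
      have := (hfin x).to_subtype
      choose! d hd hd' using h x hx
      obtain ⟨δ, h1, h2⟩ := exists_pos_le_of_finite (ι := {t | P x t}) (δ := fun y => d y.1)
        fun y => hd y.1 y.2
      exact ⟨δ, h1, fun y hy x' hx' => hd' y hy x' (hx'.mono (h2 ⟨y, hy⟩))⟩)
    obtain ⟨V₂, hV₂V, hV₂, ⟨x, hx⟩, δ₀, hδ₀, hle'⟩ := hX.pos hδ V₁ hV₁ hV₁ne fun x hx => (H x hx).1
    obtain ⟨δ₁, hδ₁, h1⟩ := (mem_nhds_iff_near (R := R)).1 (hV₂.mem_nhds hx)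
    refine ⟨x, hVU (hV₁V (hV₂V hx)), ε₀, hε₀, min δ₀ δ₁, lt_min hδ₀ hδ₁, fun x' hx' => ?_⟩
    have hx'V := h1 x' (hx'.mono (min_le_right _ _))
    refine ⟨fun y y' hy hy' hne => ?_, fun y hy => ?_, fun y hy => ?_⟩
    · exact (hle x' (hV₁V (hV₂V hx'V))).trans ((hsep x').2 y y' hy hy' hne)
    · exact (H x (hV₂V hx)).2 y hy x' (hx'.mono ((min_le_left _ _).trans (hle' x hx)))
    · exact (H x' (hV₂V hx'V)).2 y hy x
        (near_comm.1 (hx'.mono ((min_le_left _ _).trans (hle' x' hx'V))))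

/-- Where fibres match, their cardinality is locally constant, hence constant on each of finitely
many connected pieces. The remaining points form a set without interior, which reduces to `Y`. -/
theorem HasUniformFiniteness.of_thin (hg : IsGeneric L R X) (hp : HasPieces L R X)
    (hY : HasUniformFiniteness L R Y)
    (hthin : ∀ Z : Set X, DPred L R (· ∈ Z) → interior Z = ∅ →
      FinUnion (fun Z' => DPred L R (· ∈ Z') ∧ EmbedsIn L R Z' Y) Z) :
    HasUniformFiniteness L R X := by
  intro P hP hfin
  have hG : DPred L R fun x => FibersMatchNear P x := by
    unfold FibersMatchNear
    fun_prop
  obtain ⟨N₁, hN₁⟩ := (hp {x | FibersMatchNear P x} hG (fun _ => 0) (by fun_prop)).exists_bound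
    (b := fun N x => {t | P x t}.ncard ≤ N) (fun m n x h h' => h'.trans h) (by
      rintro C hCG ⟨hC, hconn, -⟩
      rcases C.eq_empty_or_nonempty with rfl | ⟨x₀, hx₀⟩
      · exact ⟨0, by simp⟩
      refine ⟨{t | P x₀ t}.ncard, fun x hx => le_of_eq ?_⟩
      refine hconn {x | {t | P x t}.ncard = {t | P x₀ t}.ncard} (DPred.ncard_eq _ hP hfin)
        (fun x hx h => ?_) (fun x hx h => ?_) x₀ hx₀ x hx rfl
      · refine mem_nhdsWithin_of_mem_nhds ?_
        filter_upwards [(hCG hx).eventually_ncard hfin] with x' hx'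
        exact hx'.trans h
      · refine mem_nhdsWithin_of_mem_nhds ?_
        filter_upwards [(hCG hx).eventually_ncard hfin] with x' hx' h'
        exact h (hx'.symm.trans h'))
  obtain ⟨N₂, hN₂⟩ := (hthin {x | ¬ FibersMatchNear P x} hG.not (by
      refine interior_eq_empty_of_forall fun U hU hne hUG => ?_
      obtain ⟨x, hx, h⟩ := hg.exists_fibersMatchNear hP hfin hU hne
      exact hUG hx h)).exists_bound
    (b := fun N x => {t | P x t}.ncard ≤ N) (fun m n x h h' => h'.trans h)
    fun Z' _ hZ' => hY.of_embedsIn hZ'.2 hP hfin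
  refine ⟨max N₁ N₂, fun x => ?_⟩
  by_cases h : FibersMatchNear P x
  · exact (hN₁ x h).trans (le_max_left _ _)
  · exact (hN₂ x h).trans (le_max_right _ _)

/-! ### Tameness of affine spaces -/

theorem IsTame.prod (hX : IsTame L R X) : IsTame L R (X × R) where
  generic := hX.generic.prod
  pieces := hX.prod_pieces
  uniform := .of_thin hX.generic.prod hX.prod_pieces hX.uniform fun _ => hX.thin_embeds
  thin _ hZ hempty := (hX.thin_embeds hZ hempty).bind fun _ _ h => .single ⟨h.1, h.2.prod⟩

theorem isTame_punit : IsTame L R PUnit where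
  generic := isGeneric_punit
  pieces D hD f _ := .single ⟨hD, fun _ _ _ _ _ _ _ _ h => h,
    continuous_of_discreteTopology.continuousOn⟩
  uniform P _ _ := ⟨{t | P ⟨⟩ t}.ncard, fun _ => le_rfl⟩
  thin D hD hempty := ⟨∅, Set.finite_empty, by simp, by
    have : interior D = D := (isOpen_discrete D).interior_eq
    rw [Set.sUnion_empty, ← this, hempty]⟩

/-- The inductive step concerns `X × R`, so tameness is proved for an iterated product and carried
over to `Fin n → R` by a definable homeomorphism. -/
theorem exists_isTame_embedsIn (n : ℕ) : ∃ (X : Type w) (_ : TopologicalSpace X)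
    (_ : Coords R X), IsTame L R X ∧ EmbedsIn L R (univ : Set (Fin n → R)) X := by
  induction n with
  | zero =>
    refine ⟨PUnit, inferInstance, inferInstance, isTame_punit, fun _ => ⟨⟩, fun _ => 0,
      by fun_prop, by fun_prop, continuousOn_const, continuousOn_const, fun x _ => ?_⟩
    exact Subsingleton.elim _ _
  | succ n ih =>
    obtain ⟨X, _, _, hX, φ, ψ, h1, h2, h3, h4, h5⟩ := ih
    have hc : Continuous fun c : Fin (n + 1) → R => fun i : Fin n => c i.castSucc := by fun_prop
    refine ⟨X × R, inferInstance, inferInstance, hX.prod,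
      fun c => (φ fun i => c i.castSucc, c (Fin.last n)),
      fun z => Fin.snoc (ψ z.1) z.2, by fun_prop, ?_, ?_, ?_, ?_⟩
    · refine DFun.pi fun i => ?_
      refine Fin.lastCases ?_ (fun i => ?_) i
      · simpa using DFun.snd .id
      · simp only [Fin.snoc_castSucc]
        fun_prop
    · exact (h3.comp hc.continuousOn fun _ _ => trivial).prodMk (continuous_apply _).continuousOn
    · refine continuousOn_pi.2 fun i => ?_
      refine Fin.lastCases ?_ (fun i => ?_) i
      · simpa using continuousOn_snd
      · simp only [Fin.snoc_castSucc]
        refine (continuous_apply i).comp_continuousOn (h4.comp continuousOn_fst ?_)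
        rintro _ ⟨c, -, rfl⟩
        exact ⟨_, trivial, rfl⟩
    · intro c _
      dsimp only
      rw [h5 _ trivial]
      exact Fin.snoc_init_self c

theorem exists_embedsIn_fin {κ : Type} [Finite κ] :
    ∃ n, EmbedsIn L R (univ : Set (κ → R)) (Fin n → R) := by
  obtain ⟨n, ⟨e⟩⟩ := Finite.exists_equiv_fin κ
  refine ⟨n, fun c i => c (e.symm i), fun c i => c (e i), by fun_prop, by fun_prop, by fun_prop,
    by fun_prop, fun c _ => ?_⟩
  simp

theorem hasPieces_pi (κ : Type) [Finite κ] : HasPieces L R (κ → R) := by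
  intro D hD f hf
  obtain ⟨n, hn⟩ := exists_embedsIn_fin (L := L) (R := R) (κ := κ)
  refine HasPieces.of_embedsIn (Y := Fin n → R) ?_ hD (hn.mono (Set.subset_univ _)) hf
  intro D hD f hf
  obtain ⟨X, _, _, hX, hX'⟩ := exists_isTame_embedsIn (L := L) (R := R) n
  exact hX.pieces.of_embedsIn hD (hX'.mono (Set.subset_univ _)) hf

theorem hasUniformFiniteness_pi (κ : Type) [Finite κ] : HasUniformFiniteness L R (κ → R) := by
  have h1 : ∀ n, HasUniformFiniteness L R (Fin n → R) := by
    intro n P hP hfin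
    obtain ⟨X, _, _, hX, hX'⟩ := exists_isTame_embedsIn (L := L) (R := R) n
    obtain ⟨N, hN⟩ := hX.uniform.of_embedsIn hX' hP hfin
    exact ⟨N, fun x => hN x trivial⟩
  intro P hP hfin
  obtain ⟨n, hn⟩ := exists_embedsIn_fin (L := L) (R := R) (κ := κ)
  obtain ⟨N, hN⟩ := (h1 n).of_embedsIn hn hP hfin
  exact ⟨N, fun x => hN x trivial⟩

end Tame

namespace LocDefSpace

/-! ### Topology and connectedness in locally definable spaces -/

section ChartTopology

variable {L : FirstOrder.Language.{u, v}} {R : Type w} [L.Structure R] [TopologicalSpace R]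
  {M : Type x} (D : LocDefSpace.{u, v, w, x, y} L R M)

theorem isOpen_chart_preimage (i : D.ι) {O : Set (D.coord i → R)} (hO : IsOpen O) :
    IsOpen[D.topology] {m | m ∈ D.dom i ∧ D.chart i m ∈ O} := by
  intro j
  obtain ⟨O₁, hO₁, h₁⟩ := D.open_overlap j i
  obtain ⟨g, hg, hg'⟩ := D.continuous_transition j i
  obtain ⟨O₂, hO₂, h₂⟩ := continuousOn_iff'.1 hg O hO
  refine ⟨O₁ ∩ O₂, hO₁.inter hO₂, fun m hm => ?_⟩
  constructor
  · rintro ⟨hmi, hmO⟩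
    have hmem : D.chart j m ∈ D.chart j '' (D.dom j ∩ D.dom i) := ⟨m, ⟨hm, hmi⟩, rfl⟩
    refine ⟨(h₁.subset hmem).2, (h₂.subset ⟨?_, hmem⟩).1⟩
    rw [Set.mem_preimage, hg' m ⟨hm, hmi⟩]
    exact hmO
  · rintro ⟨h3, h4⟩
    have hmem : D.chart j m ∈ D.chart j '' (D.dom j ∩ D.dom i) := h₁.superset ⟨⟨m, hm, rfl⟩, h3⟩
    obtain ⟨m', hm', e⟩ := hmem
    obtain rfl : m' = m := D.injOn j hm'.1 hm e
    have := (h₂.superset ⟨h4, ⟨m', hm', rfl⟩⟩).1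
    rw [Set.mem_preimage, hg' m' hm'] at this
    exact ⟨hm'.2, this⟩

theorem isOpen_dom (i : D.ι) : IsOpen[D.topology] (D.dom i) := by
  simpa using! D.isOpen_chart_preimage i isOpen_univ

/-- Neighbourhoods of a point, described in a chart. -/
theorem mem_nhds_iff_chart {i : D.ι} {m : M} (hm : m ∈ D.dom i) {S : Set M} :
    S ∈ @nhds M D.topology m ↔
      ∃ O : Set (D.coord i → R), IsOpen O ∧ D.chart i m ∈ O ∧
        ∀ m' ∈ D.dom i, D.chart i m' ∈ O → m' ∈ S := by
  let _ := D.topology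
  rw [mem_nhds_iff]
  constructor
  · rintro ⟨V, hVS, hV, hmV⟩
    obtain ⟨O, hO, h⟩ := hV i
    exact ⟨O, hO, (h m hm).1 hmV, fun m' hm' hO' => hVS ((h m' hm').2 hO')⟩
  · rintro ⟨O, hO, hmO, h⟩
    exact ⟨_, fun m' hm' => h m' hm'.1 hm'.2, D.isOpen_chart_preimage i hO, hm, hmO⟩

theorem isOpen_restrict_iff {Y : Set M} (hY : D.IsAdmissible Y) {S : Set Y} :
    IsOpen[(D.restrict Y hY).topology] S ↔
      ∃ V, IsOpen[D.topology] V ∧ ∀ m : Y, m ∈ S ↔ (m : M) ∈ V := by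
  constructor
  · intro hS
    choose O hO h using hS
    let _ := D.topology
    refine ⟨⋃ i, {m | m ∈ D.dom i ∧ D.chart i m ∈ O i},
      isOpen_iUnion fun i => D.isOpen_chart_preimage i (hO i), fun m => ?_⟩
    rw [Set.mem_iUnion]
    constructor
    · intro hm
      obtain ⟨i, hi⟩ := D.covers m
      exact ⟨i, hi, (h i m hi).1 hm⟩
    · rintro ⟨i, hi, hi'⟩
      exact (h i m hi).2 hi'
  · rintro ⟨V, hV, h⟩ i
    obtain ⟨O, hO, hOV⟩ := hV i
    exact ⟨O, hO, fun m hm => (h m).trans (hOV m hm)⟩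

/-! ### Admissible subspaces -/

variable {D}

theorem mem_chart_image {i : D.ι} {S : Set M} {m : M} (hm : m ∈ D.dom i) :
    D.chart i m ∈ D.chart i '' (D.dom i ∩ S) ↔ m ∈ S := by
  constructor
  · rintro ⟨m', hm', e⟩
    exact D.injOn i hm'.1 hm e ▸ hm'.2
  · exact fun h => ⟨m, ⟨hm, h⟩, rfl⟩

theorem IsAdmissible.union {S T : Set M} (hS : D.IsAdmissible S) (hT : D.IsAdmissible T) :
    D.IsAdmissible (S ∪ T) := fun i => by
  rw [Set.inter_union_distrib_left, Set.image_union]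
  exact (hS i).union (hT i)

theorem isAdmissible_singleton (m : M) : D.IsAdmissible {m} := fun i => by
  by_cases h : m ∈ D.dom i
  · rw [Set.inter_eq_right.2 (by simpa using h), Set.image_singleton]
    have : DPred L R fun c : D.coord i → R => c = D.chart i m := by fun_prop
    exact this
  · rw [Set.inter_singleton_eq_empty.2 h, Set.image_empty]
    exact Set.definable_empty

theorem isAdmissible_univ : D.IsAdmissible Set.univ := fun i => by
  rw [Set.inter_univ]
  exact D.definable_image i

theorem _root_.IsLDMap.preimage_admissible {N : Type*} {D' : LocDefSpace L R N} {f : M → N}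
    (hf : IsLDMap D D' f) {U : Set N} (hU : D'.IsAdmissible U) : D.IsAdmissible (f ⁻¹' U) := by
  intro i
  obtain ⟨J, hJ, -⟩ := hf.image i
  have key : ∀ j, IsDefinable L (D.chart i '' {m | m ∈ D.dom i ∧ f m ∈ D'.dom j ∧ f m ∈ U}) := by
    intro j
    convert! ((hf.graph i j).inter ((hU j).preimage_comp Sum.inr)).image_comp
      (Sum.inl : D.coord i → D.coord i ⊕ D'.coord j) using 1
    ext c
    constructor
    · rintro ⟨m, ⟨h1, h2, h3⟩, rfl⟩
      exact ⟨_, ⟨⟨m, h1, h2, rfl⟩, ⟨f m, ⟨h2, h3⟩, by ext; simp⟩⟩, by ext; simp⟩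
    · rintro ⟨_, ⟨⟨m, h1, h2, rfl⟩, h3⟩, rfl⟩
      have h3' : D'.chart j (f m) ∈ D'.chart j '' (D'.dom j ∩ U) := by simpa using! h3
      exact ⟨m, ⟨h1, h2, (mem_chart_image h2).1 h3'⟩, by ext; simp⟩
  convert! Set.definable_biUnion_finset (L := L) (A := (Set.univ : Set R)) key J using 1
  ext c
  simp only [Set.mem_iUnion, exists_prop]
  constructor
  · rintro ⟨m, ⟨h1, h2⟩, rfl⟩
    obtain ⟨j, hj, hmj⟩ := by simpa using hJ ⟨m, h1, rfl⟩
    exact ⟨j, hj, m, ⟨h1, hmj, h2⟩, rfl⟩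
  · rintro ⟨j, -, m, ⟨h1, -, h2⟩, rfl⟩
    exact ⟨m, ⟨h1, h2⟩, rfl⟩

/-! ### Connectedness -/

theorem IsConn.eq_of_subset {C X U : Set M} (hC : D.IsConn C) (hCX : C ⊆ X)
    (hU : D.IsAdmissible U) (h1 : ∃ O, IsOpen[D.topology] O ∧ X ∩ U = X ∩ O)
    (h2 : ∃ F, IsClosed[D.topology] F ∧ X ∩ U = X ∩ F) : C ∩ U = ∅ ∨ C ⊆ U := by
  have key : ∀ {O : Set M}, X ∩ U = X ∩ O → C ∩ U = C ∩ O := fun {O} h => by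
    rw [← Set.inter_eq_self_of_subset_left hCX, Set.inter_assoc, h, Set.inter_assoc]
  obtain ⟨O, hO, e⟩ := h1
  obtain ⟨F, hF, e'⟩ := h2
  rcases hC.2.2 U hU ⟨O, hO, key e⟩ ⟨F, hF, key e'⟩ with h | h
  · exact Or.inl h
  · exact Or.inr (Set.inter_eq_left.1 h)

/-- Admissibility of the union is a separate hypothesis, because an infinite union of admissible
subspaces need not be admissible. -/
theorem isConn_sUnion {𝒞 : Set (Set M)} {e : M} (hne : 𝒞.Nonempty) (h𝒞 : ∀ C ∈ 𝒞, D.IsConn C)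
    (he : ∀ C ∈ 𝒞, e ∈ C) (hadm : D.IsAdmissible (⋃₀ 𝒞)) : D.IsConn (⋃₀ 𝒞) := by
  obtain ⟨C₀, hC₀⟩ := hne
  refine ⟨hadm, ⟨e, C₀, hC₀, he C₀ hC₀⟩, fun U hU h1 h2 => ?_⟩
  have key := fun C hC => (h𝒞 C hC).eq_of_subset (Set.subset_sUnion_of_mem hC) hU h1 h2
  by_cases heU : e ∈ U
  · refine Or.inr (Set.inter_eq_left.2 (Set.sUnion_subset fun C hC => ?_))
    exact (key C hC).resolve_left fun h => (h.subset ⟨he C hC, heU⟩ : e ∈ (∅ : Set M))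
  · refine Or.inl (Set.eq_empty_of_forall_notMem ?_)
    rintro m ⟨⟨C, hC, hm⟩, hmU⟩
    rcases key C hC with h | h
    · exact (h.subset ⟨hm, hmU⟩ : m ∈ (∅ : Set M))
    · exact heU (h (he C hC))

theorem IsConn.union {C C' : Set M} (hC : D.IsConn C) (hC' : D.IsConn C') {e : M} (he : e ∈ C)
    (he' : e ∈ C') : D.IsConn (C ∪ C') := by
  rw [← Set.sUnion_pair]
  refine isConn_sUnion (e := e) ⟨C, by simp⟩ ?_ ?_ ?_
  · rintro _ (rfl | rfl) <;> assumption
  · rintro _ (rfl | rfl) <;> assumption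
  · rw [Set.sUnion_pair]
    exact hC.1.union hC'.1

theorem IsConn.insert_of_mem_closure {C : Set M} (hC : D.IsConn C) {m : M}
    (hm : ∀ O, IsOpen[D.topology] O → m ∈ O → (O ∩ C).Nonempty) : D.IsConn (C ∪ {m}) := by
  refine ⟨hC.1.union (isAdmissible_singleton m), hC.2.1.mono Set.subset_union_left,
    fun U hU h1 h2 => ?_⟩
  have key := hC.eq_of_subset Set.subset_union_left hU h1 h2
  obtain ⟨O, hO, e⟩ := h1
  obtain ⟨F, hF, e'⟩ := h2
  rcases key with h | h
  · refine Or.inl (Set.eq_empty_of_forall_notMem ?_)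
    rintro a ⟨ha | ha, haU⟩
    · exact (h.subset ⟨ha, haU⟩ : a ∈ (∅ : Set M))
    · obtain rfl : a = m := ha
      obtain ⟨c, hcO, hcC⟩ := hm O hO (e.subset ⟨Or.inr rfl, haU⟩).2
      exact (h.subset ⟨hcC, (e.superset ⟨Or.inl hcC, hcO⟩).2⟩ : c ∈ (∅ : Set M))
  · refine Or.inr (Set.inter_eq_left.2 ?_)
    rintro a (ha | ha)
    · exact h ha
    · obtain rfl : a = m := ha
      have haF : a ∈ F := by
        by_contra haF
        obtain ⟨c, hcF, hcC⟩ := hm Fᶜ hF.1 haF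
        exact hcF (e'.subset ⟨Or.inl hcC, h hcC⟩).2
      exact (e'.superset ⟨Or.inr rfl, haF⟩).2

end ChartTopology

/-! ### Connected components of admissible subspaces -/

section Components

variable {L : FirstOrder.Language.{u, v}} {R : Type w} [L.Structure R] [TopologicalSpace R]
  [Field R] [LinearOrder R] [IsStrictOrderedRing R] [OrderTopology R] [IsOMinimalExpansion L R]
  {M : Type x} {D : LocDefSpace.{u, v, w, x, y} L R M}

/-- This passes from definable connectedness in affine space to connectedness in `M`; it suffices to
test on the chart `i`, where open sets of `M` become relatively open. -/
theorem isConn_of_chart {i : D.ι} {C : Set (D.coord i → R)} (hC : DPred L R (· ∈ C))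
    (hconn : DConn L R C) (hne : C.Nonempty) (hsub : C ⊆ D.chart i '' D.dom i) :
    D.IsConn {m | m ∈ D.dom i ∧ D.chart i m ∈ C} := by
  have hadm : D.IsAdmissible {m | m ∈ D.dom i ∧ D.chart i m ∈ C} := by
    refine IsDefinableSubspace.isAdmissible ⟨{i}, fun m hm => by simpa using hm.1, ?_⟩
    simp only [Finset.mem_singleton, forall_eq]
    refine dPred_iff_isDefinable.1 (hC.congr fun c => ?_)
    constructor
    · rintro ⟨m, hm, rfl⟩
      exact hm.2.2
    · intro hc
      obtain ⟨m, hm, rfl⟩ := hsub hc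
      exact ⟨m, ⟨hm, hm, hc⟩, rfl⟩
  refine ⟨hadm, ?_, fun U hU ⟨O, hO, eO⟩ ⟨F, hF, eF⟩ => ?_⟩
  · obtain ⟨c, hc⟩ := hne
    obtain ⟨m, hm, rfl⟩ := hsub hc
    exact ⟨m, hm, hc⟩
  obtain ⟨O₁, hO₁, h₁⟩ := hO i
  obtain ⟨O₂, hO₂, h₂⟩ := hF.1 i
  have key := hconn (D.chart i '' (D.dom i ∩ U)) (hU i) (by
      rintro c hc hcU
      obtain ⟨m, hm, rfl⟩ := hsub hc
      have hmO := (eO.subset ⟨⟨hm, hc⟩, (mem_chart_image hm).1 hcU⟩).2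
      filter_upwards [self_mem_nhdsWithin,
        mem_nhdsWithin_of_mem_nhds (hO₁.mem_nhds ((h₁ m hm).1 hmO))] with c' hc' hc'O
      obtain ⟨m', hm', rfl⟩ := hsub hc'
      exact (mem_chart_image hm').2 (eO.superset ⟨⟨hm', hc'⟩, (h₁ m' hm').2 hc'O⟩).2) (by
      rintro c hc hcU
      obtain ⟨m, hm, rfl⟩ := hsub hc
      have hmF : m ∈ Fᶜ := fun hmF =>
        hcU ((mem_chart_image hm).2 (eF.superset ⟨⟨hm, hc⟩, hmF⟩).2)
      filter_upwards [self_mem_nhdsWithin,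
        mem_nhdsWithin_of_mem_nhds (hO₂.mem_nhds ((h₂ m hm).1 hmF))] with c' hc' hc'O hcU'
      obtain ⟨m', hm', rfl⟩ := hsub hc'
      exact (h₂ m' hm').2 hc'O (eF.subset ⟨⟨hm', hc'⟩, (mem_chart_image hm').1 hcU'⟩).2)
  by_cases h : ∃ m, (m ∈ D.dom i ∧ D.chart i m ∈ C) ∧ m ∈ U
  · obtain ⟨m, hm, hmU⟩ := h
    refine Or.inr (Set.inter_eq_left.2 fun m' hm' => ?_)
    exact (mem_chart_image hm'.1).1
      (key _ hm.2 _ hm'.2 ((mem_chart_image hm.1).2 hmU))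
  · refine Or.inl (Set.eq_empty_of_forall_notMem fun m hm => h ⟨m, hm⟩)

theorem IsAdmissible.exists_conn_pieces {W : Set M} (hW : D.IsAdmissible W) (i : D.ι) :
    ∃ 𝒬 : Set (Set M), 𝒬.Finite ∧ (∀ C ∈ 𝒬, D.IsConn C) ∧ ⋃₀ 𝒬 = D.dom i ∩ W := by
  obtain ⟨𝒞, h1, h2, h3⟩ := hasPieces_pi (L := L) (R := R) (D.coord i)
    (D.chart i '' (D.dom i ∩ W)) (dPred_iff_isDefinable.2 (hW i)) (fun _ => 0) (by fun_prop)
  have hsub : ∀ C ∈ 𝒞, C ⊆ D.chart i '' (D.dom i ∩ W) := fun C hC =>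
    h3 ▸ Set.subset_sUnion_of_mem hC
  -- Empty pieces are discarded, since the empty subspace does not count as connected.
  refine ⟨(fun C => {m | m ∈ D.dom i ∧ D.chart i m ∈ C}) '' {C ∈ 𝒞 | C.Nonempty},
    (h1.subset fun C hC => hC.1).image _, ?_, ?_⟩
  · rintro _ ⟨C, ⟨hC, hne⟩, rfl⟩
    obtain ⟨h4, h5, -⟩ := h2 C hC
    exact isConn_of_chart h4 h5 hne
      ((hsub C hC).trans (Set.image_mono Set.inter_subset_left))
  · ext m
    constructor
    · rintro ⟨_, ⟨C, ⟨hC, -⟩, rfl⟩, hm, hmC⟩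
      exact ⟨hm, (mem_chart_image hm).1 (hsub C hC hmC)⟩
    · rintro ⟨hm, hmW⟩
      have : D.chart i m ∈ ⋃₀ 𝒞 := by rw [h3]; exact ⟨m, ⟨hm, hmW⟩, rfl⟩
      obtain ⟨C, hC, hmC⟩ := this
      exact ⟨_, ⟨C, ⟨hC, ⟨_, hmC⟩⟩, rfl⟩, hm, hmC⟩

/-- Every point of an admissible subspace lies in a connected component, which is open if the
subspace is. -/
theorem IsAdmissible.exists_component {W : Set M} (hW : D.IsAdmissible W) {e : M} (he : e ∈ W) :
    ∃ V, D.IsConnComponent W V ∧ e ∈ V ∧ (IsOpen[D.topology] W → IsOpen[D.topology] V) := by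
  let 𝒱 : Set (Set M) := {C | D.IsConn C ∧ C ⊆ W ∧ e ∈ C}
  have habs : ∀ C, D.IsConn C → C ⊆ W → ∀ m ∈ C, m ∈ ⋃₀ 𝒱 → C ⊆ ⋃₀ 𝒱 := by
    rintro C hC hCW m hm ⟨C', ⟨h1, h2, h3⟩, hm'⟩
    exact Set.subset_union_left.trans (Set.subset_sUnion_of_mem
      ⟨hC.union h1 hm hm', Set.union_subset hCW h2, Or.inr h3⟩)
  have hVW : ⋃₀ 𝒱 ⊆ W := Set.sUnion_subset fun C hC => hC.2.1
  -- In each chart the union of all connected subsets through `e` is made up of those of the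
  -- finitely many connected pieces that meet it, so it is definable.
  have hadm : D.IsAdmissible (⋃₀ 𝒱) := by
    intro i
    obtain ⟨𝒬, h1, h2, h3⟩ := hW.exists_conn_pieces i
    have hfin : ({C ∈ 𝒬 | (C ∩ ⋃₀ 𝒱).Nonempty}).Finite := h1.subset fun C hC => hC.1
    have e1 : D.dom i ∩ ⋃₀ 𝒱 = ⋃ C : {C ∈ 𝒬 | (C ∩ ⋃₀ 𝒱).Nonempty}, D.dom i ∩ C.1 := by
      ext m
      simp only [Set.mem_iUnion]
      constructor
      · rintro ⟨hm, hmV⟩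
        have : m ∈ ⋃₀ 𝒬 := h3 ▸ ⟨hm, hVW hmV⟩
        obtain ⟨C, hC, hmC⟩ := this
        exact ⟨⟨C, hC, m, hmC, hmV⟩, hm, hmC⟩
      · rintro ⟨⟨C, hC, m', hm'C, hm'V⟩, hm, hmC⟩
        exact ⟨hm, habs C (h2 C hC) (((h3 ▸ Set.subset_sUnion_of_mem hC : C ⊆ D.dom i ∩ W)).trans
          Set.inter_subset_right) m' hm'C hm'V hmC⟩
    have := hfin.to_subtype
    rw [e1, Set.image_iUnion]
    exact Set.definable_iUnion_of_finite fun C => (h2 C.1 C.2.1).1 i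
  have heV : {e} ∈ 𝒱 := by
    refine ⟨⟨isAdmissible_singleton e, Set.singleton_nonempty e, fun U _ _ _ => ?_⟩, by simpa, rfl⟩
    by_cases h : e ∈ U
    · exact Or.inr (by simpa using h)
    · exact Or.inl (by simpa using h)
  have hconn : D.IsConn (⋃₀ 𝒱) :=
    isConn_sUnion ⟨_, heV⟩ (fun C hC => hC.1) (fun C hC => hC.2.2) hadm
  refine ⟨⋃₀ 𝒱, ⟨hconn, hVW, fun V' h1 h2 h3 => ?_⟩, ⟨_, heV, rfl⟩, fun hWo => ?_⟩
  · exact (Set.subset_sUnion_of_mem (show V' ∈ 𝒱 from ⟨h1, h2, h3 ⟨_, heV, rfl⟩⟩)).antisymm h3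
  · let _ := D.topology
    rw [isOpen_iff_mem_nhds]
    intro m hm
    obtain ⟨i, hi⟩ := D.covers m
    obtain ⟨𝒬, h1, h2, h3⟩ := hW.exists_conn_pieces i
    have hPW : ∀ C ∈ 𝒬, C ⊆ W := fun C hC =>
      ((h3 ▸ Set.subset_sUnion_of_mem hC : C ⊆ D.dom i ∩ W)).trans Set.inter_subset_right
    -- A piece that accumulates at `m` stays connected when `m` is added, so it belongs to the
    -- component; any other piece is avoided by a neighbourhood of `m`.
    have hev : ∀ᶠ m' in 𝓝 m, ∀ C ∈ 𝒬, m' ∈ C → m' ∈ ⋃₀ 𝒱 := by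
      refine (Set.Finite.eventually_all h1).2 fun C hC => ?_
      by_cases hmC : ∀ O, IsOpen O → m ∈ O → (O ∩ C).Nonempty
      · have := habs _ ((h2 C hC).insert_of_mem_closure hmC)
          (Set.union_subset (hPW C hC) (by simpa using hVW hm)) m (Or.inr rfl) hm
        exact Filter.Eventually.of_forall fun m' hm' => this (Or.inl hm')
      · push Not at hmC
        obtain ⟨O, hO, hmO, hd⟩ := hmC
        filter_upwards [hO.mem_nhds hmO] with m' hm' hm'C
        exact absurd hd (Set.Nonempty.ne_empty ⟨m', hm', hm'C⟩)
    filter_upwards [hev, (D.isOpen_dom i).mem_nhds hi, hWo.mem_nhds (hVW hm)] with m' h4 h5 h6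
    have : m' ∈ ⋃₀ 𝒬 := h3 ▸ ⟨h5, h6⟩
    obtain ⟨C, hC, hmC⟩ := this
    exact h4 C hC hmC

theorem IsConnComponent.eq_of_mem {W V V' : Set M} (h : D.IsConnComponent W V)
    (h' : D.IsConnComponent W V') {m : M} (hm : m ∈ V) (hm' : m ∈ V') : V = V' := by
  have hu := h.1.union h'.1 hm hm'
  have hs := Set.union_subset h.2.1 h'.2.1
  rw [← h.2.2 _ hu hs Set.subset_union_left, h'.2.2 _ hu hs Set.subset_union_right]

/-- Finitely many charts meet only finitely many connected components. -/
theorem IsAdmissible.finite_components {W : Set M} (hW : D.IsAdmissible W) (J : Finset D.ι) :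
    {V | D.IsConnComponent W V ∧ ∃ j ∈ J, (D.dom j ∩ V).Nonempty}.Finite := by
  have key : ∀ j, {V | D.IsConnComponent W V ∧ (D.dom j ∩ V).Nonempty}.Finite := by
    intro j
    obtain ⟨𝒬, h1, h2, h3⟩ := hW.exists_conn_pieces j
    have hPW : ∀ C ∈ 𝒬, C ⊆ W := fun C hC =>
      ((h3 ▸ Set.subset_sUnion_of_mem hC : C ⊆ D.dom j ∩ W)).trans Set.inter_subset_right
    choose! F hF hF' using fun C (hC : C ∈ 𝒬) => hW.exists_component
      (hPW C hC (h2 C hC).2.1.some_mem)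
    refine (h1.image F).subset ?_
    rintro V ⟨hV, m, hmj, hmV⟩
    have : m ∈ ⋃₀ 𝒬 := h3 ▸ ⟨hmj, hV.2.1 hmV⟩
    obtain ⟨C, hC, hmC⟩ := this
    refine ⟨C, hC, ?_⟩
    have hCF : C ⊆ F C := by
      have := (hF C hC).2.2 _ ((hF C hC).1.union (h2 C hC) (hF' C hC).1 (h2 C hC).2.1.some_mem)
        (Set.union_subset (hF C hC).2.1 (hPW C hC)) Set.subset_union_left
      rw [← this]
      exact Set.subset_union_right
    exact (hF C hC).eq_of_mem hV (hCF hmC) hmV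
  refine (J.finite_toSet.biUnion fun j _ => key j).subset ?_
  rintro V ⟨hV, j, hj, hne⟩
  exact Set.mem_biUnion hj ⟨hV, hne⟩

end Components

end LocDefSpace

/-! ### Definable and continuous maps into locally definable spaces -/

namespace LocDefSpace

universe x' y' x₁ x₂

variable {L : FirstOrder.Language.{u, v}} {R : Type w} [L.Structure R] [TopologicalSpace R]

section DefMapOn

variable {M : Type x} {D : LocDefSpace.{u, v, w, x, y} L R M}
  {N : Type x'} {D' : LocDefSpace.{u, v, w, x', y'} L R N}
  {T : Type x₁} [TopologicalSpace T] [Coords R T] {T' : Type x₂} [TopologicalSpace T'] [Coords R T']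

variable (D) in
/-- On the set `S`, the map `g` takes values in finitely many charts and is definable there. -/
structure DefMapOn (S : Set T) (g : T → M) : Prop where
  charts : ∃ J : Finset D.ι, ∀ z ∈ S, ∃ j ∈ J, g z ∈ D.dom j
  graph : ∀ j, DPred L R fun w : T × (D.coord j → R) =>
    w.1 ∈ S ∧ g w.1 ∈ D.dom j ∧ D.chart j (g w.1) = w.2

namespace DefMapOn

variable {S S' : Set T} {g g' : T → M}

theorem of_charts (h : ∃ J : Finset D.ι, ∀ z ∈ S, ∃ j ∈ J, g z ∈ D.dom j)
    {Q : ∀ j, T × (D.coord j → R) → Prop} (hQ : ∀ j, DPred L R (Q j))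
    (hiff : ∀ j z c, Q j (z, c) ↔ z ∈ S ∧ g z ∈ D.dom j ∧ D.chart j (g z) = c) :
    D.DefMapOn S g :=
  ⟨h, fun j => (hQ j).congr fun z => (hiff j z.1 z.2).symm⟩

theorem preimage (hg : D.DefMapOn S g) {W : Set M} (hW : D.IsAdmissible W) :
    DPred L R fun z => z ∈ S ∧ g z ∈ W := by
  obtain ⟨J, hJ⟩ := hg.charts
  have h : DPred L R fun z => ∃ j : J, ∃ c : D.coord j → R,
      (z ∈ S ∧ g z ∈ D.dom j ∧ D.chart j (g z) = c) ∧ c ∈ D.chart j '' (D.dom j ∩ W) := by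
    refine .exists_finite fun j => .ex (.and (hg.graph j) ?_)
    exact DPred.preimage_snd (dPred_iff_isDefinable.2 (hW j))
  refine h.congr fun z => ?_
  constructor
  · rintro ⟨hz, hzW⟩
    obtain ⟨j, hj, hzj⟩ := hJ z hz
    exact ⟨⟨j, hj⟩, _, ⟨hz, hzj, rfl⟩, ⟨_, ⟨hzj, hzW⟩, rfl⟩⟩
  · rintro ⟨j, c, ⟨hz, hzj, rfl⟩, hc⟩
    exact ⟨hz, (mem_chart_image hzj).1 hc⟩

theorem dPred (hg : D.DefMapOn S g) : DPred L R (· ∈ S) :=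
  (hg.preimage isAdmissible_univ).congr fun z => by simp

theorem eqOn (hg : D.DefMapOn S g) (hg' : D.DefMapOn S g') :
    DPred L R fun z => z ∈ S ∧ g z = g' z := by
  obtain ⟨J, hJ⟩ := hg.charts
  have h : DPred L R fun z => ∃ j : J, ∃ c : D.coord j → R,
      (z ∈ S ∧ g z ∈ D.dom j ∧ D.chart j (g z) = c) ∧
      (z ∈ S ∧ g' z ∈ D.dom j ∧ D.chart j (g' z) = c) :=
    .exists_finite fun j => .ex (.and (hg.graph j) (hg'.graph j))
  refine h.congr fun z => ?_
  constructor
  · rintro ⟨hz, e⟩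
    obtain ⟨j, hj, hzj⟩ := hJ z hz
    exact ⟨⟨j, hj⟩, _, ⟨hz, hzj, rfl⟩, hz, e ▸ hzj, e ▸ rfl⟩
  · rintro ⟨j, c, ⟨hz, hzj, rfl⟩, -, hzj', e⟩
    exact ⟨hz, D.injOn j hzj hzj' e.symm⟩

theorem mono (hg : D.DefMapOn S g) (hS' : DPred L R (· ∈ S')) (h : S' ⊆ S) :
    D.DefMapOn S' g := by
  obtain ⟨J, hJ⟩ := hg.charts
  refine of_charts ⟨J, fun z hz => hJ z (h hz)⟩
    (fun j => (DPred.preimage_fst (Y := D.coord j → R) hS').and (hg.graph j)) fun j z c => ?_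
  exact ⟨fun h' => ⟨h'.1, h'.2.2⟩, fun h' => ⟨h'.1, h h'.1, h'.2⟩⟩

theorem congr (hg : D.DefMapOn S g) (h : ∀ z ∈ S, g' z = g z) : D.DefMapOn S g' := by
  obtain ⟨J, hJ⟩ := hg.charts
  refine of_charts ⟨J, fun z hz => (h z hz).symm ▸ hJ z hz⟩ hg.graph fun j z c => ?_
  constructor
  · rintro ⟨hz, h'⟩
    exact ⟨hz, (h z hz).symm ▸ h'⟩
  · rintro ⟨hz, h'⟩
    exact ⟨hz, h z hz ▸ h'⟩

theorem union (hg : D.DefMapOn S g) (hg' : D.DefMapOn S' g) : D.DefMapOn (S ∪ S') g := by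
  classical
  obtain ⟨J, hJ⟩ := hg.charts
  obtain ⟨J', hJ'⟩ := hg'.charts
  refine of_charts ⟨J ∪ J', ?_⟩ (fun j => (hg.graph j).or (hg'.graph j)) fun j z c => ?_
  · rintro z (hz | hz)
    · obtain ⟨j, hj, h⟩ := hJ z hz
      exact ⟨j, Finset.mem_union_left _ hj, h⟩
    · obtain ⟨j, hj, h⟩ := hJ' z hz
      exact ⟨j, Finset.mem_union_right _ hj, h⟩
  · simp only [Set.mem_union, or_and_right]

theorem comp (hg : D.DefMapOn S g) {φ : T' → T} (hφ : DFun L R φ) {S' : Set T'}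
    (hS' : DPred L R (· ∈ S')) (h : ∀ z ∈ S', φ z ∈ S) : D.DefMapOn S' fun z => g (φ z) := by
  obtain ⟨J, hJ⟩ := hg.charts
  refine of_charts ⟨J, fun z hz => hJ _ (h z hz)⟩
    (fun j => (DPred.preimage_fst (Y := D.coord j → R) hS').and
      ((hg.graph j).comp (f := fun w : T' × (D.coord j → R) => (φ w.1, w.2)) (by fun_prop)))
    fun j z c => ?_
  exact ⟨fun h' => ⟨h'.1, h'.2.2⟩, fun h' => ⟨h'.1, h _ h'.1, h'.2⟩⟩

end DefMapOn

theorem DefMapOn.empty (g : T → M) : D.DefMapOn ∅ g :=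
  .of_charts ⟨∅, by simp⟩ (fun _ => DPred.const False) (by simp)

/-- Continuity at a point along a set, of a map to a locally definable space. -/
def ContAt (D : LocDefSpace.{u, v, w, x, y} L R M) (g : T → M) (S : Set T) (z : T) : Prop :=
  ∀ O, IsOpen[D.topology] O → g z ∈ O → ∀ᶠ z' in 𝓝[S] z, g z' ∈ O

namespace ContAt

variable {S S' : Set T} {g g' : T → M} {z : T}

theorem mono (h : D.ContAt g S z) (hS : S' ⊆ S) : D.ContAt g S' z :=
  fun O hO hz => (h O hO hz).filter_mono (nhdsWithin_mono z hS)

theorem union (h : D.ContAt g S z) (h' : D.ContAt g S' z) : D.ContAt g (S ∪ S') z :=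
  fun O hO hz => by
    rw [nhdsWithin_union, Filter.eventually_sup]
    exact ⟨h O hO hz, h' O hO hz⟩

/-- The condition is vacuous away from the closure of `S`. With `union`, this allows continuity on a
union of closed strips to be checked one strip at a time. -/
theorem of_notMem {C : Set T} (hC : IsClosed C) (hS : S ⊆ C) (hz : z ∉ C) : D.ContAt g S z :=
  fun O _ _ => by
    filter_upwards [self_mem_nhdsWithin,
      mem_nhdsWithin_of_mem_nhds (hC.isOpen_compl.mem_nhds hz)] with z' h1 h2
    exact (h2 (hS h1)).elim

theorem congr (h : D.ContAt g S z) (hz : z ∈ S) (hg : ∀ z ∈ S, g' z = g z) : D.ContAt g' S z :=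
  fun O hO hzO => by
    filter_upwards [h O hO (hg z hz ▸ hzO), self_mem_nhdsWithin] with z' h1 h2
    rw [hg z' h2]
    exact h1

theorem comp {φ : T' → T} {S' : Set T'} {z : T'} (h : D.ContAt g S (φ z))
    (hφ : ContinuousWithinAt φ S' z) (hm : ∀ z ∈ S', φ z ∈ S) :
    D.ContAt (fun z => g (φ z)) S' z := fun O hO hz =>
  (tendsto_nhdsWithin_iff.2 ⟨hφ, by
    filter_upwards [self_mem_nhdsWithin] with z' hz' using hm z' hz'⟩).eventually (h O hO hz)

end ContAt

theorem _root_.IsLDMap.isOpen_preimage {f : M → N} (hf : IsLDMap D D' f) {O : Set N}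
    (hO : IsOpen[D'.topology] O) : IsOpen[D.topology] (f ⁻¹' O) :=
  (@continuous_def _ _ D.topology D'.topology f).1 hf.continuous O hO

section OneChart

variable {i₀ : D.ι}

/-- An ld-map on a space with a single chart, as a definable map of the coordinates. -/
theorem _root_.IsLDMap.defMapOn (i₀ : D.ι) (hdom : ∀ m, m ∈ D.dom i₀) {f : M → N}
    (hf : IsLDMap D D' f) {G : (D.coord i₀ → R) → N} (hG : ∀ m, G (D.chart i₀ m) = f m) :
    D'.DefMapOn (Set.range (D.chart i₀)) G := by
  obtain ⟨J, hJ, -⟩ := hf.image i₀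
  refine .of_charts ⟨J, ?_⟩ (Q := fun j z => Sum.elim z.1 z.2 ∈
    {c : D.coord i₀ ⊕ D'.coord j → R | ∃ m ∈ D.dom i₀, f m ∈ D'.dom j ∧
      c = Sum.elim (D.chart i₀ m) (D'.chart j (f m))}) (fun j => ?_) fun j z c => ?_
  · rintro _ ⟨m, rfl⟩
    obtain ⟨j, hj, hmj⟩ := by simpa using hJ ⟨m, hdom m, rfl⟩
    exact ⟨j, hj, (hG m).symm ▸ hmj⟩
  · refine DPred.comp (dPred_iff_isDefinable.2 (hf.graph i₀ j))
      (f := fun z : (D.coord i₀ → R) × (D'.coord j → R) => Sum.elim z.1 z.2) (.pi ?_)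
    rintro (k | k)
    · exact .comp (g := fun c : D.coord i₀ → R => c k) (by fun_prop) (by fun_prop)
    · exact .comp (g := fun c : D'.coord j → R => c k) (by fun_prop) (by fun_prop)
  · constructor
    · rintro ⟨m, hm, h1, h2⟩
      obtain ⟨rfl, rfl⟩ : z = D.chart i₀ m ∧ c = D'.chart j (f m) :=
        ⟨by simpa using congrArg (· ∘ Sum.inl) h2, by simpa using congrArg (· ∘ Sum.inr) h2⟩
      exact ⟨⟨m, rfl⟩, (hG m).symm ▸ h1, by rw [hG]⟩
    · rintro ⟨⟨m, rfl⟩, h1, rfl⟩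
      rw [hG] at h1 ⊢
      exact ⟨m, hdom m, h1, rfl⟩

theorem _root_.IsLDMap.contAt (i₀ : D.ι) (hdom : ∀ m, m ∈ D.dom i₀) {f : M → N}
    (hf : IsLDMap D D' f) {G : (D.coord i₀ → R) → N} (hG : ∀ m, G (D.chart i₀ m) = f m) (m : M) :
    D'.ContAt G (Set.range (D.chart i₀)) (D.chart i₀ m) := by
  intro O hO hm
  obtain ⟨O', hO', h⟩ := hf.isOpen_preimage hO i₀
  rw [hG] at hm
  filter_upwards [self_mem_nhdsWithin, mem_nhdsWithin_of_mem_nhds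
    (hO'.mem_nhds ((h m (hdom m)).1 hm))] with z hz hzO'
  obtain ⟨m', rfl⟩ := hz
  rw [hG]
  exact (h m' (hdom m')).2 hzO'

/-- Converse to `IsLDMap.defMapOn` and `IsLDMap.contAt`; a lift constructed in coordinates is turned
back into an ld-map by it. -/
theorem DefMapOn.isLDMap (i₀ : D.ι) (hι : ∀ i, i = i₀) (hdom : ∀ m, m ∈ D.dom i₀) {f : M → N}
    {G : (D.coord i₀ → R) → N} (hG : ∀ m, G (D.chart i₀ m) = f m)
    (hd : D'.DefMapOn (Set.range (D.chart i₀)) G)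
    (hc : ∀ m, D'.ContAt G (Set.range (D.chart i₀)) (D.chart i₀ m)) : IsLDMap D D' f := by
  have hgr : ∀ j, IsDefinable L {c : D.coord i₀ ⊕ D'.coord j → R |
      ∃ m ∈ D.dom i₀, f m ∈ D'.dom j ∧ c = Sum.elim (D.chart i₀ m) (D'.chart j (f m))} := by
    intro j
    have h := (hd.graph j).comp (f := fun c : D.coord i₀ ⊕ D'.coord j → R =>
      (c ∘ Sum.inl, c ∘ Sum.inr))
      (.prodMk (.pi fun k => .apply (Sum.inl k)) (.pi fun k => .apply (Sum.inr k)))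
    refine dPred_iff_isDefinable.1 (h.congr fun c => ?_)
    constructor
    · rintro ⟨m, hm, h1, rfl⟩
      refine ⟨⟨m, by simp⟩, ?_⟩
      simp only [Sum.elim_comp_inl, Sum.elim_comp_inr, hG]
      exact ⟨h1, trivial⟩
    · rintro ⟨⟨m, hm⟩, h1, h2⟩
      change D.chart i₀ m = c ∘ Sum.inl at hm
      change G (c ∘ Sum.inl) ∈ _ at h1
      change D'.chart j (G (c ∘ Sum.inl)) = c ∘ Sum.inr at h2
      rw [← hm, hG] at h1 h2
      refine ⟨m, hdom m, h1, ?_⟩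
      rw [hm, h2, Sum.elim_comp_inl_inr]
  refine ⟨?_, fun i => ?_, fun i => ?_⟩
  · let _ := D.topology
    let _ := D'.topology
    refine continuous_def.2 fun O hO => isOpen_iff_mem_nhds.2 fun m hm => ?_
    have h := hc m O hO ((hG m).symm ▸ hm)
    rw [Filter.Eventually, mem_nhdsWithin] at h
    obtain ⟨O', hO', h1, h2⟩ := h
    refine (D.mem_nhds_iff_chart (hdom m)).2 ⟨O', hO', h1, fun m' _ h' => ?_⟩
    have := h2 ⟨h', m', rfl⟩
    rw [Set.mem_ofPred_eq, hG] at this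
    exact this
  · obtain rfl := hι i
    obtain ⟨J, hJ⟩ := hd.charts
    refine ⟨J, ?_, fun j _ => ?_⟩
    · rintro _ ⟨m, -, rfl⟩
      obtain ⟨j, hj, h⟩ := hJ _ ⟨m, rfl⟩
      rw [hG] at h
      exact Set.mem_biUnion hj h
    · convert! (hgr j).image_comp (Sum.inr : _ → D.coord i ⊕ D'.coord j) using 1
      ext c
      constructor
      · rintro ⟨_, ⟨h, ⟨m, hm, rfl⟩⟩, rfl⟩
        exact ⟨_, ⟨m, hm, h, rfl⟩, by ext; simp⟩
      · rintro ⟨_, ⟨m, hm, h, rfl⟩, rfl⟩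
        exact ⟨f m, ⟨h, ⟨m, hm, rfl⟩⟩, by ext; simp⟩
  · obtain rfl := hι i
    exact hgr

end OneChart

end DefMapOn

/-! ### Sheets of a covering -/

section Sheet

variable {E : Type x} {B : Type x'} {D : LocDefSpace.{u, v, w, x, y} L R E}
  {D' : LocDefSpace.{u, v, w, x', y'} L R B}
  {T : Type x₁} [TopologicalSpace T] [Coords R T]

/-- The restriction of `p` to the open admissible subspace `V` is an open embedding with image `U`,
and finitely many charts cover the part of `V` over a chart. -/
structure IsSheet (p : LDMap D D') (V : Set E) (U : Set B) : Prop where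
  admissible : D.IsAdmissible V
  isOpen : IsOpen[D.topology] V
  injOn : Set.InjOn p V
  image : p '' V = U
  openImage : ∀ O, IsOpen[D.topology] O → IsOpen[D'.topology] (p '' (V ∩ O))
  charts : ∀ i, ∃ J : Finset D.ι, ∀ m ∈ V, p m ∈ D'.dom i → ∃ j ∈ J, m ∈ D.dom j

/-- Both finer clauses come from the inverse being an ld-map: its continuity makes images of open
sets open, and the images of chart domains, being definable subspaces, lie in finitely many charts.
-/
theorem _root_.RestrictsToLDHomeo.isSheet {p : LDMap D D'} {V : Set E} {hV : D.IsAdmissible V}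
    {U : Set B} {hU : D'.IsAdmissible U} (h : RestrictsToLDHomeo p V hV U hU)
    (hVo : IsOpen[D.topology] V) (hUo : IsOpen[D'.topology] U) : IsSheet p V U := by
  obtain ⟨e, he, -, he'⟩ := h
  refine ⟨hV, hVo, ?_, ?_, fun O hO => ?_, fun i => ?_⟩
  · intro a ha b hb hab
    have : e ⟨a, ha⟩ = e ⟨b, hb⟩ := Subtype.ext (by rw [he, he]; exact hab)
    exact congrArg Subtype.val (e.injective this)
  · ext b
    constructor
    · rintro ⟨a, ha, rfl⟩
      exact he ⟨a, ha⟩ ▸ (e ⟨a, ha⟩).2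
    · intro hb
      exact ⟨e.symm ⟨b, hb⟩, (e.symm ⟨b, hb⟩).2, by rw [← he, e.apply_symm_apply]⟩
  · have h1 : IsOpen[(D.restrict V hV).topology] {m : V | (m : E) ∈ O} :=
      (D.isOpen_restrict_iff hV).2 ⟨O, hO, fun _ => Iff.rfl⟩
    obtain ⟨O', hO', h2⟩ := (D'.isOpen_restrict_iff hU).1 (he'.isOpen_preimage h1)
    let _ := D'.topology
    convert! hUo.inter hO' using 1
    ext b
    constructor
    · rintro ⟨a, ⟨ha, haO⟩, rfl⟩
      rw [← he ⟨a, ha⟩]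
      exact ⟨(e ⟨a, ha⟩).2, (h2 _).1 (by simpa using haO)⟩
    · rintro ⟨hb, hbO⟩
      exact ⟨e.symm ⟨b, hb⟩, ⟨(e.symm ⟨b, hb⟩).2, (h2 ⟨b, hb⟩).2 hbO⟩,
        by rw [← he, e.apply_symm_apply]⟩
  · obtain ⟨J, hJ, -⟩ := he'.image i
    refine ⟨J, fun m hm hmi => ?_⟩
    have : (⟨m, hm⟩ : V) ∈ e.symm '' (D'.restrict U hU).dom i :=
      ⟨e ⟨m, hm⟩, show (e ⟨m, hm⟩ : B) ∈ D'.dom i by rw [he]; exact hmi, by simp⟩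
    obtain ⟨j, hj, h⟩ := by simpa using! hJ this
    exact ⟨j, hj, h⟩

variable {p : LDMap D D'} {V : Set E} {U : Set B}

theorem IsSheet.exists_section (h : IsSheet p V U) (hV : V.Nonempty) :
    ∃ s : B → E, ∀ b ∈ U, s b ∈ V ∧ p (s b) = b := by
  have : Nonempty E := ⟨hV.some⟩
  have key : ∀ b, ∃ e, b ∈ U → e ∈ V ∧ p e = b := by
    intro b
    by_cases hb : b ∈ U
    · rw [← h.image] at hb
      obtain ⟨e, he, rfl⟩ := hb
      exact ⟨e, fun _ => ⟨he, rfl⟩⟩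
    · exact ⟨Classical.arbitrary E, fun h => (hb h).elim⟩
  exact ⟨fun b => (key b).choose, fun b => (key b).choose_spec⟩

/-- Since `p` is injective on `V`, the value `g z` is the only point of `V` over `H z`. The graph of
`g` is therefore defined from those of `H` and `p` together with `V`. -/
theorem IsSheet.defMapOn (h : IsSheet p V U) {S : Set T} {g : T → E} {H : T → B}
    (hH : D'.DefMapOn S H) (hg : ∀ z ∈ S, g z ∈ V) (hp : ∀ z ∈ S, p (g z) = H z) :
    D.DefMapOn S g := by
  classical
  obtain ⟨J', hJ'⟩ := hH.charts
  choose J hJ using h.charts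
  refine .of_charts ⟨J'.biUnion J, fun z hz => ?_⟩
    (Q := fun j w => ∃ i : J', ∃ d : D'.coord i → R,
      (w.1 ∈ S ∧ H w.1 ∈ D'.dom i ∧ D'.chart i (H w.1) = d) ∧
      w.2 ∈ D.chart j '' (D.dom j ∩ V) ∧ Sum.elim w.2 d ∈
        {c : D.coord j ⊕ D'.coord i → R | ∃ m ∈ D.dom j, p m ∈ D'.dom i ∧
          c = Sum.elim (D.chart j m) (D'.chart i (p m))}) (fun j => ?_) fun j z c => ?_
  · obtain ⟨i, hi, hzi⟩ := hJ' z hz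
    obtain ⟨j, hj, hzj⟩ := hJ i (g z) (hg z hz) ((hp z hz).symm ▸ hzi)
    exact ⟨j, Finset.mem_biUnion.2 ⟨i, hi, hj⟩, hzj⟩
  · refine .exists_finite fun i => .ex (.and ?_ (.and ?_ ?_))
    · exact (hH.graph i).comp (f := fun w : (T × (D.coord j → R)) × (D'.coord i → R) =>
        (w.1.1, w.2)) (by fun_prop)
    · exact DPred.comp (dPred_iff_isDefinable.2 (h.admissible j))
        (f := fun w : (T × (D.coord j → R)) × (D'.coord i → R) => w.1.2) (by fun_prop)
    · refine DPred.comp (dPred_iff_isDefinable.2 (p.isLDMap.graph j i))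
        (f := fun w : (T × (D.coord j → R)) × (D'.coord i → R) => Sum.elim w.1.2 w.2) (.pi ?_)
      rintro (k | k)
      · exact .comp (g := fun c : D.coord j → R => c k) (by fun_prop) (by fun_prop)
      · exact .comp (g := fun c : D'.coord i → R => c k) (by fun_prop) (by fun_prop)
  · constructor
    · rintro ⟨i, d, ⟨hz, hzi, rfl⟩, hcV, m, hm, hmi, hm'⟩
      obtain ⟨rfl, e2⟩ : c = D.chart j m ∧ D'.chart i (H z) = D'.chart i (p m) :=
        ⟨by simpa using congrArg (· ∘ Sum.inl) hm', by simpa using congrArg (· ∘ Sum.inr) hm'⟩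
      have e : g z = m := h.injOn (hg z hz) ((mem_chart_image hm).1 hcV)
        ((hp z hz).trans (D'.injOn i hzi hmi e2))
      exact ⟨hz, e ▸ hm, e ▸ rfl⟩
    · rintro ⟨hz, hzj, rfl⟩
      obtain ⟨i, hi, hzi⟩ := hJ' z hz
      refine ⟨⟨i, hi⟩, _, ⟨hz, hzi, rfl⟩, ⟨_, ⟨hzj, hg z hz⟩, rfl⟩, g z, hzj, ?_, ?_⟩
      · rw [hp z hz]
        exact hzi
      · rw [hp z hz]

/-- As long as `g` stays in `V` it is the inverse of the open embedding `p` on `V`, composed with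
`H`. -/
theorem IsSheet.contAt (h : IsSheet p V U) {S : Set T} {g : T → E} {H : T → B} {z : T}
    (hH : D'.ContAt H S z) (hz : g z ∈ V) (hpz : p (g z) = H z) (hg : ∀ᶠ z in 𝓝[S] z, g z ∈ V)
    (hp : ∀ z ∈ S, p (g z) = H z) :
    D.ContAt g S z := by
  intro O hO hzO
  filter_upwards [hH _ (h.openImage O hO) ⟨g z, ⟨hz, hzO⟩, hpz⟩, self_mem_nhdsWithin, hg]
    with z' h1 h2 h3
  obtain ⟨m, ⟨hm, hmO⟩, e⟩ := h1
  exact h.injOn hm h3 (e.trans (hp z' h2).symm) ▸ hmO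

end Sheet

end LocDefSpace

/-! ### Evenly covered subspaces and uniform subdivision -/

namespace LocDefSpace

universe x' y' x₁

variable {L : FirstOrder.Language.{u, v}} {R : Type w} [L.Structure R] [TopologicalSpace R]
  {E : Type x} {B : Type x'} {D : LocDefSpace.{u, v, w, x, y} L R E}
  {D' : LocDefSpace.{u, v, w, x', y'} L R B}
  {T : Type x₁} [TopologicalSpace T] [Coords R T]

/-- The open admissible subspace `U` is evenly covered by the sheets in `𝒱`. -/
structure IsEvenlyCovered (p : LDMap D D') (U : Set B) (𝒱 : Set (Set E)) : Prop where
  isOpen : IsOpen[D'.topology] U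
  admissible : D'.IsAdmissible U
  sheet : ∀ V ∈ 𝒱, IsSheet p V U
  sUnion : ⋃₀ 𝒱 = p ⁻¹' U
  disjoint : ∀ V ∈ 𝒱, ∀ V' ∈ 𝒱, ∀ e ∈ V, e ∈ V' → V = V'
  finite : ∀ J : Finset D.ι, {V ∈ 𝒱 | ∃ j ∈ J, (D.dom j ∩ V).Nonempty}.Finite

variable {p : LDMap D D'} {U : Set B} {𝒱 : Set (Set E)}

theorem IsEvenlyCovered.exists_mem (h : IsEvenlyCovered p U 𝒱) {e : E} (he : p e ∈ U) :
    ∃ V ∈ 𝒱, e ∈ V := by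
  have : e ∈ ⋃₀ 𝒱 := h.sUnion.superset he
  exact this

/-- A map of a connected set to the part of the total space over an evenly covered subspace stays
in one sheet. -/
theorem IsEvenlyCovered.mem_sheet (h : IsEvenlyCovered p U 𝒱) {V : Set E} (hV : V ∈ 𝒱)
    {C : Set T} (hC : DConn L R C) {g : T → E} (hg : D.DefMapOn C g)
    (hc : ∀ z ∈ C, D.ContAt g C z) (hU : ∀ z ∈ C, p (g z) ∈ U) {z z' : T} (hz : z ∈ C)
    (hz' : z' ∈ C) (hzV : g z ∈ V) : g z' ∈ V := by
  refine (hC {z | z ∈ C ∧ g z ∈ V} (hg.preimage (h.sheet V hV).admissible) ?_ ?_ z hz z' hz'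
    ⟨hz, hzV⟩).2
  · rintro z hz ⟨-, hzV⟩
    filter_upwards [hc z hz V (h.sheet V hV).isOpen hzV, self_mem_nhdsWithin] with z' h1 h2
    exact ⟨h2, h1⟩
  -- A value outside `V` lies in another sheet, which is open and disjoint from `V`.
  · intro z hz hzV
    obtain ⟨V', hV', hzV'⟩ := h.exists_mem (hU z hz)
    filter_upwards [hc z hz V' (h.sheet V' hV').isOpen hzV'] with z' h1 h2
    exact hzV ⟨hz, h.disjoint V' hV' V hV _ h1 h2.2 ▸ hzV'⟩

section Covering

variable [Field R] [LinearOrder R] [IsStrictOrderedRing R] [OrderTopology R]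
  [IsOMinimalExpansion L R]

/-- The sheets are the connected components of `p⁻¹(U)`; the component theorems supply their
openness, the covering of `p⁻¹(U)`, disjointness and finiteness in charts. -/
theorem _root_.IsLDCovering.exists_evenlyCovered (hp : IsLDCovering p) :
    ∃ S : Set (Set B), D'.IsOpenAdmissibleCovering S ∧
      ∀ U ∈ S, ∃ 𝒱, IsEvenlyCovered p U 𝒱 := by
  obtain ⟨-, S, hS, h⟩ := hp
  refine ⟨S, hS, fun U hU => ?_⟩
  obtain ⟨hUo, hUd⟩ := hS.2.1 U hU
  have hadm := p.isLDMap.preimage_admissible hUd.isAdmissible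
  have hopen := p.isLDMap.isOpen_preimage hUo
  refine ⟨{V | D.IsConnComponent (p ⁻¹' U) V}, hUo, hUd.isAdmissible, fun V hV => ?_, ?_, ?_,
    hadm.finite_components⟩
  · obtain ⟨e, he⟩ := hV.1.2.1
    obtain ⟨V', hV', heV', ho⟩ := hadm.exists_component (hV.2.1 he)
    have hVo : IsOpen[D.topology] V := hV'.eq_of_mem hV heV' he ▸ ho hopen
    exact (h U hU hUd V hV).isSheet hVo hUo
  · ext e
    constructor
    · rintro ⟨V, hV, he⟩
      exact hV.2.1 he
    · intro he
      obtain ⟨V, hV, heV, -⟩ := hadm.exists_component he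
      exact ⟨V, hV, heV⟩
  · intro V hV V' hV' e he he'
    exact hV.eq_of_mem hV' he he'

end Covering

/-! ### Subdivision of paths -/

section Reach

variable [LinearOrder R] [Field R] [IsStrictOrderedRing R] [OrderTopology R]
  [IsOMinimalExpansion L R]

/-- The interval `[t, s]` is contained in one of the sets `A k` over `x`. -/
def StepIn {κ : Type*} (A : κ → Set (T × R)) (x : T) (t s : R) : Prop :=
  t ≤ s ∧ s ≤ 1 ∧ ∃ k, ∀ r, t ≤ r → r ≤ s → (x, r) ∈ A k

/-- The interval `[t, 1]` can be subdivided into `m` intervals as in `StepIn`. -/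
def Reach {κ : Type*} (A : κ → Set (T × R)) : ℕ → T → R → Prop
  | 0, _, t => t = 1
  | m + 1, x, t => ∃ s, StepIn A x t s ∧ Reach A m x s

variable {κ : Type*} {A : κ → Set (T × R)}

theorem dPred_stepIn [Finite κ] (hA : ∀ k, DPred L R (· ∈ A k)) {Y : Type*} [TopologicalSpace Y]
    [Coords R Y] {f : Y → T} {a b : Y → R} (hf : DFun L R f) (ha : DFun L R a)
    (hb : DFun L R b) : DPred L R fun y => StepIn A (f y) (a y) (b y) := by
  refine .and (by fun_prop) (.and (by fun_prop) (.exists_finite fun k => ?_))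
  have := hA k
  fun_prop

theorem dPred_reach [Finite κ] (hA : ∀ k, DPred L R (· ∈ A k)) (m : ℕ) :
    DPred L R fun z : T × R => Reach A m z.1 z.2 := by
  induction m with
  | zero =>
    change DPred L R fun z : T × R => z.2 = 1
    fun_prop
  | succ m ih =>
    change DPred L R fun z : T × R => ∃ s, StepIn A z.1 z.2 s ∧ Reach A m z.1 s
    refine .ex (.and (dPred_stepIn hA (by fun_prop) (by fun_prop) (by fun_prop)) ?_)
    exact ih.comp (f := fun w : (T × R) × R => (w.1.1, w.2)) (by fun_prop)

theorem Reach.mono_succ {m : ℕ} {x : T} {t : R} (h1 : ∃ k, (x, (1 : R)) ∈ A k)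
    (h : Reach A m x t) : Reach A (m + 1) x t := by
  induction m generalizing t with
  | zero =>
    obtain rfl : t = 1 := h
    obtain ⟨k, hk⟩ := h1
    -- The extra step is the degenerate interval `[1, 1]`, which is why some `A k` must contain `(x,
    -- 1)`.
    exact ⟨1, ⟨le_rfl, le_rfl, k, fun r hr hr' => le_antisymm hr' hr ▸ hk⟩, rfl⟩
  | succ m ih =>
    obtain ⟨s, hs, h⟩ := h
    exact ⟨s, hs, ih h⟩

theorem Reach.mono {m m' : ℕ} (hm : m ≤ m') {x : T} {t : R} (h1 : ∃ k, (x, (1 : R)) ∈ A k)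
    (h : Reach A m x t) : Reach A m' x t := by
  induction hm with
  | refl => exact h
  | step _ ih => exact ih.mono_succ h1

/-- If the sets `A k` over `x` are relatively open in `[0, 1]` and cover it, and have no frontier
points outside the finite set `F`, then the number of steps needed is bounded in terms of `F`. -/
theorem reach_of_frontier {x : T} (hA : ∀ k, DPred L R fun t => (x, t) ∈ A k) (F : Finset R)
    (hF : ∀ t, t ∉ F → ∀ k, ∃ δ > 0, (∀ s, |s - t| < δ → (x, s) ∈ A k) ∨
      ∀ s, |s - t| < δ → (x, s) ∉ A k)
    (hcov : ∀ t ∈ Icc (0 : R) 1, ∃ k, (x, t) ∈ A k ∧ ∀ᶠ s in 𝓝[Icc 0 1] t, (x, s) ∈ A k)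
    {t : R} (ht : t ∈ Icc (0 : R) 1) :
    Reach A (2 * (F.filter fun s => t < s ∧ s < 1).card + 2) x t := by
  induction hn : (F.filter fun s => t < s ∧ s < 1).card using Nat.strong_induction_on
    generalizing t with
  | _ n ih =>
  have h1 : ∃ k, (x, (1 : R)) ∈ A k := by
    obtain ⟨k, hk, -⟩ := hcov 1 ⟨zero_le_one, le_rfl⟩
    exact ⟨k, hk⟩
  rcases ht.2.eq_or_lt with rfl | ht1
  · exact Reach.mono (Nat.zero_le _) h1 (show Reach A 0 x 1 from rfl)
  -- `b` is the next point of `F` below `1`, or `1` if there is none.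
  obtain ⟨b, htb, hb1, hbF, hb⟩ : ∃ b, t < b ∧ b ≤ 1 ∧ (∀ s ∈ F, t < s → b ≤ s ∨ 1 ≤ s) ∧
      (b ∈ F ∧ b < 1 ∨ b = 1) := by
    by_cases hne : (F.filter fun s => t < s ∧ s < 1).Nonempty
    · have hmem := Finset.mem_filter.1 (Finset.min'_mem _ hne)
      refine ⟨_, hmem.2.1, hmem.2.2.le, fun s hs hts => ?_, Or.inl ⟨hmem.1, hmem.2.2⟩⟩
      rcases lt_or_ge s 1 with h | h
      · exact Or.inl (Finset.min'_le _ _ (Finset.mem_filter.2 ⟨hs, hts, h⟩))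
      · exact Or.inr h
    · refine ⟨1, ht1, le_rfl, fun s hs hts => Or.inr ?_, Or.inr rfl⟩
      by_contra h
      exact hne ⟨s, Finset.mem_filter.2 ⟨hs, hts, not_le.1 h⟩⟩
  have hconst : ∀ k, ∀ r ∈ Ioo t b, ∀ s ∈ Ioo t b, (x, r) ∈ A k → (x, s) ∈ A k := by
    intro k r hr s hs hrk
    refine DPred.of_no_frontier (hA k) Set.ordConnected_Ioo (fun q hq => hF q (fun hqF => ?_) k)
      hr hs hrk
    rcases hbF q hqF hq.1 with h | h
    · exact absurd hq.2 h.not_gt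
    · exact absurd hq.2 (hb1.trans h).not_gt
  -- On `(t, b)` membership in each `A k` is constant. A set that contains a neighbourhood of `t`
  -- thus contains `[t, c]`, and one that contains a neighbourhood of `b` contains `[c, b]`; the two
  -- sets may differ. Hence each gap costs two steps, and the summand `2` in the bound pays for the
  -- last gap, which ends at `1`.
  let c := (t + b) / 2
  have htc : t < c := by simp only [c]; linarith
  have hcb : c < b := by simp only [c]; linarith
  have step₁ : StepIn A x t c := by
    obtain ⟨k, hk, hev⟩ := hcov t ht
    refine ⟨htc.le, hcb.le.trans hb1, k, fun r hr hr' => ?_⟩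
    rcases hr.eq_or_lt with rfl | hr
    · exact hk
    have h2 : ∀ᶠ s in 𝓝[>] t, (x, s) ∈ A k ∧ s ∈ Ioo t b := by
      have h3 : Ioo t b ∈ 𝓝[>] t := Ioo_mem_nhdsGT htb
      refine Filter.Eventually.and ?_ h3
      refine Filter.Eventually.filter_mono (nhdsWithin_le_iff.2 ?_) hev
      filter_upwards [h3] with s hs
      exact ⟨ht.1.trans hs.1.le, hs.2.le.trans hb1⟩
    obtain ⟨s, hs, hs'⟩ := h2.exists
    exact hconst k s hs' r ⟨hr, hr'.trans_lt hcb⟩ hs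
  have step₂ : StepIn A x c b := by
    obtain ⟨k, hk, hev⟩ := hcov b ⟨ht.1.trans htb.le, hb1⟩
    refine ⟨hcb.le, hb1, k, fun r hr hr' => ?_⟩
    rcases hr'.eq_or_lt with rfl | hr'
    · exact hk
    have h2 : ∀ᶠ s in 𝓝[<] b, (x, s) ∈ A k ∧ s ∈ Ioo t b := by
      have h3 : Ioo t b ∈ 𝓝[<] b := Ioo_mem_nhdsLT htb
      refine Filter.Eventually.and ?_ h3
      refine Filter.Eventually.filter_mono (nhdsWithin_le_iff.2 ?_) hev
      filter_upwards [h3] with s hs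
      exact ⟨ht.1.trans hs.1.le, hs.2.le.trans hb1⟩
    obtain ⟨s, hs, hs'⟩ := h2.exists
    exact hconst k s hs' r ⟨htc.trans_le hr, hr'⟩ hs
  rcases hb with ⟨hbF', hb1'⟩ | rfl
  · have hlt : (F.filter fun s => b < s ∧ s < 1).card < n := by
      rw [← hn]
      refine Finset.card_lt_card (Finset.ssubset_iff_of_subset ?_ |>.2
        ⟨b, Finset.mem_filter.2 ⟨hbF', htb, hb1'⟩, by simp⟩)
      intro s hs
      rw [Finset.mem_filter] at hs ⊢
      exact ⟨hs.1, htb.trans hs.2.1, hs.2.2⟩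
    have h3 := ih _ hlt (t := b) ⟨ht.1.trans htb.le, hb1⟩ rfl
    exact ⟨c, step₁, b, step₂, h3.mono (by omega) h1⟩
  · exact ⟨c, step₁, 1, step₂, Reach.mono (Nat.zero_le _) h1 (show Reach A 0 x 1 from rfl)⟩

/-- The frontier points over `x` are among the values of finitely many selectors, and the number of
selectors does not depend on `x`. This replaces the Lebesgue number. -/
theorem exists_reach [Finite κ] (hT : HasUniformFiniteness L R T) (hA : ∀ k, DPred L R (· ∈ A k))
    {X : Set T}
    (hcov : ∀ x ∈ X, ∀ t ∈ Icc (0 : R) 1, ∃ k, (x, t) ∈ A k ∧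
      ∀ᶠ s in 𝓝[Icc 0 1] t, (x, s) ∈ A k) :
    ∃ m, ∀ x ∈ X, ∀ t ∈ Icc (0 : R) 1, Reach A m x t := by
  classical
  have := Fintype.ofFinite κ
  choose N f hf h using fun k => hT.exists_frontier_selectors (hA k)
  let F : T → Finset R := fun x => Finset.univ.image fun i : Σ k, Fin (N k) => f i.1 i.2 x
  refine ⟨2 * Fintype.card (Σ k, Fin (N k)) + 2, fun x hx t ht => ?_⟩
  have hk : ∀ k, DPred L R fun t => (x, t) ∈ A k := fun k => by
    have := hA k
    fun_prop
  have key := reach_of_frontier hk (F x) (fun t ht k => h k x t fun i hi => ht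
    (Finset.mem_image.2 ⟨⟨k, i⟩, Finset.mem_univ _, hi⟩)) (hcov x hx) ht
  refine key.mono ?_ ?_
  · have h1 := Finset.card_filter_le (F x) fun s => t < s ∧ s < 1
    have h2 : (F x).card ≤ _ := Finset.card_image_le
    rw [Finset.card_univ] at h2
    omega
  · obtain ⟨k, hk, -⟩ := hcov x hx 1 ⟨zero_le_one, le_rfl⟩
    exact ⟨k, hk⟩

end Reach

end LocDefSpace

/-! ### Construction of a definable lift, continuous along fibres -/

namespace LocDefSpace

universe x' y' x₁ x₂

variable {L : FirstOrder.Language.{u, v}} {R : Type w} [L.Structure R] [TopologicalSpace R]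
  [Field R] [LinearOrder R] [IsStrictOrderedRing R] [OrderTopology R] [IsOMinimalExpansion L R]
  {E : Type x} {B : Type x'} {D : LocDefSpace.{u, v, w, x, y} L R E}
  {D' : LocDefSpace.{u, v, w, x', y'} L R B}
  {p : LDMap D D'} {T : Type x₁} [TopologicalSpace T] [Coords R T]

/-- `G` is a definable lift of `H` on the strip `{(x, t) | x ∈ X, a x ≤ t ≤ 1}` which starts at `e`
and is continuous on the fibres of the strip. -/
structure IsLiftOn (p : LDMap D D') (H : T × R → B) (a : T → R) (e : T → E) (X : Set T)
    (G : T × R → E) : Prop where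
  defMapOn : D.DefMapOn {z | z.1 ∈ X ∧ a z.1 ≤ z.2 ∧ z.2 ≤ 1} G
  start : ∀ x ∈ X, G (x, a x) = e x
  lift : ∀ x ∈ X, ∀ t, a x ≤ t → t ≤ 1 → p (G (x, t)) = H (x, t)
  cont : ∀ x ∈ X, ∀ t ∈ Icc (a x) 1, D.ContAt (fun t => G (x, t)) (Icc (a x) 1) t

section Patch

variable {H : T × R → B} {a : T → R} {e : T → E} {X X₁ X₂ : Set T} {G G₁ G₂ : T × R → E}

theorem IsLiftOn.mono (h : IsLiftOn p H a e X G) (ha : DFun L R a) (hX₁ : DPred L R (· ∈ X₁))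
    (hsub : X₁ ⊆ X) : IsLiftOn p H a e X₁ G where
  defMapOn := h.defMapOn.mono
    (show DPred L R fun z : T × R => z.1 ∈ X₁ ∧ a z.1 ≤ z.2 ∧ z.2 ≤ 1 by fun_prop)
    fun _ hz => ⟨hsub hz.1, hz.2⟩
  start x hx := h.start x (hsub hx)
  lift x hx := h.lift x (hsub hx)
  cont x hx := h.cont x (hsub hx)

-- As `IsLiftOn` demands no continuity in `x`, lifts over two parts of the base combine without any
-- compatibility on the overlap.
open Classical in
theorem IsLiftOn.union (h₁ : IsLiftOn p H a e X₁ G₁) (h₂ : IsLiftOn p H a e X₂ G₂)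
    (ha : DFun L R a) (hX₁ : DPred L R (· ∈ X₁)) (hX₂ : DPred L R (· ∈ X₂)) :
    IsLiftOn p H a e (X₁ ∪ X₂) fun z => if z.1 ∈ X₁ then G₁ z else G₂ z := by
  have hd : DPred L R (· ∈ X₂ \ X₁) := show DPred L R fun x => x ∈ X₂ ∧ ¬ x ∈ X₁ by fun_prop
  have h₂' := h₂.mono ha hd Set.sdiff_subset
  have split : ∀ x ∈ X₁ ∪ X₂, x ∈ X₁ ∨ x ∈ X₂ \ X₁ := fun x hx => by
    by_cases h : x ∈ X₁
    · exact Or.inl h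
    · exact Or.inr ⟨hx.resolve_left h, h⟩
  refine ⟨?_, fun x hx => ?_, fun x hx => ?_, fun x hx => ?_⟩
  · have := (h₁.defMapOn.congr (g' := fun z => if z.1 ∈ X₁ then G₁ z else G₂ z)
      fun z hz => if_pos hz.1).union (h₂'.defMapOn.congr fun z hz => if_neg hz.1.2)
    convert! this using 1
    ext z
    simp only [Set.mem_ofPred_eq, Set.mem_union, ← or_and_right]
    exact and_congr_left fun _ => ⟨split z.1, Or.imp_right And.left⟩
  · rcases split x hx with h | h
    · simpa [h] using h₁.start x h
    · simpa [h.2] using h₂.start x h.1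
  · rcases split x hx with h | h
    · simpa [h] using h₁.lift x h
    · simpa [h.2] using h₂.lift x h.1
  · rcases split x hx with h | h
    · simpa [h] using h₁.cont x h
    · simpa [h.2] using h₂.cont x h.1

theorem exists_isLiftOn_iUnion [Nonempty E] {κ : Type x₂} [Finite κ] {Y : κ → Set T}
    (ha : DFun L R a) (hY : ∀ k, DPred L R (· ∈ Y k))
    (h : ∀ k, ∃ G, IsLiftOn p H a e (Y k) G) : ∃ G, IsLiftOn p H a e (⋃ k, Y k) G := by
  classical
  have := Fintype.ofFinite κ
  have key : ∀ s : Finset κ, DPred L R (· ∈ ⋃ k ∈ s, Y k) ∧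
      ∃ G, IsLiftOn p H a e (⋃ k ∈ s, Y k) G := by
    intro s
    induction s using Finset.induction_on with
    | empty =>
      refine ⟨(DPred.const False).congr (by simp), fun _ => Classical.arbitrary E, ?_, by simp,
        by simp, by simp⟩
      simpa using DefMapOn.empty _
    | insert k s _ ih =>
      obtain ⟨hs, G₂, h₂⟩ := ih
      obtain ⟨G₁, h₁⟩ := h k
      rw [Finset.set_biUnion_insert]
      exact ⟨(hY k).or hs, _, h₁.union h₂ ha (hY k) hs⟩
  simpa using (key Finset.univ).2

end Patch

section Lifting

variable {κ : Type x₂} [Finite κ] {U : κ → Set B} {𝒱 : κ → Set (Set E)}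
  {X : Set T} {H : T × R → B}

/-- The part of the cylinder over `X` which is mapped to `U`. -/
def partOver (X : Set T) (H : T × R → B) (U : Set B) : Set (T × R) :=
  {z | z ∈ X ×ˢ Icc (0 : R) 1 ∧ H z ∈ U}

open Classical in
theorem IsLiftOn.concat {a s : T → R} {e : T → E} {G₁ G₂ : T × R → E} {Y : Set T}
    (has : ∀ x ∈ Y, a x ≤ s x ∧ s x ≤ 1)
    (hd : D.DefMapOn {z | z.1 ∈ Y ∧ a z.1 ≤ z.2 ∧ z.2 ≤ s z.1} G₁)
    (hstart : ∀ x ∈ Y, G₁ (x, a x) = e x)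
    (hlift : ∀ x ∈ Y, ∀ t, a x ≤ t → t ≤ s x → p (G₁ (x, t)) = H (x, t))
    (hcont : ∀ x ∈ Y, ∀ t ∈ Icc (a x) (s x),
      D.ContAt (fun t => G₁ (x, t)) (Icc (a x) (s x)) t)
    (h₂ : IsLiftOn p H s (fun x => G₁ (x, s x)) Y G₂) :
    IsLiftOn p H a e Y fun z => if z.2 ≤ s z.1 then G₁ z else G₂ z := by
  -- At the seam `t = s x` both lifts have the same value, so the combined map equals `G₂` on the
  -- closed second strip.
  have e₂ : ∀ x ∈ Y, ∀ t, s x ≤ t →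
      (if t ≤ s x then G₁ (x, t) else G₂ (x, t)) = G₂ (x, t) := by
    intro x hx t ht
    split_ifs with h
    · obtain rfl := le_antisymm h ht
      exact (h₂.start x hx).symm
    · rfl
  refine ⟨?_, fun x hx => ?_, fun x hx t h3 h4 => ?_, fun x hx t ht => ?_⟩
  · have := (hd.congr (g' := fun z => if z.2 ≤ s z.1 then G₁ z else G₂ z)
      fun z hz => if_pos hz.2.2).union (h₂.defMapOn.congr fun z hz => e₂ z.1 hz.1 z.2 hz.2.1)
    convert! this using 1
    ext z
    constructor
    · rintro ⟨h1, h2, h3⟩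
      rcases le_total z.2 (s z.1) with h | h
      · exact Or.inl ⟨h1, h2, h⟩
      · exact Or.inr ⟨h1, h, h3⟩
    · rintro (⟨h1, h2, h3⟩ | ⟨h1, h2, h3⟩)
      · exact ⟨h1, h2, h3.trans (has _ h1).2⟩
      · exact ⟨h1, (has _ h1).1.trans h2, h3⟩
  · simpa [(has x hx).1] using hstart x hx
  · rcases le_total t (s x) with h | h
    · simpa [h] using hlift x hx t h3 h
    · simpa only [e₂ x hx t h] using h₂.lift x hx t h h4
  · rw [← Set.Icc_union_Icc_eq_Icc (has x hx).1 (has x hx).2]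
    refine ContAt.union ?_ ?_
    · by_cases h : t ∈ Icc (a x) (s x)
      · exact (hcont x hx t h).congr h fun t ht => if_pos ht.2
      · exact .of_notMem isClosed_Icc subset_rfl h
    · by_cases h : t ∈ Icc (s x) 1
      · exact (h₂.cont x hx t h).congr h fun t ht => e₂ x hx t ht.1
      · exact .of_notMem isClosed_Icc subset_rfl h

/-- Induction on the number of steps. The first step lies over a single `U k`, and there the lift is
a section of a sheet composed with `H`; its end is the starting point for the remaining steps. -/
theorem exists_isLiftOn [Nonempty E] (hU : ∀ k, IsEvenlyCovered p (U k) (𝒱 k))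
    (hH : D'.DefMapOn (X ×ˢ Icc (0 : R) 1) H)
    (hHc : ∀ z ∈ X ×ˢ Icc (0 : R) 1, D'.ContAt H (X ×ˢ Icc (0 : R) 1) z) (m : ℕ)
    {a : T → R} {e : T → E} {Y : Set T} (ha : DFun L R a) (he : D.DefMapOn Y e) (hYX : Y ⊆ X)
    (ha0 : ∀ x ∈ Y, 0 ≤ a x ∧ a x ≤ 1)
    (hp : ∀ x ∈ Y, p (e x) = H (x, a x))
    (hm : ∀ x ∈ Y, Reach (fun k => partOver X H (U k)) m x (a x)) :
    ∃ G, IsLiftOn p H a e Y G := by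
  have hA : ∀ k, DPred L R (· ∈ partOver X H (U k)) := fun k => hH.preimage (hU k).admissible
  induction m generalizing a e Y with
  | zero =>
    have hm : ∀ x ∈ Y, a x = 1 := hm
    have hY := he.dPred
    refine ⟨fun z => e z.1, ?_, fun _ _ => rfl, fun x hx t h1 h2 => ?_, fun x hx t ht => ?_⟩
    · exact he.comp (by fun_prop)
        (show DPred L R fun z : T × R => z.1 ∈ Y ∧ a z.1 ≤ z.2 ∧ z.2 ≤ 1 by fun_prop)
        fun z hz => hz.1
    · obtain rfl : t = 1 := le_antisymm h2 (hm x hx ▸ h1)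
      rw [hp x hx, hm x hx]
    · exact fun O _ h => Filter.Eventually.of_forall fun _ => h
  | succ m ih =>
    have hY := he.dPred
    -- The end `s x` of the first step is chosen definably; it may well be discontinuous in `x`.
    obtain ⟨s, hs, hs'⟩ := exists_dFun_choice (L := L)
      (P := fun x s => StepIn (fun k => partOver X H (U k)) x (a x) s ∧
        Reach (fun k => partOver X H (U k)) m x s)
      (.and (dPred_stepIn hA (by fun_prop) (by fun_prop) (by fun_prop)) (dPred_reach hA m))
    replace hs' := fun x hx => hs' x (hm x hx)
    obtain ⟨J, hJ⟩ := he.charts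
    -- The starting points `e x` lie in finitely many charts, which meet finitely many sheets. So
    -- the base splits into finitely many definable sets `Y'`, over each of which the set `U k` and
    -- the sheet are fixed.
    have hfin : ∀ k, Finite {V ∈ 𝒱 k | ∃ j ∈ J, (D.dom j ∩ V).Nonempty} := fun k =>
      ((hU k).finite J).to_subtype
    let Y' : (Σ k, {V ∈ 𝒱 k | ∃ j ∈ J, (D.dom j ∩ V).Nonempty}) → Set T := fun q =>
      {x | (x ∈ Y ∧ e x ∈ q.2.1) ∧ ∀ r, a x ≤ r → r ≤ s x → (x, r) ∈ partOver X H (U q.1)}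
    have hY' : ∀ q, DPred L R (· ∈ Y' q) := fun q => by
      have h1 := hA q.1
      exact (he.preimage ((hU q.1).sheet _ q.2.2.1).admissible).and (by fun_prop)
    have hcover : Y = ⋃ q, Y' q := by
      ext x
      rw [Set.mem_iUnion]
      constructor
      · intro hx
        obtain ⟨⟨h1, h2, k, hk⟩, -⟩ := hs' x hx
        obtain ⟨V, hV, hxV⟩ := (hU k).exists_mem (e := e x) (by
          rw [hp x hx]
          exact (hk _ le_rfl h1).2)
        obtain ⟨j, hj, hxj⟩ := hJ x hx
        exact ⟨⟨k, V, hV, j, hj, _, hxj, hxV⟩, ⟨hx, hxV⟩, hk⟩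
      · rintro ⟨q, hq⟩
        exact hq.1.1
    rw [hcover]
    refine exists_isLiftOn_iUnion ha hY' ?_
    rintro ⟨k, V, hV, hVJ⟩
    let Z := Y' ⟨k, V, hV, hVJ⟩
    have hZ : DPred L R (· ∈ Z) := hY' _
    have hsh := (hU k).sheet V hV
    obtain ⟨σ, hσ⟩ := hsh.exists_section (by
      obtain ⟨j, -, hne⟩ := hVJ
      exact hne.mono Set.inter_subset_right)
    have hG₁ : ∀ x ∈ Z, ∀ t, a x ≤ t → t ≤ s x →
        ((x, t) ∈ X ×ˢ Icc (0 : R) 1 ∧ σ (H (x, t)) ∈ V ∧ p (σ (H (x, t))) = H (x, t)) :=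
      fun x hx t h1 h2 => ⟨(hx.2 t h1 h2).1, hσ _ (hx.2 t h1 h2).2⟩
    have hst : ∀ x ∈ Z, a x ≤ s x ∧ s x ≤ 1 := fun x hx =>
      ⟨(hs' x hx.1.1).1.1, (hs' x hx.1.1).1.2.1⟩
    have hd : D.DefMapOn {z : T × R | z.1 ∈ Z ∧ a z.1 ≤ z.2 ∧ z.2 ≤ s z.1}
        (fun z => σ (H z)) := by
      refine hsh.defMapOn (hH.mono ?_ fun z hz => (hG₁ z.1 hz.1 z.2 hz.2.1 hz.2.2).1)
        (fun z hz => (hG₁ z.1 hz.1 z.2 hz.2.1 hz.2.2).2.1)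
        (fun z hz => (hG₁ z.1 hz.1 z.2 hz.2.1 hz.2.2).2.2)
      change DPred L R fun z : T × R => z.1 ∈ Z ∧ a z.1 ≤ z.2 ∧ z.2 ≤ s z.1
      fun_prop
    obtain ⟨G₂, h₂⟩ := ih (a := s) (e := fun x => σ (H (x, s x))) (Y := Z) hs
      (hd.comp (φ := fun x => (x, s x)) (by fun_prop) hZ
        fun x hx => ⟨hx, (hst x hx).1, le_rfl⟩)
      (fun x hx => hYX hx.1.1)
      (fun x hx => ⟨(ha0 x hx.1.1).1.trans (hst x hx).1, (hst x hx).2⟩)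
      (fun x hx => (hG₁ x hx _ (hst x hx).1 le_rfl).2.2) (fun x hx => (hs' x hx.1.1).2)
    refine ⟨_, IsLiftOn.concat (e := e) hst hd (fun x hx => ?_)
      (fun x hx t h1 h2 => (hG₁ x hx t h1 h2).2.2) (fun x hx t ht => ?_) h₂⟩
    · obtain ⟨-, h2, h3⟩ := hG₁ x hx _ le_rfl (hst x hx).1
      exact hsh.injOn h2 hx.1.2 (h3.trans (hp x hx.1.1).symm)
    · obtain ⟨h1, h2, h3⟩ := hG₁ x hx t ht.1 ht.2
      refine hsh.contAt (H := fun t => H (x, t)) ?_ h2 h3 ?_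
        (fun t ht => (hG₁ x hx t ht.1 ht.2).2.2)
      · exact (hHc _ h1).comp (φ := fun t => (x, t)) (by fun_prop)
          fun t ht => (hG₁ x hx t ht.1 ht.2).1
      · filter_upwards [self_mem_nhdsWithin] with t ht
        exact (hG₁ x hx t ht.1 ht.2).2.1

end Lifting

end LocDefSpace

/-! ### Continuity of the lift and homotopy lifting for coverings -/

namespace LocDefSpace

universe x' y' x₁ x₂

variable {L : FirstOrder.Language.{u, v}} {R : Type w} [L.Structure R] [TopologicalSpace R]
  [Field R] [LinearOrder R] [IsStrictOrderedRing R] [OrderTopology R] [IsOMinimalExpansion L R]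
  {E : Type x} {B : Type x'} {D : LocDefSpace.{u, v, w, x, y} L R E}
  {D' : LocDefSpace.{u, v, w, x', y'} L R B}
  {p : LDMap D D'} {T : Type x₁} [TopologicalSpace T] [Coords R T]

/-- A form of the tube lemma for definable sets. -/
theorem exists_tube {A : Set (T × R)} (hA : DPred L R (· ∈ A)) {X : Set T}
    (hX : DPred L R (· ∈ X)) {x₀ : T} {t s : R} (hts : t ≤ s)
    (hopen : ∀ r ∈ Icc t s, ∃ δ > (0 : R), ∀ x ∈ X, Near x₀ x δ → ∀ r', |r' - r| < δ →
      r' ∈ Icc t s → (x, r') ∈ A) :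
    ∃ δ > (0 : R), ∀ x ∈ X, Near x₀ x δ → ∀ r ∈ Icc t s, (x, r) ∈ A := by
  have hP : DPred L R fun r : R => ∃ δ : R, 0 < δ ∧ ∀ x, x ∈ X → Near x₀ x δ →
      ∀ r' : R, t ≤ r' → r' ≤ s → r' ≤ r → (x, r') ∈ A := by fun_prop
  suffices h : ∃ δ : R, 0 < δ ∧ ∀ x, x ∈ X → Near x₀ x δ →
      ∀ r' : R, t ≤ r' → r' ≤ s → r' ≤ s → (x, r') ∈ A by
    obtain ⟨δ, hδ, h⟩ := h
    exact ⟨δ, hδ, fun x hx hn r hr => h x hx hn r hr.1 hr.2 hr.2⟩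
  -- Induction on the height up to which a tube exists takes the place of compactness of `[t, s]`.
  refine hP.Icc_induction (a := t) (b := s) ?_ ?_ ?_ s ⟨hts, le_rfl⟩
  · obtain ⟨δ, hδ, h⟩ := hopen t ⟨le_rfl, hts⟩
    refine ⟨δ, hδ, fun x hx hn r h1 h2 h3 => ?_⟩
    obtain rfl := le_antisymm h3 h1
    exact h x hx hn r (by simpa using hδ) ⟨h1, h2⟩
  · rintro q hq1 hq2 ⟨δ₁, hδ₁, h₁⟩
    obtain ⟨δ, hδ, h⟩ := hopen q ⟨hq1, hq2.le⟩
    refine ⟨q + δ, by linarith, fun r hr => ⟨min δ₁ δ, lt_min hδ₁ hδ, fun x hx hn r' h1 h2 h3 => ?_⟩⟩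
    rcases le_or_gt r' q with h4 | h4
    · exact h₁ x hx (hn.mono (min_le_left _ _)) r' h1 h2 h4
    · refine h x hx (hn.mono (min_le_right _ _)) r' ?_ ⟨h1, h2⟩
      rw [abs_of_pos (by linarith)]
      linarith [hr.2]
  · intro q hq1 hq2 ih
    obtain ⟨δ, hδ, h⟩ := hopen q ⟨hq1.le, hq2⟩
    obtain ⟨δ₁, hδ₁, h₁⟩ := ih (max t (q - δ / 2)) ⟨le_max_left _ _, max_lt hq1 (by linarith)⟩
    refine ⟨min δ₁ δ, lt_min hδ₁ hδ, fun x hx hn r' h1 h2 h3 => ?_⟩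
    rcases le_or_gt r' (max t (q - δ / 2)) with h4 | h4
    · exact h₁ x hx (hn.mono (min_le_left _ _)) r' h1 h2 h4
    · refine h x hx (hn.mono (min_le_right _ _)) r' ?_ ⟨h1, h2⟩
      have := (le_max_right t (q - δ / 2)).trans_lt h4
      rw [abs_sub_lt_iff]
      constructor <;> linarith

section Lifting

variable {κ : Type x₂} {U : κ → Set B} {𝒱 : κ → Set (Set E)}
  {X : Set T} {H : T × R → B} {G : T × R → E} {e : T → E}

/-- A lift that is continuous at the beginning and on the fibres is continuous. -/
theorem IsLiftOn.contAt (hU : ∀ k, IsEvenlyCovered p (U k) (𝒱 k)) (hX : DPred L R (· ∈ X))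
    (hH : D'.DefMapOn (X ×ˢ Icc (0 : R) 1) H)
    (hHc : ∀ z ∈ X ×ˢ Icc (0 : R) 1, D'.ContAt H (X ×ˢ Icc (0 : R) 1) z)
    (hG : IsLiftOn p H (fun _ => 0) e X G) {x₀ : T} (hx₀ : x₀ ∈ X) (m : ℕ) {t : R}
    (ht : t ∈ Icc (0 : R) 1) (hm : Reach (fun k => partOver X H (U k)) m x₀ t)
    (hc : D.ContAt (fun x => G (x, t)) X x₀) :
    ∀ r ∈ Icc t 1, D.ContAt G (X ×ˢ Icc t 1) (x₀, r) := by
  induction m generalizing t with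
  | zero =>
    obtain rfl : t = 1 := hm
    intro r hr
    refine (ContAt.comp (φ := Prod.fst) (z := (x₀, r)) (S' := X ×ˢ Icc (1 : R) 1) hc
      continuousWithinAt_fst fun z hz => hz.1).congr ⟨hx₀, hr⟩ fun z hz => ?_
    have : z.2 = 1 := le_antisymm hz.2.2 hz.2.1
    rw [← this]
  | succ m ih =>
    obtain ⟨s, ⟨hts, hs1, k, hk⟩, hreach⟩ := hm
    have hs0 : 0 ≤ s := ht.1.trans hts
    obtain ⟨V, hV, hV'⟩ := (hU k).exists_mem (e := G (x₀, t)) (by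
      rw [hG.lift x₀ hx₀ t ht.1 ht.2]
      exact (hk t le_rfl hts).2)
    have hsh := (hU k).sheet V hV
    -- The step `[t, s]`, chosen for `x₀`, lies over `U k` for all nearby `x` as well.
    obtain ⟨δ, hδ, htube⟩ := exists_tube (A := partOver X H (U k))
      (hH.preimage (hU k).admissible) hX (x₀ := x₀) hts (by
        intro r hr
        have h0 := hHc (x₀, r) (hk r hr.1 hr.2).1 (U k) (hU k).isOpen (hk r hr.1 hr.2).2
        rw [Filter.Eventually, mem_nhdsWithin_iff_eventually, Filter.Eventually,
          mem_nhds_iff_near (R := R)] at h0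
        obtain ⟨δ, hδ, h⟩ := h0
        refine ⟨δ, hδ, fun x hx hn r' hr' hmem => ?_⟩
        have hz : (x, r') ∈ X ×ˢ Icc (0 : R) 1 :=
          ⟨hx, ht.1.trans hmem.1, hmem.2.trans hs1⟩
        exact ⟨hz, h (x, r') (near_prod.2 ⟨hn, near_line.2 hr'⟩) hz⟩)
    -- For `x` near `x₀` the path `r ↦ G (x, r)` starts in `V` by continuity at height `t`. It lies
    -- over `U k`, so by connectedness of `[t, s]` it never leaves `V`.
    have hnear : ∀ᶠ x in 𝓝[X] x₀, x ∈ X ∧ ∀ r ∈ Icc t s, G (x, r) ∈ V := by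
      filter_upwards [hc V hsh.isOpen hV', self_mem_nhdsWithin,
        mem_nhdsWithin_of_mem_nhds (near_mem_nhds x₀ hδ)] with x h1 h2 h3
      refine ⟨h2, fun r hr => ?_⟩
      refine (hU k).mem_sheet hV (dConn_of_ordConnected (L := L) (J := Icc t s)
        Set.ordConnected_Icc) (g := fun r => G (x, r)) ?_ (fun r hr => ?_) (fun r hr => ?_)
        ⟨le_rfl, hts⟩ hr h1
      · refine hG.defMapOn.comp (φ := fun r => (x, r)) (by fun_prop)
          (show DPred L R fun r : R => t ≤ r ∧ r ≤ s by fun_prop)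
          fun r hr => ⟨h2, ht.1.trans hr.1, hr.2.trans hs1⟩
      · exact (hG.cont x h2 r ⟨ht.1.trans hr.1, hr.2.trans hs1⟩).mono
          (Set.Icc_subset_Icc ht.1 hs1)
      · rw [hG.lift x h2 r (ht.1.trans hr.1) (hr.2.trans hs1)]
        exact (htube x h2 h3 r hr).2
    have hstrip : ∀ r ∈ Icc t s, D.ContAt G (X ×ˢ Icc t s) (x₀, r) := by
      intro r hr
      have hsub : X ×ˢ Icc t s ⊆ X ×ˢ Icc (0 : R) 1 :=
        Set.prod_mono subset_rfl (Set.Icc_subset_Icc ht.1 hs1)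
      refine hsh.contAt ((hHc (x₀, r) (hk r hr.1 hr.2).1).mono hsub) ?_ ?_ ?_ fun z hz => ?_
      · exact (mem_of_mem_nhdsWithin hx₀ hnear).2 r hr
      · exact hG.lift x₀ hx₀ r (ht.1.trans hr.1) (hr.2.trans hs1)
      · have hfst : Filter.Tendsto Prod.fst (𝓝[X ×ˢ Icc t s] (x₀, r)) (𝓝[X] x₀) :=
          tendsto_nhdsWithin_iff.2 ⟨continuousWithinAt_fst, by
            filter_upwards [self_mem_nhdsWithin] with z hz using hz.1⟩
        filter_upwards [hfst.eventually hnear, self_mem_nhdsWithin] with z h1 h2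
        exact h1.2 z.2 h2.2
      · exact hG.lift z.1 hz.1 z.2 (ht.1.trans hz.2.1) (hz.2.2.trans hs1)
    -- Joint continuity on the strip gives continuity in `x` at height `s`, the hypothesis for the
    -- next step.
    have hc' : D.ContAt (fun x => G (x, s)) X x₀ :=
      (hstrip s ⟨hts, le_rfl⟩).comp (φ := fun x => (x, s)) (by fun_prop)
        fun x hx => ⟨hx, hts, le_rfl⟩
    have hrest := ih ⟨hs0, hs1⟩ hreach hc'
    intro r hr
    rw [← Set.Icc_union_Icc_eq_Icc hts hs1, Set.prod_union]
    refine ContAt.union ?_ ?_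
    · by_cases h : r ∈ Icc t s
      · exact hstrip r h
      · exact .of_notMem (C := Set.univ ×ˢ Icc t s) (isClosed_univ.prod isClosed_Icc)
          (Set.prod_mono (Set.subset_univ _) subset_rfl) fun h' => h h'.2
    · by_cases h : r ∈ Icc s 1
      · exact hrest r h
      · exact .of_notMem (C := Set.univ ×ˢ Icc s 1) (isClosed_univ.prod isClosed_Icc)
          (Set.prod_mono (Set.subset_univ _) subset_rfl) fun hmem => h hmem.2

/-- Homotopy lifting for coverings. -/
theorem _root_.IsLDCovering.exists_lift [Nonempty E] (hp : IsLDCovering p)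
    (hT : HasUniformFiniteness L R T)
    (hH : D'.DefMapOn (X ×ˢ Icc (0 : R) 1) H)
    (hHc : ∀ z ∈ X ×ˢ Icc (0 : R) 1, D'.ContAt H (X ×ˢ Icc (0 : R) 1) z)
    (he : D.DefMapOn X e) (hec : ∀ x ∈ X, D.ContAt e X x) (hpe : ∀ x ∈ X, p (e x) = H (x, 0)) :
    ∃ G : T × R → E, D.DefMapOn (X ×ˢ Icc (0 : R) 1) G ∧
      (∀ z ∈ X ×ˢ Icc (0 : R) 1, D.ContAt G (X ×ˢ Icc (0 : R) 1) z) ∧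
      (∀ x ∈ X, G (x, 0) = e x) ∧ ∀ z ∈ X ×ˢ Icc (0 : R) 1, p (G z) = H z := by
  obtain ⟨S, ⟨-, -, hS⟩, hev⟩ := hp.exists_evenlyCovered
  choose! 𝒱 h𝒱 using hev
  obtain ⟨J, hJ⟩ := hH.charts
  -- `H` takes values in finitely many charts, and admissibility of the covering provides finitely
  -- many members of `S` for each of them.
  choose W hWS hWf hW using hS
  have hfin : Finite (⋃ i ∈ J, W i : Set (Set B)) :=
    (J.finite_toSet.biUnion fun i _ => hWf i).to_subtype
  let U : (⋃ i ∈ J, W i : Set (Set B)) → Set B := Subtype.val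
  have hU : ∀ k, IsEvenlyCovered p (U k) (𝒱 (U k)) := by
    rintro ⟨V, hV⟩
    simp only [Set.mem_iUnion] at hV
    obtain ⟨i, -, hV⟩ := hV
    exact h𝒱 V (hWS i hV)
  have hcov : ∀ z ∈ X ×ˢ Icc (0 : R) 1, ∃ k, H z ∈ U k := by
    intro z hz
    obtain ⟨i, hi, hzi⟩ := hJ z hz
    obtain ⟨V, hV, hzV⟩ := hW i hzi
    exact ⟨⟨V, Set.mem_biUnion hi hV⟩, hzV⟩
  obtain ⟨m, hm⟩ := exists_reach (A := fun k => partOver X H (U k)) hT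
    (fun k => hH.preimage (hU k).admissible) (X := X) (by
      intro x hx t ht
      obtain ⟨k, hk⟩ := hcov (x, t) ⟨hx, ht⟩
      refine ⟨k, ⟨⟨hx, ht⟩, hk⟩, ?_⟩
      have h0 := (hHc (x, t) ⟨hx, ht⟩).comp (φ := fun t => (x, t)) (S' := Icc (0 : R) 1) (z := t)
        (by fun_prop) (fun t ht => ⟨hx, ht⟩) (U k) (hU k).isOpen hk
      filter_upwards [h0, self_mem_nhdsWithin] with s h1 h2
      exact ⟨⟨hx, h2⟩, h1⟩)
  obtain ⟨G, hG⟩ := exists_isLiftOn hU hH hHc m (a := fun _ => 0) (by fun_prop) he subset_rfl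
    (fun x _ => ⟨le_rfl, zero_le_one⟩) hpe (fun x hx => hm x hx 0 ⟨le_rfl, zero_le_one⟩)
  refine ⟨G, hG.defMapOn, fun z hz => ?_, hG.start, fun z hz => hG.lift z.1 hz.1 z.2 hz.2.1 hz.2.2⟩
  refine hG.contAt hU he.dPred hH hHc hz.1 m ⟨le_rfl, zero_le_one⟩
    (hm z.1 hz.1 0 ⟨le_rfl, zero_le_one⟩) ?_ z.2 hz.2
  exact (hec z.1 hz.1).congr hz.1 hG.start

end Lifting

section Cylinder

variable {n : ℕ} {X : Set (Fin n → R)} (hX : IsDefinable L X)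

theorem _root_.IsLDMap.defMapOn_definable {f : X → E} (hf : IsLDMap (ofDefinable X hX) D f)
    {G : (Fin n → R) → E} (hG : ∀ a : X, G a = f a) :
    D.DefMapOn X G ∧ ∀ a ∈ X, D.ContAt G X a := by
  have h1 : D.DefMapOn (Set.range (Subtype.val : X → Fin n → R)) G :=
    hf.defMapOn (D := ofDefinable X hX) () (fun _ => trivial) hG
  have h2 : ∀ a : X, D.ContAt G (Set.range (Subtype.val : X → Fin n → R)) a :=
    hf.contAt (D := ofDefinable X hX) () (fun _ => trivial) hG
  rw [Subtype.range_val] at h1 h2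
  exact ⟨h1, fun a ha => h2 ⟨a, ha⟩⟩

theorem range_cylinder_chart : Set.range (((ofDefinable X hX).prod (unitSpace L R)).chart ((), ())) =
    {c : Fin n ⊕ Unit → R | c ∘ Sum.inl ∈ X ∧ 0 ≤ c (Sum.inr ()) ∧ c (Sum.inr ()) ≤ 1} := by
  ext c
  constructor
  · rintro ⟨⟨a, t⟩, rfl⟩
    exact ⟨a.2, t.2⟩
  · rintro ⟨h1, h2⟩
    refine ⟨(⟨_, h1⟩, ⟨_, h2⟩), ?_⟩
    ext (k | k) <;> rfl

theorem _root_.IsLDMap.defMapOn_cylinder {f : X × Icc (0 : R) 1 → E}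
    (hf : IsLDMap ((ofDefinable X hX).prod (unitSpace L R)) D f)
    {G : (Fin n → R) × R → E} (hG : ∀ z : X × Icc (0 : R) 1, G (z.1, z.2) = f z) :
    D.DefMapOn (X ×ˢ Icc (0 : R) 1) G ∧
      ∀ z ∈ X ×ˢ Icc (0 : R) 1, D.ContAt G (X ×ˢ Icc (0 : R) 1) z := by
  let G' : (Fin n ⊕ Unit → R) → E := fun c => G (c ∘ Sum.inl, c (Sum.inr ()))
  let φ : (Fin n → R) × R → Fin n ⊕ Unit → R := fun z => Sum.elim z.1 fun _ => z.2
  have h1 : D.DefMapOn {c : Fin n ⊕ Unit → R | c ∘ Sum.inl ∈ X ∧ 0 ≤ c (Sum.inr ()) ∧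
      c (Sum.inr ()) ≤ 1} G' := by
    rw [← range_cylinder_chart (L := L) hX]
    exact hf.defMapOn (D := (ofDefinable X hX).prod (unitSpace L R)) ((), ()) (fun _ => ⟨trivial, trivial⟩) hG
  have h2 : ∀ z : X × Icc (0 : R) 1, D.ContAt G' {c : Fin n ⊕ Unit → R | c ∘ Sum.inl ∈ X ∧
      0 ≤ c (Sum.inr ()) ∧ c (Sum.inr ()) ≤ 1} (φ (z.1, z.2)) := by
    rw [← range_cylinder_chart (L := L) hX]
    exact hf.contAt (D := (ofDefinable X hX).prod (unitSpace L R)) ((), ()) (fun _ => ⟨trivial, trivial⟩) hG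
  have hφ : DFun L R φ := by
    refine .pi ?_
    rintro (k | k)
    · exact .comp (g := fun c : Fin n → R => c k) (by fun_prop) (by fun_prop)
    · exact .snd .id
  have hX' : DPred L R (· ∈ X) := dPred_iff_isDefinable.2 hX
  refine ⟨h1.comp hφ (show DPred L R fun z : (Fin n → R) × R =>
    z.1 ∈ X ∧ 0 ≤ z.2 ∧ z.2 ≤ 1 by fun_prop) fun z hz => hz, fun z hz => ?_⟩
  refine (h2 (⟨z.1, hz.1⟩, ⟨z.2, hz.2⟩)).comp (φ := φ) (Continuous.continuousWithinAt ?_)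
    fun z hz => hz
  refine continuous_pi ?_
  rintro (k | k)
  · exact (continuous_apply k).comp continuous_fst
  · exact continuous_snd

theorem DefMapOn.isLDMap_cylinder {G : (Fin n → R) × R → E}
    (hd : D.DefMapOn (X ×ˢ Icc (0 : R) 1) G)
    (hc : ∀ z ∈ X ×ˢ Icc (0 : R) 1, D.ContAt G (X ×ˢ Icc (0 : R) 1) z) :
    IsLDMap ((ofDefinable X hX).prod (unitSpace L R)) D
      fun z : X × Icc (0 : R) 1 => G (z.1, z.2) := by
  let G' : (Fin n ⊕ Unit → R) → E := fun c => G (c ∘ Sum.inl, c (Sum.inr ()))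
  have hψ : DFun L R fun c : Fin n ⊕ Unit → R => (c ∘ Sum.inl, c (Sum.inr ())) :=
    .prodMk (.pi fun k => .apply (Sum.inl k)) (by fun_prop)
  have hX' : DPred L R (· ∈ X) := dPred_iff_isDefinable.2 hX
  have h1 : D.DefMapOn {c : Fin n ⊕ Unit → R | c ∘ Sum.inl ∈ X ∧ 0 ≤ c (Sum.inr ()) ∧
      c (Sum.inr ()) ≤ 1} G' :=
    hd.comp hψ ((show DPred L R fun z : (Fin n → R) × R =>
      z.1 ∈ X ∧ 0 ≤ z.2 ∧ z.2 ≤ 1 by fun_prop).comp hψ) fun z hz => hz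
  have h2 : ∀ z : X × Icc (0 : R) 1, D.ContAt G' {c : Fin n ⊕ Unit → R | c ∘ Sum.inl ∈ X ∧
      0 ≤ c (Sum.inr ()) ∧ c (Sum.inr ()) ≤ 1} (Sum.elim z.1.1 fun _ => z.2.1) := fun z =>
    (hc (z.1, z.2) ⟨z.1.2, z.2.2⟩).comp (φ := fun c : Fin n ⊕ Unit → R =>
      (c ∘ Sum.inl, c (Sum.inr ()))) (Continuous.continuousWithinAt (by fun_prop)) fun z hz => hz
  rw [← range_cylinder_chart (L := L) hX] at h1 h2
  exact h1.isLDMap (D := (ofDefinable X hX).prod (unitSpace L R)) ((), ()) (fun _ => rfl)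
    (fun _ => ⟨trivial, trivial⟩) (fun _ => rfl) h2

end Cylinder

theorem _root_.IsLDMap.of_isEmpty {M : Type*} [IsEmpty M] (D₀ : LocDefSpace L R M) (f : M → E) :
    IsLDMap D₀ D f := by
  refine ⟨?_, fun i => ⟨∅, by simp [Set.eq_empty_of_isEmpty], by simp⟩, fun i j => ?_⟩
  · let _ := D₀.topology
    let _ := D.topology
    exact continuous_of_discreteTopology
  · simp

theorem _root_.IsLDCovering.isFibration (hp : IsLDCovering p) : IsFibration p := by
  classical
  intro n X hX f H hfH
  -- A point of `X` is needed to extend `f` and `H` to the ambient space by irrelevant constants;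
  -- for empty `X` the total space might be empty too.
  rcases isEmpty_or_nonempty X with hX' | ⟨⟨x₀⟩⟩
  · exact ⟨⟨fun z => f z.1, .of_isEmpty _ _⟩, fun a => hX'.elim a, fun z => hX'.elim z.1⟩
  have : Nonempty E := ⟨f x₀⟩
  let f' : (Fin n → R) → E := fun a => if h : a ∈ X then f ⟨a, h⟩ else f x₀
  let H' : (Fin n → R) × R → B := fun z =>
    if h : z.1 ∈ X ∧ z.2 ∈ Icc (0 : R) 1 then H (⟨z.1, h.1⟩, ⟨z.2, h.2⟩) else p (f x₀)
  have hf' : ∀ a : X, f' a = f a := fun a => dif_pos a.2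
  have hH' : ∀ z : X × Icc (0 : R) 1, H' (z.1, z.2) = H z := fun z => dif_pos ⟨z.1.2, z.2.2⟩
  obtain ⟨h1, h2⟩ := f.isLDMap.defMapOn_definable hX hf'
  obtain ⟨h3, h4⟩ := H.isLDMap.defMapOn_cylinder hX hH'
  obtain ⟨G, h5, h6, h7, h8⟩ := hp.exists_lift (hasUniformFiniteness_pi (Fin n)) h3 h4 h1 h2
    (fun x hx => by
      rw [hf' ⟨x, hx⟩, ← hfH]
      exact (hH' (⟨x, hx⟩, 0)).symm)
  refine ⟨⟨_, h5.isLDMap_cylinder hX h6⟩, fun a => ?_, fun z => ?_⟩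
  · exact (h7 a a.2).trans (hf' a)
  · exact (h8 _ ⟨z.1.2, z.2.2⟩).trans (hH' z)

end LocDefSpace

/-! ### Ld-maps between cubes -/

section CubeMaps

universe x' y'

variable {L : FirstOrder.Language.{u, v}} {R : Type w} [L.Structure R] [TopologicalSpace R]
  [Field R] [LinearOrder R] [IsStrictOrderedRing R] [OrderTopology R] [IsOMinimalExpansion L R]
  {M : Type x} {D : LocDefSpace.{u, v, w, x, y} L R M}

theorem DFun.definableMap {κ κ' : Type} [Finite κ] [Finite κ'] {F : (κ → R) → κ' → R}
    (hF : DFun L R F) : (Set.univ : Set R).DefinableMap L F := fun i => hF.coord i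

theorem IsLDMap.of_cube {m n : ℕ} {f : Cube R m → Cube R n} {F : (Fin m → R) → Fin n → R}
    (hc : Continuous F) (hd : DFun L R F) (hf : ∀ a, (f a).1 = F a.1) :
    IsLDMap (cubeSpace L R m) (cubeSpace L R n) f :=
  IsLDMap.of_charts fun _ => ⟨(), F, hc, hd.definableMap, fun a _ => ⟨trivial, hf a⟩⟩

theorem IsLDMap.of_cylinder {m n : ℕ} {f : Cube R m × Icc (0 : R) 1 → Cube R n}
    {F : (Fin m → R) × R → Fin n → R} (hc : Continuous F) (hd : DFun L R F)
    (hf : ∀ z, (f z).1 = F (z.1, z.2)) :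
    IsLDMap ((cubeSpace L R m).prod (unitSpace L R)) (cubeSpace L R n) f := by
  have h : DFun L R fun c : Fin m ⊕ Unit → R => F (c ∘ Sum.inl, c (Sum.inr ())) :=
    hd.comp (.prodMk (.pi fun k => .apply (Sum.inl k)) (.apply (Sum.inr ())))
  refine IsLDMap.of_charts fun _ => ⟨(), fun c : Fin m ⊕ Unit → R =>
    F (c ∘ Sum.inl, c (Sum.inr ())), hc.comp (by fun_prop), h.definableMap,
    fun z _ => ⟨trivial, hf z⟩⟩

theorem IsLDMap.to_cylinder {m n : ℕ} {f : Cube R m → Cube R n × Icc (0 : R) 1}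
    {F : (Fin m → R) → Fin n → R} {s : (Fin m → R) → R} (hc : Continuous F) (hd : DFun L R F)
    (hsc : Continuous s) (hsd : DFun L R s) (hf : ∀ a, (f a).1.1 = F a.1)
    (hfs : ∀ a, (f a).2.1 = s a.1) :
    IsLDMap (cubeSpace L R m) ((cubeSpace L R n).prod (unitSpace L R)) f := by
  have h : DFun L R fun c : Fin m → R => (Sum.elim (F c) fun _ => s c : Fin n ⊕ Unit → R) := by
    refine .pi ?_
    rintro (k | k)
    · exact .comp (g := fun c : Fin n → R => c k) (by fun_prop) hd
    · exact hsd
  refine IsLDMap.of_charts fun _ => ⟨((), ()), fun c : Fin m → R =>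
    (Sum.elim (F c) fun _ => s c : Fin n ⊕ Unit → R), ?_, h.definableMap,
    fun a _ => ⟨⟨trivial, trivial⟩, ?_⟩⟩
  · refine continuous_pi ?_
    rintro (k | k)
    · exact (continuous_apply k).comp hc
    · exact hsc
  · change Sum.elim (f a).1.1 (fun _ => (f a).2.1) = Sum.elim (F a.1) fun _ => s a.1
    rw [hf, hfs]

theorem isLDMap_const {N : Type x'} (D₀ : LocDefSpace.{u, v, w, x', y'} L R N) (m : M) :
    IsLDMap D₀ D fun _ => m := by
  obtain ⟨j, hj⟩ := D.covers m
  exact IsLDMap.of_charts fun _ => ⟨j, fun _ => D.chart j m, continuous_const,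
    fun _ => definableFun_const' _, fun _ _ => ⟨hj, rfl⟩⟩

theorem IsLDMap.glue_cube {n : ℕ} {f g : Cube R n → M} (hf : IsLDMap (cubeSpace L R n) D f)
    (hg : IsLDMap (cubeSpace L R n) D g) {ρ : (Fin n → R) → R} (hc : Continuous ρ)
    (hd : DFun L R ρ) (b : R) (h : ∀ a, ρ a.1 = b → f a = g a) :
    IsLDMap (cubeSpace L R n) D fun a => if ρ a.1 ≤ b then f a else g a := by
  classical
  have key := IsLDMap.glue (S := {a : Cube R n | ρ a.1 ≤ b}) (T := {a : Cube R n | b ≤ ρ a.1}) hf hg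
    (@IsClosed.mk _ (cubeSpace L R n).topology _ fun _ =>
      ⟨{c | b < ρ c}, isOpen_lt continuous_const hc, fun a _ => by
        change ¬ ρ a.1 ≤ b ↔ b < ρ a.1
        exact not_le⟩)
    (@IsClosed.mk _ (cubeSpace L R n).topology _ fun _ =>
      ⟨{c | ρ c < b}, isOpen_lt hc continuous_const, fun a _ => by
        change ¬ b ≤ ρ a.1 ↔ ρ a.1 < b
        exact not_le⟩) (by
      ext a
      simpa using le_total (ρ a.1) b) (fun _ => by
      have h1 : DPred L R (· ∈ Cube R n) := dPred_iff_isDefinable.2 (isDefinable_cube L R n)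
      have h2 : DPred L R fun c : Fin n → R => c ∈ Cube R n ∧ ρ c ≤ b := by fun_prop
      refine dPred_iff_isDefinable.1 (h2.congr fun c => ?_)
      constructor
      · rintro ⟨a, ⟨-, ha⟩, rfl⟩
        exact ⟨a.2, ha⟩
      · rintro ⟨h3, h4⟩
        exact ⟨⟨c, h3⟩, ⟨trivial, h4⟩, rfl⟩)
    (fun a h1 h2 => h a (le_antisymm h1 h2))
  convert! key using 1
  funext a
  by_cases h : ρ a.1 ≤ b <;> simp [h]

end CubeMaps

/-! ### Lifting relative to a box -/

section Box

variable {R : Type w} [Field R] [LinearOrder R] {n : ℕ}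

/-- The union of the faces of the cube other than the face `c i₀ = 0`. -/
def openBox (i₀ : Fin n) : Set (Fin n → R) := {c | ∃ i, c i = 1 ∨ (c i = 0 ∧ i ≠ i₀)}

/-- The gauge of the box that is obtained by reflecting the cube in the face `c i₀ = 0` and
enlarging it, as seen from the point with coordinate `-1` at `i₀` and `1/2` elsewhere. -/
def boxGauge (i₀ : Fin n) (c : Fin n → R) : R :=
  Finset.univ.sup' ⟨i₀, Finset.mem_univ i₀⟩ fun i =>
    if i = i₀ then (c i + 1) / 2 else 2 * |c i - 1 / 2|

/-- The factor by which the central projection contracts. -/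
def boxScale (i₀ : Fin n) (z : (Fin n → R) × R) : R :=
  max (1 / 2) (min 1 (boxGauge i₀ z.1 + z.2))

/-- The central projection of the cube to the union of all faces but one, slowed down. -/
def boxPush (i₀ : Fin n) (z : (Fin n → R) × R) (i : Fin n) : R :=
  if i = i₀ then (z.1 i + 1) / boxScale i₀ z - 1 else (z.1 i - 1 / 2) / boxScale i₀ z + 1 / 2

variable [IsStrictOrderedRing R] {i₀ : Fin n} {c : Fin n → R}

/-- The coordinate at `i₀` is at distance at least `1` from that of the centre, which is `-1`. On
the cube the cut-off at `1 / 2` in `boxScale` is therefore inactive; it only avoids division by zero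
elsewhere. -/
theorem half_le_boxGauge (hc : c ∈ Cube R n) : 1 / 2 ≤ boxGauge i₀ c := by
  refine le_trans ?_ (Finset.le_sup' _ (Finset.mem_univ i₀))
  have := hc.1 i₀
  simp only [if_true, Pi.zero_apply] at this ⊢
  linarith

theorem boxGauge_le_one (hc : c ∈ Cube R n) : boxGauge i₀ c ≤ 1 := by
  refine Finset.sup'_le _ _ fun i _ => ?_
  have h1 := hc.1 i
  have h2 := hc.2 i
  simp only [Pi.zero_apply, Pi.one_apply] at h1 h2
  split_ifs
  · linarith
  · have : |c i - 1 / 2| ≤ 1 / 2 := abs_le.2 ⟨by linarith, by linarith⟩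
    linarith

theorem boxGauge_eq_one (hc : c ∈ Cube R n) (hJ : c ∈ openBox i₀) : boxGauge i₀ c = 1 := by
  refine le_antisymm (boxGauge_le_one hc) ?_
  obtain ⟨i, hi⟩ := hJ
  refine le_trans ?_ (Finset.le_sup' _ (Finset.mem_univ i))
  rcases hi with hi | ⟨hi, hne⟩
  · rw [hi]
    split_ifs
    · norm_num
    · rw [abs_of_nonneg (by norm_num)]
      norm_num
  · rw [hi, if_neg hne, abs_of_nonpos (by norm_num)]
    norm_num

theorem boxScale_bounds (hc : c ∈ Cube R n) {t : R} (ht : 0 ≤ t) :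
    boxGauge i₀ c ≤ boxScale i₀ (c, t) ∧ boxScale i₀ (c, t) ≤ 1 ∧ 0 < boxScale i₀ (c, t) := by
  refine ⟨le_max_of_le_right (le_min (boxGauge_le_one hc) (by simpa using ht)),
    max_le (by norm_num) (min_le_left _ _), lt_max_of_lt_left (by norm_num)⟩

theorem boxPush_mem (hc : c ∈ Cube R n) {t : R} (ht : 0 ≤ t) : boxPush i₀ (c, t) ∈ Cube R n := by
  obtain ⟨h1, h2, h3⟩ := boxScale_bounds (i₀ := i₀) hc ht
  have key : ∀ i, 0 ≤ boxPush i₀ (c, t) i ∧ boxPush i₀ (c, t) i ≤ 1 := by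
    intro i
    have h4 := (Finset.le_sup' (fun i => if i = i₀ then (c i + 1) / 2 else 2 * |c i - 1 / 2|)
      (Finset.mem_univ i)).trans h1
    have h5 := hc.1 i
    simp only [Pi.zero_apply] at h5
    unfold boxPush
    split_ifs with hi
    · rw [if_pos hi] at h4
      constructor
      · rw [sub_nonneg, le_div_iff₀ h3]
        linarith
      · rw [sub_le_iff_le_add, div_le_iff₀ h3]
        linarith
    · rw [if_neg hi] at h4
      have h6 := abs_le.1 (show |c i - 1 / 2| ≤ boxScale i₀ (c, t) / 2 by linarith)
      have h7 : -(1 / 2) ≤ (c i - 1 / 2) / boxScale i₀ (c, t) := by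
        rw [le_div_iff₀ h3]
        linarith
      have h8 : (c i - 1 / 2) / boxScale i₀ (c, t) ≤ 1 / 2 := by
        rw [div_le_iff₀ h3]
        linarith
      constructor <;> linarith
  exact ⟨fun i => (key i).1, fun i => (key i).2⟩

/-- At time `0` the displacement from the centre is divided by the gauge, so a coordinate that
attains the maximum lands on a face: on `c i₀ = 1` if the index is `i₀`, on one of the two opposite
faces otherwise. -/
theorem boxPush_zero_mem (hc : c ∈ Cube R n) : boxPush i₀ (c, 0) ∈ openBox i₀ := by
  have hg := half_le_boxGauge (i₀ := i₀) hc
  have hs : boxScale i₀ (c, 0) = boxGauge i₀ c := by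
    rw [boxScale, add_zero, min_eq_right (boxGauge_le_one hc), max_eq_right hg]
  have hpos : 0 < boxGauge i₀ c := lt_of_lt_of_le (by norm_num) hg
  obtain ⟨i, -, hi⟩ := Finset.exists_mem_eq_sup' ⟨i₀, Finset.mem_univ i₀⟩
    fun i => if i = i₀ then (c i + 1) / 2 else 2 * |c i - 1 / 2|
  change boxGauge i₀ c = _ at hi
  refine ⟨i, ?_⟩
  unfold boxPush
  rw [hs]
  split_ifs at hi ⊢ with h
  · left
    rw [show c i + 1 = 2 * boxGauge i₀ c by linarith, mul_div_cancel_right₀ _ hpos.ne']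
    norm_num
  · rcases le_total 0 (c i - 1 / 2) with h' | h'
    · left
      rw [abs_of_nonneg h'] at hi
      rw [show c i - 1 / 2 = 1 / 2 * boxGauge i₀ c by linarith, mul_div_cancel_right₀ _ hpos.ne']
      norm_num
    · right
      rw [abs_of_nonpos h'] at hi
      rw [show c i - 1 / 2 = -(1 / 2) * boxGauge i₀ c by linarith, mul_div_cancel_right₀ _ hpos.ne']
      exact ⟨by norm_num, h⟩

-- At time `1 - boxGauge i₀ c` the scale has grown to `1`, and the projection has become the
-- identity at `c`.
variable (i₀ c) in
theorem boxPush_eq : boxPush i₀ (c, 1 - boxGauge i₀ c) = c := by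
  have hs : boxScale i₀ (c, 1 - boxGauge i₀ c) = 1 := by
    rw [boxScale, add_sub_cancel, min_self, max_eq_right (by norm_num)]
  funext i
  unfold boxPush
  rw [hs]
  split_ifs <;> simp

theorem boxPush_zero_eq (hc : c ∈ Cube R n) (hJ : c ∈ openBox i₀) : boxPush i₀ (c, 0) = c := by
  have := boxPush_eq i₀ c
  rwa [boxGauge_eq_one hc hJ, sub_self] at this

section Topology

variable [TopologicalSpace R] [OrderTopology R]

theorem continuous_boxGauge : Continuous (boxGauge i₀ : (Fin n → R) → R) := by
  refine Continuous.finset_sup'_apply _ fun i _ => ?_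
  split_ifs
  · exact ((continuous_apply i).add continuous_const).div_const _
  · exact continuous_const.mul ((continuous_apply i).sub continuous_const).abs

theorem continuous_boxPush : Continuous (boxPush i₀ : (Fin n → R) × R → Fin n → R) := by
  have hg : Continuous (boxScale i₀ : (Fin n → R) × R → R) :=
    continuous_const.max (continuous_const.min
      ((continuous_boxGauge.comp continuous_fst).add continuous_snd))
  have hpos : ∀ z : (Fin n → R) × R, boxScale i₀ z ≠ 0 := fun z =>
    (lt_max_of_lt_left (by norm_num : (0 : R) < 1 / 2)).ne'
  refine continuous_pi fun i => ?_
  have hi : Continuous fun z : (Fin n → R) × R => z.1 i := (continuous_apply i).comp continuous_fst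
  unfold boxPush
  split_ifs
  · exact ((hi.add continuous_const).div hg hpos).sub continuous_const
  · exact ((hi.sub continuous_const).div hg hpos).add continuous_const

variable {L : FirstOrder.Language.{u, v}} [L.Structure R] [IsOMinimalExpansion L R]

theorem dFun_boxGauge : DFun L R (boxGauge i₀ : (Fin n → R) → R) := by
  let w : Fin n → (Fin n → R) → R := fun i c => if i = i₀ then (c i + 1) / 2 else 2 * |c i - 1 / 2|
  have hw : ∀ i, DFun L R (w i) := by
    intro i
    by_cases h : i = i₀
    · simp only [w, h, if_true]
      fun_prop
    · simp only [w, h, if_false]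
      fun_prop
  have h1 : DPred L R fun z : (Fin n → R) × R => (∀ i, w i z.1 ≤ z.2) ∧ ∃ i, z.2 = w i z.1 := by
    refine .and (.forall_finite fun i => ?_) (.exists_finite fun i => ?_)
    · have := hw i
      fun_prop
    · have := hw i
      fun_prop
  refine h1.congr fun z => ?_
  constructor
  · intro h
    rw [h]
    refine ⟨fun i => Finset.le_sup' (fun i => w i z.1) (Finset.mem_univ i), ?_⟩
    obtain ⟨i, -, hi⟩ := Finset.exists_mem_eq_sup' ⟨i₀, Finset.mem_univ i₀⟩ fun i => w i z.1
    exact ⟨i, hi⟩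
  · rintro ⟨h, i, hi⟩
    refine le_antisymm ?_ (Finset.sup'_le _ _ fun i _ => h i)
    rw [hi]
    exact Finset.le_sup' (fun i => w i z.1) (Finset.mem_univ i)

theorem dFun_boxPush : DFun L R (boxPush i₀ : (Fin n → R) × R → Fin n → R) := by
  have hg : DFun L R (boxScale i₀ : (Fin n → R) × R → R) := by
    have := dFun_boxGauge (L := L) (R := R) (i₀ := i₀)
    unfold boxScale
    fun_prop
  refine .pi fun i => ?_
  have hi : DFun L R fun z : (Fin n → R) × R => z.1 i :=
    .comp (g := fun c : Fin n → R => c i) (by fun_prop) (by fun_prop)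
  unfold boxPush
  split_ifs
  · fun_prop
  · fun_prop

variable (i₀) in
/-- The retraction of the cube to the union of all faces but one. -/
def boxRetract (a : Cube R n) : Cube R n := ⟨boxPush i₀ (a.1, 0), boxPush_mem a.2 le_rfl⟩

theorem boxRetract_mem (a : Cube R n) : (boxRetract i₀ a).1 ∈ openBox i₀ := boxPush_zero_mem a.2

theorem boxRetract_eq {a : Cube R n} (ha : a.1 ∈ openBox i₀) : boxRetract i₀ a = a :=
  Subtype.ext (boxPush_zero_eq a.2 ha)

theorem isLDMap_boxRetract : IsLDMap (cubeSpace L R n) (cubeSpace L R n) (boxRetract i₀) := by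
  have := dFun_boxPush (L := L) (R := R) (i₀ := i₀)
  exact .of_cube (F := fun c => boxPush i₀ (c, 0)) (continuous_boxPush.comp (by fun_prop))
    (by fun_prop) fun _ => rfl

universe x' y'

variable {E : Type x} {B : Type x'} {D : LocDefSpace.{u, v, w, x, y} L R E}
  {D' : LocDefSpace.{u, v, w, x', y'} L R B}

/-- A map of the cube can be lifted with prescribed values on all faces but one. -/
theorem HasHomotopyLifting.exists_box_lift {p : LDMap D D'}
    (hp : HasHomotopyLifting p (Cube R n) (isDefinable_cube L R n))
    (i₀ : Fin n) (K : LDMap (cubeSpace L R n) D') (q : LDMap (cubeSpace L R n) D)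
    (hq : ∀ a, p (q a) = K (boxRetract i₀ a)) :
    ∃ G : LDMap (cubeSpace L R n) D, (∀ a, p (G a) = K a) ∧
      ∀ a : Cube R n, a.1 ∈ openBox i₀ → G a = q a := by
  let h : Cube R n × Icc (0 : R) 1 → Cube R n := fun z =>
    ⟨boxPush i₀ (z.1, z.2), boxPush_mem z.1.2 z.2.2.1⟩
  have hh : IsLDMap ((cubeSpace L R n).prod (unitSpace L R)) (cubeSpace L R n) h :=
    .of_cylinder continuous_boxPush dFun_boxPush fun _ => rfl
  obtain ⟨G, hG0, hG⟩ := hp q ⟨_, K.isLDMap.comp hh⟩ fun a => (hq a).symm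
  -- The lifted homotopy is evaluated over `a` at the time when the push has returned to `a`, so the
  -- result lies over `K`. On the prescribed faces that time is `0`, where the lift is `q`.
  have hlo : ∀ a : Cube R n, 1 - boxGauge i₀ a.1 ∈ Icc (0 : R) 1 := fun a =>
    ⟨by linarith [boxGauge_le_one (i₀ := i₀) a.2], by linarith [half_le_boxGauge (i₀ := i₀) a.2]⟩
  let j : Cube R n → Cube R n × Icc (0 : R) 1 := fun a => (a, ⟨_, hlo a⟩)
  have hj : IsLDMap (cubeSpace L R n) ((cubeSpace L R n).prod (unitSpace L R)) j := by
    have := dFun_boxGauge (L := L) (R := R) (i₀ := i₀)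
    exact .to_cylinder (F := fun c => c) (s := fun c => 1 - boxGauge i₀ c) continuous_id .id
      (continuous_const.sub continuous_boxGauge) (by fun_prop) (fun _ => rfl) fun _ => rfl
  refine ⟨⟨_, G.isLDMap.comp hj⟩, fun a => ?_, fun a ha => ?_⟩
  · refine (hG (j a)).trans ?_
    change K (h (j a)) = K a
    congr 1
    exact Subtype.ext (boxPush_eq i₀ a.1)
  · refine Eq.trans ?_ (hG0 a)
    have h0 : (⟨_, hlo a⟩ : Icc (0 : R) 1) = 0 :=
      Subtype.ext (show 1 - boxGauge i₀ a.1 = 0 by rw [boxGauge_eq_one a.2 ha, sub_self])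
    change G (a, ⟨_, hlo a⟩) = G (a, 0)
    rw [h0]

end Topology

end Box

/-! ### Application to homotopy groups -/

section Homotopy

universe x' y' z z'

variable {L : FirstOrder.Language.{u, v}} {R : Type w} [L.Structure R] [TopologicalSpace R]
  [Field R] [LinearOrder R] [IsStrictOrderedRing R] [OrderTopology R] [IsOMinimalExpansion L R]
  {E : Type x} {B : Type x'} {D : LocDefSpace.{u, v, w, x, y} L R E}
  {D' : LocDefSpace.{u, v, w, x', y'} L R B} {p : LDMap D D'}

variable {n : ℕ}

/-! ### Generalities on homotopy sets -/

theorem SystemMap.homotopic_of_eq {M : Type*} {D₀ : LocDefSpace L R M} {κ : Type*}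
    {A : κ → Set M} {C : κ → Set E} {f g : SystemMap D₀ D A C}
    (h : ∀ m, f.toLDMap m = g.toLDMap m) : f.Homotopic g := by
  obtain ⟨H, h0, h1, hH⟩ := f.homotopic_refl
  exact ⟨H, h0, fun m => (h1 m).trans (h m), hH⟩

theorem HomotopySet.map_concat {κ : Type z} {κ' : Type z'} {A : κ → Set (Cube R (n + 1))}
    {C : κ → Set E} {A' : κ' → Set (Cube R (n + 1))} {C' : κ' → Set B} {e : E} {b : B}
    (hl : IsLoopSystem A C e) (hl' : IsLoopSystem A' C' b)
    (hp : ∀ F : Cube R (n + 1) → E, (∀ k, ∀ m ∈ A k, F m ∈ C k) →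
      ∀ k, ∀ m ∈ A' k, p (F m) ∈ C' k)
    (f g : SystemMap (cubeSpace L R (n + 1)) D A C) :
    HomotopySet.map p hp (Quotient.mk _ (concat hl f g)) =
      Quotient.mk (SystemMap.setoid _ _ _ _) (concat hl'
        ⟨p.comp f.toLDMap, hp f.toLDMap f.mapsTo⟩ ⟨p.comp g.toLDMap, hp g.toLDMap g.mapsTo⟩) := by
  refine Quotient.sound (SystemMap.homotopic_of_eq fun a => ?_)
  change p (if (getFirst a : R) ≤ 2⁻¹ then f.toLDMap (setFirst a (stretchL (getFirst a)))
    else g.toLDMap (setFirst a (stretchR (getFirst a)))) =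
    if (getFirst a : R) ≤ 2⁻¹ then p (f.toLDMap (setFirst a (stretchL (getFirst a))))
    else p (g.toLDMap (setFirst a (stretchR (getFirst a))))
  split_ifs <;> rfl

theorem RelHomotopyPi.map_mul (p : LDMap D D') (b₀ : B) (e₀ : p ⁻¹' {b₀})
    (c d : RelHomotopyPi D (n + 2) (p ⁻¹' {b₀}) e₀) :
    RelHomotopyPi.map (n + 2) p b₀ e₀ (c * d) =
      RelHomotopyPi.map (n + 2) p b₀ e₀ c * RelHomotopyPi.map (n + 2) p b₀ e₀ d := by
  induction c using Quotient.inductionOn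
  induction d using Quotient.inductionOn
  exact HomotopySet.map_concat (isLoopSystem_relative n _ _ e₀.2) (isLoopSystem_absolute _ b₀) _ _ _

theorem HomotopyPi.map_mul (p : LDMap D D') {e₀ : E} {b₀ : B} (h : p e₀ = b₀)
    (c d : HomotopyPi D (n + 1) e₀) :
    HomotopyPi.map (n + 1) p h (c * d) =
      HomotopyPi.map (n + 1) p h c * HomotopyPi.map (n + 1) p h d := by
  induction c using Quotient.inductionOn
  induction d using Quotient.inductionOn
  exact HomotopySet.map_concat (isLoopSystem_absolute _ e₀) (isLoopSystem_absolute _ b₀) _ _ _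

theorem isClosed_cube (n : ℕ) : IsClosed (Cube R n) := isClosed_Icc

theorem IsSerreFibration.hasHomotopyLifting_cube (hp : IsSerreFibration p) (n : ℕ) :
    HasHomotopyLifting p (Cube R n) (isDefinable_cube L R n) := by
  refine hp n _ _ (isClosed_cube n) ⟨1, fun a ha i => ?_⟩
  have h1 := ha.1 i
  have h2 := ha.2 i
  simp only [Pi.zero_apply, Pi.one_apply] at h1 h2
  exact abs_le.2 ⟨by linarith, h2⟩

/-! ### The relative homotopy groups of a Serre fibration -/

theorem mem_cubeJ_iff {a : Cube R (n + 1)} : a ∈ cubeJ R (n + 1) ↔ a.1 ∈ openBox (Fin.last n) := by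
  refine exists_congr fun i => or_congr_right (and_congr_right fun _ => not_congr ?_)
  rw [Fin.ext_iff, Fin.val_last]
  omega

theorem cubeJ_subset_boundary : cubeJ R n ⊆ cubeBoundary R n := by
  rintro a ⟨i, hi | hi⟩
  · exact ⟨i, Or.inr hi⟩
  · exact ⟨i, Or.inl hi.1⟩

theorem cubeFace_subset_boundary : cubeFace R (n + 1) ⊆ cubeBoundary R (n + 1) :=
  fun _ ha => ⟨Fin.last n, Or.inl (ha _ rfl)⟩

/-- The retraction maps the cube into `J`, on which `f` is constant, so the constant map at `e₀` is
an admissible prescription in `exists_box_lift`. -/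
theorem exists_lift_of_boundary
    (hp : HasHomotopyLifting p (Cube R (n + 1)) (isDefinable_cube L R (n + 1))) {e₀ : E} {b₀ : B}
    (he : p e₀ = b₀) (f : LDMap (cubeSpace L R (n + 1)) D')
    (hf : ∀ a ∈ cubeBoundary R (n + 1), f a = b₀) :
    ∃ G : LDMap (cubeSpace L R (n + 1)) D, (∀ a, p (G a) = f a) ∧
      ∀ a ∈ cubeJ R (n + 1), G a = e₀ := by
  obtain ⟨G, hG, hG'⟩ := hp.exists_box_lift (Fin.last n) f ⟨fun _ => e₀, isLDMap_const _ e₀⟩ (by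
    intro a
    rw [hf _ (cubeJ_subset_boundary (mem_cubeJ_iff.2 (boxRetract_mem a)))]
    exact he)
  exact ⟨G, hG, fun a ha => hG' a (mem_cubeJ_iff.1 ha)⟩

theorem RelHomotopyPi.map_surjective
    (hp : HasHomotopyLifting p (Cube R (n + 1)) (isDefinable_cube L R (n + 1))) (b₀ : B)
    (e₀ : p ⁻¹' {b₀}) : Function.Surjective (RelHomotopyPi.map (n + 1) p b₀ e₀) := by
  intro c
  induction c using Quotient.inductionOn with
  | _ f =>
  obtain ⟨G, hG, hGJ⟩ := exists_lift_of_boundary hp e₀.2 f.toLDMap fun a ha => f.mapsTo () a ha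
  refine ⟨Quotient.mk _ ⟨G, fun k a ha => ?_⟩, Quotient.sound (SystemMap.homotopic_of_eq hG)⟩
  fin_cases k
  · change p (G a) = b₀
    rw [hG]
    exact f.mapsTo () a (cubeFace_subset_boundary ha)
  · exact hGJ a ha

/-- Drop the last coordinate of a point of the cube. -/
def cubeInit (a : Cube R (n + 1)) : Cube R n :=
  ⟨Fin.init a.1, fun i => a.2.1 i.castSucc, fun i => a.2.2 i.castSucc⟩

/-- The last coordinate of a point of the cube. -/
def cubeLast (a : Cube R (n + 1)) : Icc (0 : R) 1 :=
  ⟨a.1 (Fin.last n), a.2.1 (Fin.last n), a.2.2 (Fin.last n)⟩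

/-- Append a last coordinate to a point of the cube. -/
def cubeSnoc (z : Cube R n × Icc (0 : R) 1) : Cube R (n + 1) :=
  ⟨Fin.snoc (α := fun _ => R) z.1.1 z.2, fun i => by
      refine Fin.lastCases ?_ (fun i => ?_) i
      · simpa using z.2.2.1
      · simpa using z.1.2.1 i, fun i => by
      refine Fin.lastCases ?_ (fun i => ?_) i
      · simpa using z.2.2.2
      · simpa using z.1.2.2 i⟩

@[simp] theorem cubeInit_snoc (z : Cube R n × Icc (0 : R) 1) : cubeInit (cubeSnoc z) = z.1 :=
  Subtype.ext (Fin.init_snoc (α := fun _ => R) _ _)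

@[simp] theorem cubeLast_snoc (z : Cube R n × Icc (0 : R) 1) : cubeLast (cubeSnoc z) = z.2 :=
  Subtype.ext (Fin.snoc_last (α := fun _ => R) _ _)

theorem isLDMap_cubeInit : IsLDMap (cubeSpace L R (n + 1)) (cubeSpace L R n) cubeInit :=
  .of_cube (F := fun c i => c i.castSucc) (by fun_prop) (.pi fun i => .apply _) fun _ => rfl

theorem isLDMap_cubeInit_last : IsLDMap (cubeSpace L R (n + 1))
    ((cubeSpace L R n).prod (unitSpace L R)) fun a => (cubeInit a, cubeLast a) :=
  .to_cylinder (F := fun c i => c i.castSucc) (s := fun c => c (Fin.last n)) (by fun_prop)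
    (.pi fun i => .apply _) (by fun_prop) (.apply _) (fun _ => rfl) fun _ => rfl

theorem isLDMap_cubeSnoc :
    IsLDMap ((cubeSpace L R n).prod (unitSpace L R)) (cubeSpace L R (n + 1)) cubeSnoc := by
  refine .of_cylinder (F := fun z => Fin.snoc (α := fun _ => R) z.1 z.2)
    (continuous_pi fun i => ?_) (.pi fun i => ?_) fun _ => rfl
  · refine Fin.lastCases ?_ (fun i => ?_) i
    · simpa using continuous_snd
    · simpa [Function.comp_def] using (continuous_apply i).comp continuous_fst
  · refine Fin.lastCases ?_ (fun i => ?_) i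
    · simpa using DFun.snd DFun.id
    · simpa using DFun.comp (g := fun c : Fin n → R => c i) (.apply i) (DFun.fst DFun.id)

/-- With the last coordinate as time, the omitted face is `I^n × I`, on which a homotopy of triples
need only stay in the fibre. The other faces are the two ends and `J × I`, where its values are
prescribed. -/
theorem mem_openBox_castSucc_iff {a : Cube R (n + 2)} :
    a.1 ∈ openBox (Fin.castSucc (Fin.last n)) ↔
      cubeLast a = 0 ∨ cubeLast a = 1 ∨ cubeInit a ∈ cubeJ R (n + 1) := by
  rw [mem_cubeJ_iff, Subtype.ext_iff, Subtype.ext_iff]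
  change _ ↔ a.1 (Fin.last (n + 1)) = 0 ∨ a.1 (Fin.last (n + 1)) = 1 ∨
    ∃ i : Fin (n + 1), a.1 i.castSucc = 1 ∨ (a.1 i.castSucc = 0 ∧ i ≠ Fin.last n)
  constructor
  · rintro ⟨i, hi⟩
    revert hi
    refine Fin.lastCases (fun hi => ?_) (fun i hi => ?_) i
    · rcases hi with hi | hi
      · exact Or.inr (Or.inl hi)
      · exact Or.inl hi.1
    · refine Or.inr (Or.inr ⟨i, hi.imp_right fun h => ⟨h.1, fun h' => h.2 (by rw [h'])⟩⟩)
  · rintro (h | h | ⟨i, h⟩)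
    · exact ⟨Fin.last (n + 1), Or.inr ⟨h, (Fin.castSucc_lt_last _).ne'⟩⟩
    · exact ⟨Fin.last (n + 1), Or.inl h⟩
    · exact ⟨i.castSucc, h.imp_right fun h => ⟨h.1, fun h' =>
        h.2 (Fin.castSucc_injective _ h')⟩⟩

/-- The homotopy downstairs is a map on a cube of one dimension more. It is lifted with the two
given maps at its ends and `e₀` on `J × I`; over the omitted face the lift lies in the fibre
automatically. -/
theorem RelHomotopyPi.map_injective
    (hp : HasHomotopyLifting p (Cube R (n + 2)) (isDefinable_cube L R (n + 2))) (b₀ : B)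
    (e₀ : p ⁻¹' {b₀}) : Function.Injective (RelHomotopyPi.map (n + 1) p b₀ e₀) := by
  intro c d hcd
  induction c using Quotient.inductionOn with
  | _ f₀ =>
  induction d using Quotient.inductionOn with
  | _ f₁ =>
  obtain ⟨H, h0, h1, hH⟩ := Quotient.exact hcd
  have hJ₀ : ∀ a ∈ cubeJ R (n + 1), f₀.toLDMap a = e₀ := fun a ha => f₀.mapsTo 1 a ha
  have hJ₁ : ∀ a ∈ cubeJ R (n + 1), f₁.toLDMap a = e₀ := fun a ha => f₁.mapsTo 1 a ha
  let i₀ : Fin (n + 2) := Fin.castSucc (Fin.last n)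
  let r : Cube R (n + 2) → Cube R (n + 2) := boxRetract i₀
  have hr : IsLDMap (cubeSpace L R (n + 2)) (cubeSpace L R (n + 2)) r := isLDMap_boxRetract
  have hρ : DFun L R fun c : Fin (n + 2) → R => boxPush i₀ (c, 0) (Fin.last (n + 1)) := by
    have := dFun_boxPush (L := L) (R := R) (i₀ := i₀)
    exact DFun.comp (g := fun c : Fin (n + 2) → R => c (Fin.last (n + 1))) (.apply _)
      (by fun_prop)
  have hρc : Continuous fun c : Fin (n + 2) → R => boxPush i₀ (c, 0) (Fin.last (n + 1)) :=
    (continuous_apply (Fin.last (n + 1))).comp ((continuous_boxPush (i₀ := i₀)).comp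
      (by fun_prop : Continuous fun c : Fin (n + 2) → R => (c, (0 : R))))
  -- The prescribed values are pulled back to the whole cube by the retraction and glued along time
  -- `1/2` of the retracted point. At that time the point is on neither end, so it lies in `J × I`,
  -- where both maps are `e₀`.
  have hq := IsLDMap.glue_cube (f₀.toLDMap.isLDMap.comp (isLDMap_cubeInit.comp hr))
    (f₁.toLDMap.isLDMap.comp (isLDMap_cubeInit.comp hr))
    (ρ := fun c => boxPush i₀ (c, 0) (Fin.last (n + 1)))
    hρc hρ 2⁻¹ (by
      intro a ha
      have ha' : (cubeLast (r a) : R) = 2⁻¹ := ha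
      have : cubeInit (r a) ∈ cubeJ R (n + 1) := by
        rcases mem_openBox_castSucc_iff.1 (boxRetract_mem a) with h | h | h
        · rw [h] at ha'
          norm_num at ha'
        · rw [h] at ha'
          norm_num at ha'
        · exact h
      exact (hJ₀ _ this).trans (hJ₁ _ this).symm)
  let q : LDMap (cubeSpace L R (n + 2)) D := ⟨_, hq⟩
  have hq' : ∀ a, q a = if (cubeLast (r a) : R) ≤ 2⁻¹ then f₀.toLDMap (cubeInit (r a))
      else f₁.toLDMap (cubeInit (r a)) := fun a => rfl
  let K : LDMap (cubeSpace L R (n + 2)) D' := ⟨_, H.isLDMap.comp isLDMap_cubeInit_last⟩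
  have hK : ∀ a, K a = H (cubeInit a, cubeLast a) := fun _ => rfl
  have hzero : ((0 : Icc (0 : R) 1) : R) ≤ 2⁻¹ := by norm_num
  have hone : ¬ ((1 : Icc (0 : R) 1) : R) ≤ 2⁻¹ := by norm_num
  obtain ⟨G, hG, hG'⟩ := hp.exists_box_lift i₀ K q (by
    intro a
    rw [hq', hK]
    change _ = H (cubeInit (r a), cubeLast (r a))
    rcases mem_openBox_castSucc_iff.1 (boxRetract_mem a) with h | h | h
    · change cubeLast (r a) = 0 at h
      rw [h, if_pos hzero, h0]
      rfl
    · change cubeLast (r a) = 1 at h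
      rw [h, if_neg hone, h1]
      rfl
    · change cubeInit (r a) ∈ _ at h
      rw [hJ₀ _ h, hJ₁ _ h, ite_self]
      exact e₀.2.trans (hH () _ (cubeJ_subset_boundary h) _).symm)
  have hbox : ∀ (a : Cube R (n + 1)) (t : Icc (0 : R) 1), t = 0 ∨ t = 1 ∨ a ∈ cubeJ R (n + 1) →
      G (cubeSnoc (a, t)) = if (t : R) ≤ 2⁻¹ then f₀.toLDMap a else f₁.toLDMap a := by
    intro a t h
    have hm : (cubeSnoc (a, t)).1 ∈ openBox i₀ := mem_openBox_castSucc_iff.2 (by simpa using h)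
    rw [hG' _ hm, hq', show r (cubeSnoc (a, t)) = _ from boxRetract_eq hm, cubeInit_snoc,
      cubeLast_snoc]
  refine Quotient.sound ⟨⟨_, G.isLDMap.comp isLDMap_cubeSnoc⟩, fun a => ?_, fun a => ?_,
    fun k a ha t => ?_⟩
  · exact (hbox a 0 (Or.inl rfl)).trans (if_pos hzero)
  · exact (hbox a 1 (Or.inr (Or.inl rfl))).trans (if_neg hone)
  · fin_cases k
    · change p (G (cubeSnoc (a, t))) = b₀
      rw [hG, hK, cubeInit_snoc, cubeLast_snoc]
      exact hH () a (cubeFace_subset_boundary ha) t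
    · refine (hbox a t (Or.inr (Or.inr ha))).trans ?_
      rw [hJ₀ a ha, hJ₁ a ha, ite_self]

/-! ### Unique lifting for coverings -/

/-- The cube is convex, so any two points are joined by a segment, the image of the connected
interval `[0, 1]`. -/
theorem dConn_cube (n : ℕ) : DConn L R (Cube R n) := by
  intro U hU h1 h2 a ha b hb haU
  let γ : R → Fin n → R := fun t i => a i + t * (b i - a i)
  have hγ : Continuous γ := by fun_prop
  have hγd : DFun L R γ := .pi fun i => by fun_prop
  have hmem : ∀ t ∈ Icc (0 : R) 1, γ t ∈ Cube R n := by
    intro t ht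
    have key : ∀ i, γ t i = (1 - t) * a i + t * b i := fun i => by simp only [γ]; ring
    refine ⟨fun i => ?_, fun i => ?_⟩
    · rw [key]
      exact add_nonneg (mul_nonneg (sub_nonneg.2 ht.2) (ha.1 i)) (mul_nonneg ht.1 (hb.1 i))
    · rw [key, Pi.one_apply]
      have e1 := mul_le_mul_of_nonneg_left (ha.2 i) (sub_nonneg.2 ht.2)
      have e2 := mul_le_mul_of_nonneg_left (hb.2 i) ht.1
      simp only [Pi.one_apply] at e1 e2
      linarith
  have ht : ∀ t ∈ Icc (0 : R) 1, Filter.Tendsto γ (𝓝[Icc 0 1] t) (𝓝[Cube R n] (γ t)) :=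
    fun t _ => tendsto_nhdsWithin_iff.2 ⟨hγ.continuousWithinAt, by
      filter_upwards [self_mem_nhdsWithin] with s hs using hmem s hs⟩
  have key := dConn_of_ordConnected (L := L) (J := Icc (0 : R) 1) Set.ordConnected_Icc (γ ⁻¹' U)
    (hU.comp hγd) (fun t h h' => ht t h (h1 _ (hmem t h) h'))
    (fun t h h' => ht t h (h2 _ (hmem t h) h')) 0 ⟨le_rfl, zero_le_one⟩ 1 ⟨zero_le_one, le_rfl⟩
    (by
      have : γ 0 = a := by funext i; simp [γ]
      rwa [Set.mem_preimage, this])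
  have : γ 1 = b := by funext i; simp [γ]
  rwa [Set.mem_preimage, this] at key

/-- The set where two lifts agree is relatively clopen: at a point of agreement both stay in one
sheet, on which `p` is injective, and at a point of disagreement they lie in different, disjoint
sheets. -/
theorem IsLDCovering.lift_unique (hp : IsLDCovering p) (g g' : LDMap (cubeSpace L R n) D)
    (h : ∀ a, p (g a) = p (g' a)) {a₀ : Cube R n} (h₀ : g a₀ = g' a₀) (a : Cube R n) :
    g a = g' a := by
  classical
  obtain ⟨S, ⟨hS, -⟩, hev⟩ := hp.exists_evenlyCovered
  let ext : LDMap (cubeSpace L R n) D → (Fin n → R) → E := fun g c =>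
    if hc : c ∈ Cube R n then g ⟨c, hc⟩ else g a₀
  have hext : ∀ (g : LDMap (cubeSpace L R n) D) (a : Cube R n), ext g a = g a := fun g a =>
    dif_pos a.2
  obtain ⟨hd, hc⟩ := g.isLDMap.defMapOn_definable (isDefinable_cube L R n) (hext g)
  obtain ⟨hd', hc'⟩ := g'.isLDMap.defMapOn_definable (isDefinable_cube L R n) (hext g')
  have hpe : ∀ c ∈ Cube R n, p (ext g c) = p (ext g' c) := fun c hc => by
    rw [hext g ⟨c, hc⟩, hext g' ⟨c, hc⟩, h]
  have key := dConn_cube n {c | c ∈ Cube R n ∧ ext g c = ext g' c} (hd.eqOn hd') ?_ ?_ a₀ a₀.2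
    a a.2 ⟨a₀.2, by rw [hext, hext, h₀]⟩
  · rw [← hext, ← hext]
    exact key.2
  · rintro c hcC ⟨-, e⟩
    obtain ⟨U, hU, hcU⟩ : p (ext g c) ∈ ⋃₀ S := hS ▸ Set.mem_univ _
    obtain ⟨𝒱, h𝒱⟩ := hev U hU
    obtain ⟨V, hV, hcV⟩ := h𝒱.exists_mem hcU
    filter_upwards [self_mem_nhdsWithin, hc c hcC V (h𝒱.sheet V hV).isOpen hcV,
      hc' c hcC V (h𝒱.sheet V hV).isOpen (e ▸ hcV)] with c' h1 h2 h3
    exact ⟨h1, (h𝒱.sheet V hV).injOn h2 h3 (hpe c' h1)⟩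
  · rintro c hcC hne
    obtain ⟨U, hU, hcU⟩ : p (ext g c) ∈ ⋃₀ S := hS ▸ Set.mem_univ _
    obtain ⟨𝒱, h𝒱⟩ := hev U hU
    obtain ⟨V, hV, hcV⟩ := h𝒱.exists_mem hcU
    obtain ⟨V', hV', hcV'⟩ := h𝒱.exists_mem (hpe c hcC ▸ hcU)
    filter_upwards [hc c hcC V (h𝒱.sheet V hV).isOpen hcV,
      hc' c hcC V' (h𝒱.sheet V' hV').isOpen hcV'] with c' h2 h3 h4
    obtain rfl := h𝒱.disjoint V hV V' hV' _ h2 (h4.2 ▸ h3)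
    exact hne ⟨hcC, (h𝒱.sheet V hV).injOn hcV hcV' (hpe c hcC)⟩

/-- The lift with value `e₀` on `J` maps the remaining face into the fibre over `b₀`. Composed with
the projection `φ` to that face it lifts a constant map, so by uniqueness it is constant. -/
theorem IsLDCovering.map_surjective (hp : IsLDCovering p) {e₀ : E} {b₀ : B} (h : p e₀ = b₀) :
    Function.Surjective (HomotopyPi.map (n + 2) p h) := by
  intro c
  induction c using Quotient.inductionOn with
  | _ f =>
  obtain ⟨G, hG, hGJ⟩ := exists_lift_of_boundary (hp.isFibration _ _ _) h f.toLDMap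
    fun a ha => f.mapsTo () a ha
  have hsub : ∀ a : Cube R (n + 2), Function.update a.1 (Fin.last (n + 1)) 0 ∈ Cube R (n + 2) := by
    intro a
    refine ⟨fun i => ?_, fun i => ?_⟩
    · by_cases hi : i = Fin.last (n + 1)
      · simp [hi]
      · simpa [hi] using a.2.1 i
    · by_cases hi : i = Fin.last (n + 1)
      · simp [hi]
      · simpa [hi] using a.2.2 i
  let φ : Cube R (n + 2) → Cube R (n + 2) := fun a => ⟨_, hsub a⟩
  have hφ : IsLDMap (cubeSpace L R (n + 2)) (cubeSpace L R (n + 2)) φ := by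
    refine .of_cube (F := fun c => Function.update c (Fin.last (n + 1)) 0)
      (continuous_id.update _ continuous_const) (.pi fun i => ?_) fun _ => rfl
    by_cases hi : i = Fin.last (n + 1)
    · subst hi
      simpa using DFun.const (0 : R)
    · simpa [hi] using DFun.apply i
  have hφface : ∀ a ∈ cubeFace R (n + 2), φ a = a := by
    intro a ha
    refine Subtype.ext ?_
    have h0 : a.1 (Fin.last (n + 1)) = 0 := ha _ rfl
    change Function.update a.1 (Fin.last (n + 1)) 0 = a.1
    rw [← h0, Function.update_eq_self]
  have hφmem : ∀ a, φ a ∈ cubeBoundary R (n + 2) := fun a =>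
    ⟨Fin.last (n + 1), Or.inl (by simp [φ])⟩
  have hone : (1 : Fin (n + 2) → R) ∈ Cube R (n + 2) := ⟨zero_le_one, le_rfl⟩
  have hface : ∀ a ∈ cubeFace R (n + 2), G a = e₀ := by
    intro a ha
    -- The two lifts are compared at the corner `1`: its projection keeps the first coordinate `1`,
    -- so it lies in `J`. This needs a coordinate besides the last, that is, dimension at least two.
    have := hp.lift_unique ⟨_, G.isLDMap.comp hφ⟩ ⟨fun _ => e₀, isLDMap_const _ e₀⟩ (fun a => by
      change p (G (φ a)) = p e₀
      rw [hG, h]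
      exact f.mapsTo () _ (hφmem a)) (a₀ := ⟨1, hone⟩) (hGJ _ ⟨0, Or.inl (by simp [φ])⟩) a
    change G (φ a) = e₀ at this
    rwa [hφface a ha] at this
  refine ⟨Quotient.mk _ ⟨G, fun k a ha => ?_⟩, Quotient.sound (SystemMap.homotopic_of_eq hG)⟩
  rcases cubeBoundary_subset _ ha with ha | ha
  · exact hface a ha
  · exact hGJ a ha

/-- The homotopy lifts starting from `f₀`. Over a boundary point its path lifts a constant path and
so stays at `e₀`; its end and `f₁` lift the same map and agree at a boundary point, hence
everywhere. -/
theorem IsLDCovering.map_injective (hp : IsLDCovering p) {e₀ : E} {b₀ : B} (h : p e₀ = b₀) :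
    Function.Injective (HomotopyPi.map (n + 1) p h) := by
  intro c d hcd
  induction c using Quotient.inductionOn with
  | _ f₀ =>
  induction d using Quotient.inductionOn with
  | _ f₁ =>
  obtain ⟨H, h0, h1, hH⟩ := Quotient.exact hcd
  obtain ⟨G, hG0, hG⟩ := hp.isFibration _ _ (isDefinable_cube L R (n + 1)) f₀.toLDMap H h0
  have hbd : ∀ a ∈ cubeBoundary R (n + 1), ∀ t, G (a, t) = e₀ := by
    intro a ha t
    let j : Cube R 1 → Cube R (n + 1) × Icc (0 : R) 1 := fun s => (a, getFirst s)
    have hj : IsLDMap (cubeSpace L R 1) ((cubeSpace L R (n + 1)).prod (unitSpace L R)) j :=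
      .to_cylinder (F := fun _ => a.1) (s := fun c => c 0) continuous_const (.const _)
        (by fun_prop) (.apply _) (fun _ => rfl) fun _ => rfl
    have hzero : (0 : Fin 1 → R) ∈ Cube R 1 := ⟨le_rfl, zero_le_one⟩
    have := hp.lift_unique ⟨_, G.isLDMap.comp hj⟩ ⟨fun _ => e₀, isLDMap_const _ e₀⟩ (fun s => by
      change p (G (j s)) = p e₀
      rw [hG, h]
      exact hH () a ha _) (a₀ := ⟨0, hzero⟩)
      ((hG0 a).trans (f₀.mapsTo () a ha)) ⟨fun _ => t, fun _ => t.2.1, fun _ => t.2.2⟩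
    exact this
  refine Quotient.sound ⟨G, hG0, fun a => ?_, fun k a ha t => hbd a ha t⟩
  have hj : IsLDMap (cubeSpace L R (n + 1)) ((cubeSpace L R (n + 1)).prod (unitSpace L R))
      fun a => (a, 1) :=
    .to_cylinder (F := fun c => c) (s := fun _ => 1) continuous_id .id continuous_const
      (.const _) (fun _ => rfl) fun _ => rfl
  have hzero : (0 : Fin (n + 1) → R) ∈ Cube R (n + 1) := ⟨le_rfl, zero_le_one⟩
  have hmem : (⟨0, hzero⟩ : Cube R (n + 1)) ∈ cubeBoundary R (n + 1) := ⟨0, Or.inl rfl⟩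
  exact hp.lift_unique ⟨_, G.isLDMap.comp hj⟩ f₁.toLDMap (fun a => (hG _).trans (h1 a))
    (a₀ := ⟨0, hzero⟩) ((hbd _ hmem 1).trans (f₁.mapsTo () _ hmem).symm) a

end Homotopy

theorem mainTheorem10 {L : FirstOrder.Language} {R : Type*} [Field R] [LinearOrder R]
    [IsStrictOrderedRing R] [IsRealClosed R] [TopologicalSpace R] [OrderTopology R]
    [L.Structure R] [IsOMinimalExpansion L R] {E B : Type*}
    (DE : LocDefSpace L R E) (DB : LocDefSpace L R B)
    (hE : DE.IsLDSpace) (hB : DB.IsLDSpace) (p : LDMap DE DB) :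
    (IsSerreFibration p → ∀ (b₀ : B) (e₀ : p ⁻¹' {b₀}),
      Function.Bijective (RelHomotopyPi.map 1 p b₀ e₀) ∧
      ∀ n : ℕ, ∃ φ : RelHomotopyPi DE (n + 2) (p ⁻¹' {b₀}) e₀ ≃* HomotopyPi DB (n + 2) b₀,
        ∀ c, φ c = RelHomotopyPi.map (n + 2) p b₀ e₀ c) ∧
    (IsLDCovering p → IsFibration p) ∧
    (IsLDCovering p → ∀ (e₀ : E) (b₀ : B) (h : p e₀ = b₀),
      (∀ n : ℕ, ∃ φ : HomotopyPi DE (n + 2) e₀ ≃* HomotopyPi DB (n + 2) b₀,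
        ∀ c, φ c = HomotopyPi.map (n + 2) p h c) ∧
      Function.Injective (HomotopyPi.map 1 p h)) := by
  refine ⟨fun hp b₀ e₀ => ?_, fun hp => hp.isFibration, fun hp e₀ b₀ h => ⟨fun n => ?_, ?_⟩⟩
  -- In dimension `n + 1`, surjectivity uses lifting on the cube of that dimension and injectivity
  -- lifting on the cube of dimension `n + 2`.
  · have hbij : ∀ n, Function.Bijective (RelHomotopyPi.map (n + 1) p b₀ e₀) := fun n =>
      ⟨RelHomotopyPi.map_injective (hp.hasHomotopyLifting_cube _) b₀ e₀,
        RelHomotopyPi.map_surjective (hp.hasHomotopyLifting_cube _) b₀ e₀⟩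
    refine ⟨hbij 0, fun n => ⟨MulEquiv.ofBijective
      (MonoidHom.mk' (RelHomotopyPi.map (n + 2) p b₀ e₀) (RelHomotopyPi.map_mul p b₀ e₀))
      (hbij (n + 1)), fun _ => rfl⟩⟩
  · exact ⟨MulEquiv.ofBijective
      (MonoidHom.mk' (HomotopyPi.map (n + 2) p h) (HomotopyPi.map_mul p h))
      ⟨hp.map_injective h, hp.map_surjective h⟩, fun _ => rfl⟩
  · exact hp.map_injective h
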